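/- Let $c\ge 0$. For $N\ge 1$ let $P_N$ be the $\beta$-ensemble on $\mathbb R^N$ with $\beta=2c/N$, $$P_N(dx)=\frac1{Z_N}\prod_{i<j}|x_i-x_j|^{2c/N}\,e^{-\frac12\sum_i x_i^2}\,dx .$$ Here $0<Z_N<\infty$, so $P_N$ is a probability measure. It is a (weak) solution of the stationary Fokker–Planck equation of the dynamics $dx_i=-\frac12x_i\,dt+\frac cN\sum_{j\ne i}\frac{dt}{x_i-x_j}+db_i$: with $$L_Nf=\sum_i\Big(\tfrac12\partial_i^2f-\tfrac12x_i\,\partial_if+\tfrac cN\sum_{j\neq i}\frac{\partial_if}{x_i-x_j}\Big),$$ $L_Nf$ is $P_N$-integrable and $\int L_Nf\,dP_N=0$ for every compactly supported $C^2$ function $f$ on $\mathbb R^N$. Let $D_\nu$ denote the parabolic cylinder function, $$D_\nu(z)=2^{\nu/2}e^{-z^2/4}\Big(\tfrac{\sqrt\pi}{\Gamma((1-\nu)/2)}\,{}_1F_1\big(-\tfrac\nu2;\tfrac12;\tfrac{z^2}2\big)-\tfrac{\sqrt{2\pi}\,z}{\Gamma(-\nu/2)}\,{}_1F_1\big(\tfrac{1-\nu}2;\tfrac32;\tfrac{z^2}2\big)\Big),$$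 where $1/\Gamma$ is extended by $0$ to the poles of $\Gamma$. For $c>0$ and $z\in\mathbb C$, $$D_{-c}(z)=\frac{e^{-z^2/4}}{\Gamma(c)}\int_0^\infty e^{-zx-x^2/2}x^{c-1}\,dx,$$ the integral being absolutely convergent. For every $c\ge0$, $D_{-c}(i\lambda)\ne0$ for all real $\lambda$. Put $$\rho_c(\lambda)=\frac1{\sqrt{2\pi}\,\Gamma(1+c)\,|D_{-c}(i\lambda)|^2},\qquad \lambda\in\mathbb R .$$ 1. (Limiting stationary density.) $\rho_c$ is a probability density, and if $x$ has law $P_N$ then, as $N\to\infty$, the empirical measure $\frac1N\sum_i\delta_{x_i}$ converges weakly, in probability, to $\rho_c(\lambda)\,d\lambda$: for every bounded continuous $f$ and every $\varepsilon>0$, $P_N\big(|\frac1N\sum_if(x_i)-\int f\rho_c\,d\lambda|\ge\varepsilon\big)\to0$. The density with this property is unique up to equality almost everywhere. 2. (Riccati equation.) The Stieltjes transform $G(z)=\int\frac{\rho_c(\lambda)}{\lambda-z}\,d\lambda$, $z\in\mathbb C\setminus\mathbb R$, is holomorphic and satisfies $$c\,G^2+zG+G'=-1\quad\text{on }\mathbb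 C\setminus\mathbb R,\qquad G(z)\sim-\frac1z\quad\text{as }|z|\to\infty,\ z\in\mathbb C\setminus\mathbb R,$$ and it is the only holomorphic function on $\mathbb C\setminus\mathbb R$ with these two properties. The density is recovered by $\rho_c(\lambda)=\lim_{\varepsilon\downarrow0}\frac1\pi\,\mathrm{Im}\,G(\lambda+i\varepsilon)$ for every $\lambda\in\mathbb R$. 3. (Interpolation.) For each $\lambda\in\mathbb R$ the map $c\mapsto\rho_c(\lambda)$ is continuous on $[0,\infty)$; $\rho_0(\lambda)=e^{-\lambda^2/2}/\sqrt{2\pi}$; and for every $x\in\mathbb R$, $$\sqrt c\,\rho_c(\sqrt c\,x)\longrightarrow\frac1{2\pi}\sqrt{(4-x^2)_+}\qquad(c\to\infty).$$ -/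

import Mathlib

open MeasureTheory Filter Topology Asymptotics

noncomputable section

/-! ### Parabolic cylinder functions -/

/-- Kummer's confluent hypergeometric function `₁F₁(a; b; z) = ∑ (a)ₙ / (b)ₙ * zⁿ / n!`. -/
def kummerM (a b z : ℂ) : ℂ :=
  ∑' n : ℕ, (ascPochhammer ℂ n).eval a / (ascPochhammer ℂ n).eval b * z ^ n / (n.factorial : ℂ)

/-- Whittaker's parabolic cylinder function `D_ν(z)`, for every complex order `ν`:
`2^(ν/2) e^(-z²/4) (√π/Γ((1-ν)/2) ₁F₁(-ν/2; 1/2; z²/2) - √(2π) z/Γ(-ν/2) ₁F₁((1-ν)/2; 3/2; z²/2))`.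
At the poles of `Γ`, Mathlib's conventions give `(Γ s)⁻¹ = 0`, which is the value of the entire
function `1/Γ` there. -/
def parabolicCylinderD (ν z : ℂ) : ℂ :=
  (2 : ℂ) ^ (ν / 2) * Complex.exp (-z ^ 2 / 4) *
    ((Real.sqrt Real.pi : ℂ) * (Complex.Gamma ((1 - ν) / 2))⁻¹ * kummerM (-ν / 2) (1 / 2) (z ^ 2 / 2)
      - (Real.sqrt (2 * Real.pi) : ℂ) * z * (Complex.Gamma (-ν / 2))⁻¹ *
        kummerM ((1 - ν) / 2) (3 / 2) (z ^ 2 / 2))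

/-- The Gauss-Wigner crossover density
`ρ_c(l) = 1 / (√(2π) Γ(1+c) |D_{-c}(i l)|²)`. -/
def crossoverDensity (c l : ℝ) : ℝ :=
  1 / (Real.sqrt (2 * Real.pi) * Real.Gamma (1 + c) *
    ‖parabolicCylinderD (-(c : ℂ)) (Complex.I * (l : ℂ))‖ ^ 2)

/-! ### The stationary law of the eigenvalues at inverse temperature `β = 2c/N` -/

/-- The Boltzmann weight `∏_{i<j} |xᵢ - xⱼ|^β exp(-½ ∑ xᵢ²)` with `β = 2c/N`. -/
def gibbsWeight (c : ℝ) (N : ℕ) (x : Fin N → ℝ) : ℝ :=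
  (∏ i : Fin N, ∏ j ∈ Finset.Ioi i, |x i - x j| ^ (2 * c / (N : ℝ))) *
    Real.exp (-(1 / 2) * ∑ i : Fin N, x i ^ 2)

/-- The partition function. -/
def partitionFunction (c : ℝ) (N : ℕ) : ℝ := ∫ x : Fin N → ℝ, gibbsWeight c N x

/-- The `β`-ensemble with `β = 2c/N`: the measure whose density is the normalised weight. -/
def betaEnsemble (c : ℝ) (N : ℕ) : Measure (Fin N → ℝ) :=
  volume.withDensity fun x => ENNReal.ofReal (gibbsWeight c N x / partitionFunction c N)

/-- The partial derivative `∂ᵢ f`. -/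
def partialD {N : ℕ} (i : Fin N) (f : (Fin N → ℝ) → ℝ) (x : Fin N → ℝ) : ℝ :=
  fderiv ℝ f x (Pi.single i 1)

/-- The generator of `dxᵢ = -½ xᵢ dt + (c/N) ∑_{j ≠ i} dt/(xᵢ - xⱼ) + dbᵢ`, where the `bᵢ` are
independent standard Brownian motions. -/
def dysonGenerator (c : ℝ) (N : ℕ) (f : (Fin N → ℝ) → ℝ) (x : Fin N → ℝ) : ℝ :=
  ∑ i : Fin N, ((1 / 2) * partialD i (partialD i f) x
    + (-(1 / 2) * x i + (c / (N : ℝ)) * ∑ j ∈ Finset.univ.erase i, 1 / (x i - x j)) * partialD i f x)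

/-- `P` solves the stationary Fokker-Planck equation of the dynamics in the weak sense: the
generator applied to any test function has mean zero. -/
def IsStationaryFokkerPlanck (c : ℝ) (N : ℕ) (P : Measure (Fin N → ℝ)) : Prop :=
  ∀ f : (Fin N → ℝ) → ℝ, ContDiff ℝ 2 f → HasCompactSupport f →
    Integrable (dysonGenerator c N f) P ∧ ∫ x, dysonGenerator c N f x ∂P = 0

/-- `ρ` is the limiting stationary density: `ρ` is a probability density, and as `N → ∞` the
empirical measure `(1/N) ∑ δ_{xᵢ}` of `N` particles distributed according to the `β`-ensemble with
`β = 2c/N` converges weakly, in probability, to the measure with density `ρ`. -/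
def IsLimitingStationaryDensity (c : ℝ) (ρ : ℝ → ℝ) : Prop :=
  0 ≤ᵐ[volume] ρ ∧ Integrable ρ ∧ ∫ l, ρ l = 1 ∧
    ∀ f : BoundedContinuousFunction ℝ ℝ, ∀ ε : ℝ, 0 < ε →
      Tendsto (fun N : ℕ => betaEnsemble c N
          {x | ε ≤ |(1 / (N : ℝ)) * ∑ i : Fin N, f (x i) - ∫ l, f l * ρ l|})
        atTop (𝓝 0)

/-! ### Stieltjes transform and Riccati equation -/

/-- The Stieltjes transform `G(z) = ∫ ρ(l) / (l - z) dl`. -/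
def stieltjesTransform (ρ : ℝ → ℝ) (z : ℂ) : ℂ := ∫ l : ℝ, (ρ l : ℂ) / ((l : ℂ) - z)

/-- `G` solves `c G² + z G + G' = -1` on `ℂ ∖ ℝ`. -/
def SolvesRiccati (c : ℝ) (G : ℂ → ℂ) : Prop :=
  ∀ z : ℂ, z.im ≠ 0 → DifferentiableAt ℂ G z ∧ (c : ℂ) * G z ^ 2 + z * G z + deriv G z = -1

/-- `G(z) ~ -1/z` as `|z| → ∞` in `ℂ ∖ ℝ`. -/
def HasStieltjesDecay (G : ℂ → ℂ) : Prop :=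
  G ~[Bornology.cobounded ℂ ⊓ 𝓟 {z : ℂ | z.im ≠ 0}] fun z => -1 / z

end

/-! Special functions. Put M_s(ζ) = ∫₀^∞ e^{-ζx - x²/2} x^{s-1} dx, which is `gaussMellin ζ 1 s`.
Expanding e^{-ζx} and using Legendre duplication gives D_{-c} = e^{-ζ²/4} M_c / Γ(c) for c > 0. The
pair K = M_{c+1}, H = ζM_{c+1} + M_{c+2} makes sense for every c ≥ 0 (H = cM_c if c > 0, and H = 1
if c = 0) and satisfies K' = ζK - H, H' = -cK. Hence iK(-iz)/H(-iz) solves the Riccati equation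
wherever H(-iz) ≠ 0. On ζ = -il the function ω = Re(K·conj H) satisfies ω' = -lω, so it is an
explicit positive multiple of e^{-l²/2} (`wronskian_eq`). Therefore H has no zero on the imaginary
axis, and ρ_c(l) is the boundary value of Im G/π for this quotient G.

Probability. Integration by parts against the Boltzmann weight, justified by smoothing the
collisions, gives stationarity, the bound E ∑ xᵢ² ≤ N(1+c), and a loop equation. With R the defect
of the empirical Stieltjes transform in the Riccati equation and the test field conj(R)/(x_k - z),
it yields E|R|² = O(1/N) (`exists_integral_norm_loopDefect_sq_le`). The second moment confines the
empirical measures, up to small probability, to a compact set of probability measures, so with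
probability tending to one they avoid any closed set without Riccati solutions. Taking the whole
space as the closed set shows that a solution exists.

Identification. Along the positive imaginary axis every nonzero solution of the linearised Riccati
equation grows, so a decaying solution is unique and satisfies G(z)·H(-iz) = iK(-iz)
(`SolvesRiccatiUpper.mul_cylH`). Stieltjes inversion then forces the measure to be ρ_c dl
(`eq_crossoverMeasure`). In particular ρ_c has mass one without any direct integration, and
convergence in probability follows.

Semicircle. A convolution argument writes |M_c(-il)|² as a positive integral
(`norm_gaussMellin_sq`). After the scaling l = √c x, dominated convergence gives the limit for |x| <
2, and monotonicity in x² handles |x| ≥ 2. -/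

noncomputable section

/-! ### The integrals `∫₀^∞ e^{-a x - b x²/2} x^{s-1} dx` -/

/-- `∫₀^∞ e^{-a x - b x²/2} x^{s-1} dx`. -/
def gaussMellin (a b : ℂ) (s : ℝ) : ℂ :=
  ∫ x : ℝ in Set.Ioi 0,
    Complex.exp (-a * (x : ℂ) - b * (x : ℂ) ^ 2 / 2) * ((x ^ (s - 1) : ℝ) : ℂ)

/-- Exponential decay of the kernel `e^{-a x - b x²/2}` on `(0, ∞)`. -/
def KernelDecay (a b : ℂ) (C κ : ℝ) : Prop :=
  ∀ x : ℝ, 0 < x → -a.re * x - b.re * x ^ 2 / 2 ≤ C - κ * x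

/-- Completing the square absorbs (A+1)x into κx²/2 plus a constant; the spare unit in A+1 is the
exponential rate 1. The constants depend on `a` only through the bound A, so they serve whole
neighbourhoods of parameters. -/
lemma kernelDecay_of_re_pos {a b : ℂ} {A κ : ℝ} (hκ : 0 < κ) (ha : ‖a‖ ≤ A) (hb : κ ≤ b.re) :
    KernelDecay a b ((A + 1) ^ 2 / (2 * κ)) 1 := by
  intro x hx
  have h2 : -a.re ≤ A := (neg_le_abs _).trans ((Complex.abs_re_le_norm a).trans ha)
  have h3 : (A + 1) * x ≤ (A + 1) ^ 2 / (2 * κ) + κ * x ^ 2 / 2 := by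
    have : (A + 1) ^ 2 / (2 * κ) + κ * x ^ 2 / 2 - (A + 1) * x =
      (A + 1 - κ * x) ^ 2 / (2 * κ) := by field_simp; ring
    have := div_nonneg (sq_nonneg (A + 1 - κ * x)) (by linarith : 0 ≤ 2 * κ)
    linarith
  nlinarith [mul_le_mul_of_nonneg_right h2 hx.le, mul_le_mul_of_nonneg_right hb (sq_nonneg x)]

lemma kernelDecay_of_le_re {a b : ℂ} {κ : ℝ} (ha : κ ≤ a.re) (hb : 0 ≤ b.re) :
    KernelDecay a b 0 κ := by
  intro x hx
  nlinarith [mul_le_mul_of_nonneg_right ha hx.le, mul_nonneg hb (sq_nonneg x)]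

lemma kernelDecay_one (a : ℂ) : KernelDecay a 1 ((‖a‖ + 1) ^ 2 / (2 * 1)) 1 :=
  kernelDecay_of_re_pos one_pos le_rfl (by simp)

lemma norm_gaussMellin_integrand (a b : ℂ) (s : ℝ) {x : ℝ} (hx : 0 < x) :
    ‖Complex.exp (-a * (x : ℂ) - b * (x : ℂ) ^ 2 / 2) * ((x ^ (s - 1) : ℝ) : ℂ)‖ =
      Real.exp (-a.re * x - b.re * x ^ 2 / 2) * x ^ (s - 1) := by
  rw [norm_mul, Complex.norm_exp, Complex.norm_real, Real.norm_of_nonneg (Real.rpow_nonneg hx.le _)]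
  congr 2
  rw [← Complex.ofReal_pow]
  simp [-Complex.ofReal_pow]

lemma norm_gaussMellin_integrand_le {a b : ℂ} {C κ : ℝ} (h : KernelDecay a b C κ) (s : ℝ) {x : ℝ}
    (hx : 0 < x) :
    ‖Complex.exp (-a * (x : ℂ) - b * (x : ℂ) ^ 2 / 2) * ((x ^ (s - 1) : ℝ) : ℂ)‖ ≤
      Real.exp C * (x ^ (s - 1) * Real.exp (-κ * x)) := by
  rw [norm_gaussMellin_integrand a b s hx, mul_comm, mul_left_comm, ← Real.exp_add]
  gcongr
  linarith [h x hx]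

lemma integrableOn_rpow_mul_exp_neg_mul {κ s : ℝ} (hκ : 0 < κ) (hs : 0 < s) :
    IntegrableOn (fun x : ℝ => x ^ (s - 1) * Real.exp (-κ * x)) (Set.Ioi 0) := by
  simpa using integrableOn_rpow_mul_exp_neg_mul_rpow (s := s - 1) (by linarith) one_pos hκ

lemma aestronglyMeasurable_gaussMellin_integrand (a b : ℂ) (s : ℝ) :
    AEStronglyMeasurable
      (fun x : ℝ => Complex.exp (-a * (x : ℂ) - b * (x : ℂ) ^ 2 / 2) * ((x ^ (s - 1) : ℝ) : ℂ))
      (volume.restrict (Set.Ioi 0)) := by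
  apply Measurable.aestronglyMeasurable
  fun_prop

lemma integrableOn_gaussMellin {a b : ℂ} {C κ : ℝ} (h : KernelDecay a b C κ) (hκ : 0 < κ) {s : ℝ}
    (hs : 0 < s) :
    IntegrableOn
      (fun x : ℝ => Complex.exp (-a * (x : ℂ) - b * (x : ℂ) ^ 2 / 2) * ((x ^ (s - 1) : ℝ) : ℂ))
      (Set.Ioi 0) := by
  refine Integrable.mono' ((integrableOn_rpow_mul_exp_neg_mul hκ hs).const_mul (Real.exp C))
    (aestronglyMeasurable_gaussMellin_integrand a b s) ?_
  filter_upwards [ae_restrict_mem measurableSet_Ioi] with x hx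
  exact norm_gaussMellin_integrand_le h s hx

lemma rpow_mul_pow_ofReal {x : ℝ} (hx : 0 < x) (s : ℝ) :
    ((x ^ (s + 1 - 1) : ℝ) : ℂ) = (x : ℂ) * ((x ^ (s - 1) : ℝ) : ℂ) ∧
    ((x ^ (s + 2 - 1) : ℝ) : ℂ) = (x : ℂ) ^ 2 * ((x ^ (s - 1) : ℝ) : ℂ) := by
  constructor
  · rw [show s + 1 - 1 = (s - 1) + 1 by ring, Real.rpow_add_one hx.ne']; push_cast; ring
  · rw [show s + 2 - 1 = (s - 1) + 1 + 1 by ring, Real.rpow_add_one hx.ne',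
      Real.rpow_add_one hx.ne']; push_cast; ring

/-- Differentiation under the integral: the derivative brings down factors x and x², which shift s
by 1 and by 2. The field is left general because the parameters move both holomorphically and along
a real path of rotations. -/
lemma hasDerivAt_gaussMellin {𝕜 : Type*} [RCLike 𝕜] [NormedAlgebra 𝕜 ℂ] {a b a' b' : 𝕜 → ℂ}
    {U : Set 𝕜} {t : 𝕜} (hU : U ∈ 𝓝 t) {A C κ : ℝ} (hκ : 0 < κ)
    (ha : ∀ u ∈ U, HasDerivAt a (a' u) u) (hb : ∀ u ∈ U, HasDerivAt b (b' u) u)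
    (hA' : ∀ u ∈ U, ‖a' u‖ ≤ A) (hB' : ∀ u ∈ U, ‖b' u‖ ≤ A)
    (hB : ∀ u ∈ U, KernelDecay (a u) (b u) C κ) {s : ℝ} (hs : 0 < s) :
    HasDerivAt (fun u => gaussMellin (a u) (b u) s)
      (-a' t * gaussMellin (a t) (b t) (s + 1) - b' t / 2 * gaussMellin (a t) (b t) (s + 2)) t := by
  have htU := mem_of_mem_nhds hU
  have hbt := hB t htU
  have hA0 : 0 ≤ A := (norm_nonneg _).trans (hA' t htU)
  have key := hasDerivAt_integral_of_dominated_loc_of_deriv_le (𝕜 := 𝕜) (E := ℂ)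
    (μ := volume.restrict (Set.Ioi (0 : ℝ))) (x₀ := t) (s := U)
    (F := fun u x => Complex.exp (-a u * (x : ℂ) - b u * (x : ℂ) ^ 2 / 2) *
      ((x ^ (s - 1) : ℝ) : ℂ))
    (F' := fun u x =>
      -a' u * (Complex.exp (-a u * (x : ℂ) - b u * (x : ℂ) ^ 2 / 2) * ((x ^ (s + 1 - 1) : ℝ) : ℂ))
      - b' u / 2 *
        (Complex.exp (-a u * (x : ℂ) - b u * (x : ℂ) ^ 2 / 2) * ((x ^ (s + 2 - 1) : ℝ) : ℂ)))
    (bound := fun x => A * (Real.exp C * (x ^ (s + 1 - 1) * Real.exp (-κ * x)))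
      + A * (Real.exp C * (x ^ (s + 2 - 1) * Real.exp (-κ * x)))) hU
    (Eventually.of_forall fun u => aestronglyMeasurable_gaussMellin_integrand _ _ _)
    (integrableOn_gaussMellin hbt hκ hs)
    (((aestronglyMeasurable_gaussMellin_integrand _ _ _).const_mul _).sub
      ((aestronglyMeasurable_gaussMellin_integrand _ _ _).const_mul _))
    ?_ ?_ ?_
  · have h := key.2
    rw [integral_sub, integral_const_mul, integral_const_mul] at h
    · exact h
    · exact (integrableOn_gaussMellin hbt hκ (by linarith)).const_mul _
    · exact (integrableOn_gaussMellin hbt hκ (by linarith)).const_mul _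
  · filter_upwards [ae_restrict_mem measurableSet_Ioi] with x hx u hu
    refine (norm_sub_le _ _).trans (add_le_add ?_ ?_)
    · rw [norm_mul, norm_neg]
      exact mul_le_mul (hA' u hu) (norm_gaussMellin_integrand_le (hB u hu) _ hx)
        (norm_nonneg _) hA0
    · rw [norm_mul]
      refine mul_le_mul ?_ (norm_gaussMellin_integrand_le (hB u hu) _ hx)
        (norm_nonneg _) hA0
      rw [norm_div, Complex.norm_ofNat]
      linarith [hB' u hu, norm_nonneg (b' u)]
  · refine Integrable.add ?_ ?_
    · exact ((integrableOn_rpow_mul_exp_neg_mul hκ (by linarith)).const_mul _).const_mul _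
    · exact ((integrableOn_rpow_mul_exp_neg_mul hκ (by linarith)).const_mul _).const_mul _
  · filter_upwards [ae_restrict_mem measurableSet_Ioi] with x hx u hu
    obtain ⟨h1, h2⟩ := rpow_mul_pow_ofReal hx s
    have he : HasDerivAt (fun u => -a u * (x : ℂ) - b u * (x : ℂ) ^ 2 / 2)
        (-a' u * (x : ℂ) - b' u * (x : ℂ) ^ 2 / 2) u :=
      ((ha u hu).neg.mul_const (x : ℂ)).sub (((hb u hu).mul_const ((x : ℂ) ^ 2)).div_const 2)
    refine (he.cexp.mul_const ((x ^ (s - 1) : ℝ) : ℂ)).congr_deriv ?_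
    rw [h1, h2]
    ring

/-- Integrate the derivative of e^{-ax - bx²/2} x^s over (0, ∞); both boundary terms vanish, at 0
because s > 0. -/
lemma gaussMellin_recurrence {a b : ℂ} {C κ : ℝ} (h : KernelDecay a b C κ) (hκ : 0 < κ) {s : ℝ}
    (hs : 0 < s) :
    s * gaussMellin a b s = a * gaussMellin a b (s + 1) + b * gaussMellin a b (s + 2) := by
  have hlim : Tendsto (fun x : ℝ => Complex.exp (-a * (x : ℂ) - b * (x : ℂ) ^ 2 / 2) *
      ((x ^ s : ℝ) : ℂ)) atTop (𝓝 0) := by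
    rw [tendsto_zero_iff_norm_tendsto_zero]
    have h0 : Tendsto (fun x : ℝ => Real.exp C * (x ^ (s + 1 - 1) * Real.exp (-κ * x))) atTop
        (𝓝 0) := by
      rw [← mul_zero (Real.exp C)]
      exact (tendsto_rpow_mul_exp_neg_mul_atTop_nhds_zero _ κ hκ).const_mul _
    refine squeeze_zero' (Eventually.of_forall fun _ => norm_nonneg _) ?_ h0
    filter_upwards [eventually_gt_atTop 0] with x hx
    simpa using norm_gaussMellin_integrand_le h (s + 1) hx
  have i0 := (integrableOn_gaussMellin h hκ hs).const_mul (s : ℂ)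
  have i1 := (integrableOn_gaussMellin h hκ (s := s + 1) (by linarith)).const_mul a
  have i2 := (integrableOn_gaussMellin h hκ (s := s + 2) (by linarith)).const_mul b
  have key := integral_Ioi_of_hasDerivAt_of_tendsto (a := (0 : ℝ)) (m := (0 : ℂ))
    (f := fun x : ℝ => Complex.exp (-a * (x : ℂ) - b * (x : ℂ) ^ 2 / 2) * ((x ^ s : ℝ) : ℂ))
    (f' := fun x : ℝ =>
      s * (Complex.exp (-a * (x : ℂ) - b * (x : ℂ) ^ 2 / 2) * ((x ^ (s - 1) : ℝ) : ℂ)) -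
      a * (Complex.exp (-a * (x : ℂ) - b * (x : ℂ) ^ 2 / 2) * ((x ^ (s + 1 - 1) : ℝ) : ℂ)) -
      b * (Complex.exp (-a * (x : ℂ) - b * (x : ℂ) ^ 2 / 2) * ((x ^ (s + 2 - 1) : ℝ) : ℂ)))
    ?_ ?_ ((i0.sub i1).sub i2) hlim
  · have i01 := i0.sub i1
    simp only [Pi.sub_def] at i01
    rw [integral_sub i01 i2, integral_sub i0 i1, integral_const_mul, integral_const_mul,
      integral_const_mul] at key
    simp only [Real.zero_rpow hs.ne', Complex.ofReal_zero, mul_zero, sub_zero] at key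
    simp only [gaussMellin]
    linear_combination key
  · apply ContinuousAt.continuousWithinAt
    refine ContinuousAt.mul (by fun_prop) ?_
    exact Complex.continuous_ofReal.continuousAt.comp
      (Real.continuousAt_rpow_const _ _ (Or.inr hs.le))
  · intro x hx
    obtain ⟨h1, h2⟩ := rpow_mul_pow_ofReal hx s
    have e1 : HasDerivAt (fun x : ℝ => -a * (x : ℂ) - b * (x : ℂ) ^ 2 / 2) (-a - b * x) x := by
      have hx1 : HasDerivAt (fun x : ℝ => (x : ℂ)) 1 x := Complex.ofRealCLM.hasDerivAt
      convert! (hx1.const_mul (-a)).sub (((hx1.pow 2).const_mul b).div_const 2) using 1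
      simp; ring
    have e2 : HasDerivAt (fun x : ℝ => ((x ^ s : ℝ) : ℂ)) ((s * x ^ (s - 1) : ℝ) : ℂ) x :=
      (Real.hasDerivAt_rpow_const (Or.inl (ne_of_gt hx))).ofReal_comp
    convert! e1.cexp.mul e2 using 1
    have h3 : ((x ^ s : ℝ) : ℂ) = (x : ℂ) * ((x ^ (s - 1) : ℝ) : ℂ) := by
      rw [← h1]; simp
    rw [h1, h2, h3]
    push_cast
    ring

/-- Rotation of the contour x ↦ e^{iα}x, done without Cauchy's theorem: the right side, as a
function of the angle, has derivative zero by `gaussMellin_recurrence`. -/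
lemma gaussMellin_rotate (a : ℂ) {s α : ℝ} (hs : 0 < s) (hα : |α| ≤ Real.pi / 8) :
    gaussMellin a 1 s = Complex.exp (Complex.I * α * s) *
      gaussMellin (a * Complex.exp (Complex.I * α)) (Complex.exp (2 * (Complex.I * α))) s := by
  have hre : ∀ u : ℝ, (Complex.exp (2 * (Complex.I * u))).re = Real.cos (2 * u) := fun u => by
    rw [show 2 * (Complex.I * (u : ℂ)) = ((2 * u : ℝ) : ℂ) * Complex.I by push_cast; ring,
      Complex.exp_ofReal_mul_I_re]
  have hn : ∀ u : ℝ, ‖Complex.exp (Complex.I * u)‖ = 1 := fun u => by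
    rw [mul_comm, Complex.norm_exp_ofReal_mul_I]
  have hn2 : ∀ u : ℝ, ‖Complex.exp (2 * (Complex.I * u))‖ = 1 := fun u => by
    rw [show 2 * (Complex.I * (u : ℂ)) = ((2 * u : ℝ) : ℂ) * Complex.I by push_cast; ring,
      Complex.norm_exp_ofReal_mul_I]
  have hpi := Real.pi_pos
  -- For |u| < π/6 the rotated Gaussian coefficient e^{2iu} has real part at least 1/2, so decay is
  -- uniform on U.
  set U : Set ℝ := Set.Ioo (-(Real.pi / 6)) (Real.pi / 6)
  have hcos : ∀ u ∈ U, 1 / 2 ≤ Real.cos (2 * u) := fun u hu => by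
    rw [← Real.cos_pi_div_three, ← Real.cos_abs (2 * u)]
    have : |2 * u| ≤ Real.pi / 3 := abs_le.2 ⟨by linarith [hu.1], by linarith [hu.2]⟩
    exact Real.cos_le_cos_of_nonneg_of_le_pi (abs_nonneg _) (by linarith) this
  have hI : ∀ u : ℝ, HasDerivAt (fun u : ℝ => Complex.I * (u : ℂ)) Complex.I u := fun u => by
    simpa using (Complex.ofRealCLM.hasDerivAt (x := u)).const_mul Complex.I
  have hdec : ∀ u ∈ U, KernelDecay (a * Complex.exp (Complex.I * u))
      (Complex.exp (2 * (Complex.I * u))) ((‖a‖ + 1) ^ 2 / (2 * (1 / 2))) 1 := fun u hu =>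
    kernelDecay_of_re_pos (by norm_num) (by rw [norm_mul, hn, mul_one])
      (by rw [hre]; exact hcos u hu)
  set f : ℝ → ℂ := fun u => Complex.exp (Complex.I * u * s) *
      gaussMellin (a * Complex.exp (Complex.I * u)) (Complex.exp (2 * (Complex.I * u))) s
  have hderiv : ∀ t ∈ U, HasDerivAt f 0 t := by
    intro t ht
    have hg := hasDerivAt_gaussMellin (𝕜 := ℝ) (a := fun u : ℝ => a * Complex.exp (Complex.I * u))
      (b := fun u : ℝ => Complex.exp (2 * (Complex.I * u)))
      (a' := fun u : ℝ => a * (Complex.exp (Complex.I * u) * Complex.I))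
      (b' := fun u : ℝ => Complex.exp (2 * (Complex.I * u)) * (2 * Complex.I))
      (isOpen_Ioo.mem_nhds ht : U ∈ 𝓝 t) (A := max ‖a‖ 2) (κ := 1) one_pos
      (fun u _ => ((hI u).cexp).const_mul a) (fun u _ => ((hI u).const_mul 2).cexp)
      (fun u _ => by simp [hn]) (fun u _ => by simp [hn2]) hdec hs
    have he : HasDerivAt (fun u : ℝ => Complex.exp (Complex.I * u * s))
        (Complex.exp (Complex.I * t * s) * (Complex.I * s)) t := ((hI t).mul_const (s : ℂ)).cexp
    convert! he.mul hg using 1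
    have hrec := gaussMellin_recurrence (hdec t ht) one_pos hs
    linear_combination (-Complex.exp (Complex.I * t * s) * Complex.I) * hrec
  have hconst : ∀ x ∈ U, ∀ y ∈ U, f x = f y := by
    intro x hx y hy
    refine (convex_Ioo _ _).is_const_of_fderivWithin_eq_zero (𝕜 := ℝ) (s := U)
      (fun u hu => (hderiv u hu).differentiableAt.differentiableWithinAt) (fun u hu => ?_) hx hy
    rw [fderivWithin_of_isOpen isOpen_Ioo hu]
    have := (hderiv u hu).hasFDerivAt.fderiv
    rw [this]; ext; simp
  have h0 : f 0 = gaussMellin a 1 s := by simp [f]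
  rw [← h0]
  obtain ⟨h1, h2⟩ := abs_le.1 hα
  exact hconst 0 ⟨by linarith, by linarith⟩ α ⟨by linarith, by linarith⟩

/-! ### Power series and the parabolic cylinder function -/

/-- The moments `∫₀^∞ e^{-x²/2} x^{s-1} dx`. -/
def gaussMoment (s : ℝ) : ℝ := 2 ^ (s / 2 - 1) * Real.Gamma (s / 2)

lemma gaussMoment_eq_integral {s : ℝ} (hs : 0 < s) :
    ∫ x : ℝ in Set.Ioi 0, x ^ (s - 1) * Real.exp (-(1 / 2) * x ^ 2) = gaussMoment s := by
  have := integral_rpow_mul_exp_neg_mul_rpow (p := 2) (q := s - 1) (b := 1 / 2) two_pos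
    (by linarith) (by norm_num)
  simp only [Real.rpow_two] at this
  rw [this, gaussMoment, sub_add_cancel, Real.rpow_sub two_pos, Real.rpow_one, neg_div,
    Real.rpow_neg (by norm_num), one_div, Real.inv_rpow two_pos.le, inv_inv]
  ring

lemma gaussMoment_add_two {s : ℝ} (hs : 0 < s) : gaussMoment (s + 2) = s * gaussMoment s := by
  rw [gaussMoment, gaussMoment, show (s + 2) / 2 = s / 2 + 1 by ring,
    Real.Gamma_add_one (by positivity), show s / 2 + 1 - 1 = (s / 2 - 1) + 1 by ring,
    Real.rpow_add_one two_ne_zero]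
  ring

/-- Expand e^{-ζx} and integrate term by term; the series of absolute values sums to e^{‖ζ‖x}, which
the Gaussian makes integrable. -/
lemma hasSum_gaussMellin (ζ : ℂ) {s : ℝ} (hs : 0 < s) :
    HasSum (fun n : ℕ => (-ζ) ^ n / (n.factorial : ℂ) * (gaussMoment (s + n) : ℂ))
      (gaussMellin ζ 1 s) := by
  set F : ℕ → ℝ → ℂ := fun n x => (-ζ) ^ n / (n.factorial : ℂ) *
    ((x ^ (s + n - 1) * Real.exp (-(1 / 2) * x ^ 2) : ℝ) : ℂ)
  have hint : ∀ n : ℕ, IntegrableOn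
      (fun x : ℝ => x ^ (s + n - 1) * Real.exp (-(1 / 2) * x ^ 2)) (Set.Ioi 0) := fun n =>
    integrableOn_rpow_mul_exp_neg_mul_sq (by norm_num)
      (by have : (0 : ℝ) ≤ n := n.cast_nonneg; linarith)
  have hF_int : ∀ n, Integrable (F n) (volume.restrict (Set.Ioi 0)) := fun n =>
    (hint n).ofReal.const_mul _
  have hpt : ∀ x : ℝ, 0 < x → ∀ n, F n x =
      ((-ζ * x) ^ n / (n.factorial : ℂ)) * ((x ^ (s - 1) * Real.exp (-(1 / 2) * x ^ 2) : ℝ) : ℂ) := by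
    intro x hx n
    simp only [F]
    rw [show s + n - 1 = (s - 1) + n by ring, Real.rpow_add_natCast hx.ne']
    push_cast
    ring
  have hnorm : ∀ x : ℝ, 0 < x → ∀ n, ‖F n x‖ =
      ((‖ζ‖ * x) ^ n / (n.factorial : ℝ)) * (x ^ (s - 1) * Real.exp (-(1 / 2) * x ^ 2)) := by
    intro x hx n
    rw [hpt x hx, norm_mul, Complex.norm_real, Real.norm_of_nonneg (by positivity)]
    simp [abs_of_pos hx]
  have hsumint : ∀ x : ℝ, 0 < x → HasSum (fun n => ‖F n x‖)
      (Real.exp (‖ζ‖ * x) * (x ^ (s - 1) * Real.exp (-(1 / 2) * x ^ 2))) := by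
    intro x hx
    simp_rw [hnorm x hx]
    refine HasSum.mul_right _ ?_
    rw [Real.exp_eq_exp_ℝ]
    exact NormedSpace.expSeries_div_hasSum_exp (𝔸 := ℝ) _
  have hbd : IntegrableOn (fun x : ℝ => Real.exp (‖ζ‖ * x) *
      (x ^ (s - 1) * Real.exp (-(1 / 2) * x ^ 2))) (Set.Ioi 0) := by
    -- The dominating function is the norm of the same kind of integrand, taken at a = -‖ζ‖.
    have := (integrableOn_gaussMellin (kernelDecay_one (-(‖ζ‖ : ℂ))) one_pos hs).norm
    refine this.congr ?_
    filter_upwards [ae_restrict_mem measurableSet_Ioi] with x hx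
    rw [norm_mul, Complex.norm_exp, Complex.norm_real,
      Real.norm_of_nonneg (Real.rpow_nonneg (le_of_lt hx) _)]
    rw [mul_left_comm, ← Real.exp_add, mul_comm]
    congr 2
    rw [← Complex.ofReal_pow]
    simp [-Complex.ofReal_pow]
    ring
  have hsum : Summable fun n => ∫ x in Set.Ioi (0 : ℝ), ‖F n x‖ := by
    refine summable_of_sum_range_le
      (c := ∫ x in Set.Ioi (0 : ℝ), Real.exp (‖ζ‖ * x) *
      (x ^ (s - 1) * Real.exp (-(1 / 2) * x ^ 2)))
      (fun n => integral_nonneg fun x => norm_nonneg _) fun n => ?_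
    rw [← integral_finsetSum _ fun i _ => (hF_int i).norm]
    refine setIntegral_mono_on (integrable_finsetSum _ fun i _ => (hF_int i).norm) hbd
      measurableSet_Ioi fun x hx => ?_
    exact sum_le_hasSum _ (fun _ _ => norm_nonneg _) (hsumint x hx)
  have key := hasSum_integral_of_summable_integral_norm hF_int hsum
  have e1 : ∫ x in Set.Ioi (0 : ℝ), ∑' n, F n x = gaussMellin ζ 1 s := by
    refine setIntegral_congr_fun measurableSet_Ioi fun x hx => ?_
    simp_rw [hpt x hx]
    rw [tsum_mul_right, show ∑' n : ℕ, (-ζ * x) ^ n / (n.factorial : ℂ) = Complex.exp (-ζ * x) by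
      rw [Complex.exp_eq_exp_ℂ]
      exact (NormedSpace.expSeries_div_hasSum_exp (𝔸 := ℂ) _).tsum_eq]
    rw [sub_eq_add_neg (-ζ * (x : ℂ)), Complex.exp_add]
    push_cast
    rw [mul_comm (((x ^ (s - 1) : ℝ)) : ℂ), ← mul_assoc]
    congr 3
    ring
  rw [e1] at key
  refine key.congr_fun fun n => ?_
  simp only [F]
  rw [integral_const_mul, integral_complex_ofReal, gaussMoment_eq_integral (by positivity)]

lemma gaussMellin_zero {s : ℝ} (hs : 0 < s) : gaussMellin 0 1 s = gaussMoment s := by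
  have h := hasSum_gaussMellin 0 hs
  have h2 : HasSum (fun n : ℕ => (-(0 : ℂ)) ^ n / (n.factorial : ℂ) * (gaussMoment (s + n) : ℂ))
      ((-(0 : ℂ)) ^ 0 / ((0 : ℕ).factorial : ℂ) * (gaussMoment (s + (0 : ℕ)) : ℂ)) :=
    hasSum_single 0 fun n hn => by simp [hn]
  rw [h.unique h2]
  simp

/-- A hypergeometric series is determined by its first term and its ratio of consecutive terms. -/
lemma eq_mul_kummerM_term {a b w : ℂ} (hb : ∀ k : ℕ, b + k ≠ 0) {u : ℕ → ℂ}
    (hu : ∀ k : ℕ, u (k + 1) * ((b + k) * (k + 1)) = u k * ((a + k) * w)) (k : ℕ) :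
    u k = u 0 * ((ascPochhammer ℂ k).eval a / (ascPochhammer ℂ k).eval b * w ^ k /
      (k.factorial : ℂ)) := by
  have hasc : ∀ n : ℕ, (ascPochhammer ℂ n).eval b ≠ 0 := by
    intro n
    induction n with
    | zero => simp
    | succ n ih => rw [ascPochhammer_succ_eval]; exact mul_ne_zero ih (hb n)
  induction k with
  | zero => simp
  | succ k ih =>
    have h1 : ((k : ℂ) + 1) ≠ 0 := by norm_cast
    have h2 := hb k
    have h3 := hasc k
    have h4 : (k.factorial : ℂ) ≠ 0 := by exact_mod_cast k.factorial_ne_zero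
    have h5 : u (k + 1) = u k * ((a + k) * w) / ((b + k) * (k + 1)) := by
      rw [← hu, mul_div_cancel_right₀ _ (mul_ne_zero h2 h1)]
    rw [h5, ih, ascPochhammer_succ_eval, ascPochhammer_succ_eval, Nat.factorial_succ]
    push_cast
    field_simp
    ring

/-- The relation `gaussMoment_add_two` turns the ratio of every second Taylor term into a Kummer
ratio. -/
lemma gaussMellin_even_term (ζ : ℂ) {s : ℝ} (hs : 0 < s) (k : ℕ) :
    (-ζ) ^ (2 * k) / ((2 * k).factorial : ℂ) * (gaussMoment (s + (2 * k : ℕ)) : ℂ) =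
      gaussMoment s * ((ascPochhammer ℂ k).eval ((s : ℂ) / 2) /
        (ascPochhammer ℂ k).eval (1 / 2 : ℂ) * (ζ ^ 2 / 2) ^ k / (k.factorial : ℂ)) := by
  have hne : ∀ k : ℕ, (2 * (k : ℂ) + 1) ≠ 0 ∧ (2 * (k : ℂ) + 1 + 1) ≠ 0 := by
    intro k; constructor <;> norm_cast
  have := eq_mul_kummerM_term (a := s / 2) (b := 1 / 2) (w := ζ ^ 2 / 2)
    (u := fun k => (-ζ) ^ (2 * k) / ((2 * k).factorial : ℂ) *
      (gaussMoment (s + (2 * k : ℕ)) : ℂ)) ?_ ?_ k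
  · simpa using this
  · intro k h
    exact (hne k).1 (by linear_combination 2 * h)
  · intro k
    have e1 : gaussMoment (s + (2 * (k + 1) : ℕ)) =
        (s + (2 * k : ℕ)) * gaussMoment (s + (2 * k : ℕ)) := by
      rw [← gaussMoment_add_two (by positivity)]
      congr 1; push_cast; ring
    have h4 : ((2 * k).factorial : ℂ) ≠ 0 := by exact_mod_cast (2 * k).factorial_ne_zero
    obtain ⟨h1, h2⟩ := hne k
    simp only [e1]
    rw [show 2 * (k + 1) = 2 * k + 1 + 1 by ring, Nat.factorial_succ, Nat.factorial_succ]
    generalize gaussMoment (s + (2 * k : ℕ)) = m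
    push_cast
    field_simp
    ring

lemma gaussMellin_odd_term (ζ : ℂ) {s : ℝ} (hs : 0 < s) (k : ℕ) :
    (-ζ) ^ (2 * k + 1) / ((2 * k + 1).factorial : ℂ) *
        (gaussMoment (s + (2 * k + 1 : ℕ)) : ℂ) =
      -ζ * gaussMoment (s + 1) * ((ascPochhammer ℂ k).eval (((s : ℂ) + 1) / 2) /
        (ascPochhammer ℂ k).eval (3 / 2 : ℂ) * (ζ ^ 2 / 2) ^ k / (k.factorial : ℂ)) := by
  have hne : ∀ k : ℕ, (2 * (k : ℂ) + 1 + 1) ≠ 0 ∧ (2 * (k : ℂ) + 1 + 1 + 1) ≠ 0 := by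
    intro k; constructor <;> norm_cast
  have := eq_mul_kummerM_term (a := (s + 1) / 2) (b := 3 / 2) (w := ζ ^ 2 / 2)
    (u := fun k => (-ζ) ^ (2 * k + 1) / ((2 * k + 1).factorial : ℂ) *
      (gaussMoment (s + (2 * k + 1 : ℕ)) : ℂ)) ?_ ?_ k
  · simpa using this
  · intro k h
    exact (hne k).2 (by linear_combination 2 * h)
  · intro k
    have e1 : gaussMoment (s + (2 * (k + 1) + 1 : ℕ)) =
        (s + (2 * k + 1 : ℕ)) * gaussMoment (s + (2 * k + 1 : ℕ)) := by
      rw [← gaussMoment_add_two (by positivity)]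
      congr 1; push_cast; ring
    have h4 : ((2 * k + 1).factorial : ℂ) ≠ 0 := by exact_mod_cast (2 * k + 1).factorial_ne_zero
    obtain ⟨h1, h2⟩ := hne k
    simp only [e1]
    rw [show 2 * (k + 1) + 1 = 2 * k + 1 + 1 + 1 by ring, Nat.factorial_succ (2 * k + 1 + 1),
      Nat.factorial_succ (2 * k + 1)]
    generalize gaussMoment (s + (2 * k + 1 : ℕ)) = m
    push_cast
    field_simp
    ring

lemma gaussMellin_eq_kummerM (ζ : ℂ) {s : ℝ} (hs : 0 < s) :
    gaussMellin ζ 1 s = gaussMoment s * kummerM (s / 2) (1 / 2) (ζ ^ 2 / 2) -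
      ζ * gaussMoment (s + 1) * kummerM ((s + 1) / 2) (3 / 2) (ζ ^ 2 / 2) := by
  obtain ⟨f, hf⟩ : ∃ f : ℕ → ℂ, ∀ n : ℕ, f n = (-ζ) ^ n / (n.factorial : ℂ) *
    (gaussMoment (s + n) : ℂ) := ⟨_, fun _ => rfl⟩
  have h : HasSum f (gaussMellin ζ 1 s) := (hasSum_gaussMellin ζ hs).congr_fun fun n => hf n
  have he : Summable fun k => f (2 * k) :=
    h.summable.comp_injective (mul_right_injective₀ two_ne_zero)
  have ho : Summable fun k => f (2 * k + 1) :=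
    h.summable.comp_injective (i := fun k => 2 * k + 1)
      ((add_left_injective 1).comp (mul_right_injective₀ two_ne_zero))
  rw [← h.tsum_eq, ← tsum_even_add_odd he ho]
  have e1 := fun k => (hf (2 * k)).trans (gaussMellin_even_term ζ hs k)
  have e2 := fun k => (hf (2 * k + 1)).trans (gaussMellin_odd_term ζ hs k)
  rw [tsum_congr e1, tsum_congr e2, tsum_mul_left, tsum_mul_left, kummerM, kummerM]
  ring

/-! ### The first-order system for the cylinder functions -/

lemma hasDerivAt_gaussMellin_one (ζ : ℂ) {s : ℝ} (hs : 0 < s) :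
    HasDerivAt (fun ζ => gaussMellin ζ 1 s) (-gaussMellin ζ 1 (s + 1)) ζ := by
  have := hasDerivAt_gaussMellin (𝕜 := ℂ) (a := id) (a' := fun _ => 1) (b := fun _ => 1)
    (b' := fun _ => 0) (U := Metric.ball ζ 1) (t := ζ) (Metric.ball_mem_nhds _ one_pos)
    (A := 1) (κ := 1) one_pos (fun u _ => hasDerivAt_id u) (fun u _ => hasDerivAt_const _ _)
    (fun u _ => by simp) (fun u _ => by simp)
    (fun u hu => kernelDecay_of_re_pos (A := ‖ζ‖ + 1) one_pos (by
      have := norm_le_norm_add_norm_sub' u ζ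
      rw [mem_ball_iff_norm] at hu
      simp only [id]; linarith) (by simp)) hs
  simpa using this

/-- `M_{c+1}(ζ)`, a multiple of `e^{ζ²/4} D_{-c-1}(ζ)`. -/
def cylK (c : ℝ) (ζ : ℂ) : ℂ := gaussMellin ζ 1 (c + 1)

/-- `ζ M_{c+1}(ζ) + M_{c+2}(ζ)`, a multiple of `e^{ζ²/4} D_{-c}(ζ)` which makes sense for `c = 0`
too. -/
def cylH (c : ℝ) (ζ : ℂ) : ℂ := ζ * gaussMellin ζ 1 (c + 1) + gaussMellin ζ 1 (c + 2)

lemma hasDerivAt_cylK {c : ℝ} (hc : 0 ≤ c) (ζ : ℂ) :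
    HasDerivAt (cylK c) (ζ * cylK c ζ - cylH c ζ) ζ := by
  refine (hasDerivAt_gaussMellin_one ζ (s := c + 1) (by linarith)).congr_deriv ?_
  rw [cylK, cylH, show c + 1 + 1 = c + 2 by ring]
  ring

/-- Direct differentiation gives M_{c+1} - ζM_{c+2} - M_{c+3}, and the recurrence at s = c+1
replaces the last two terms by -(c+1)M_{c+1}. With `hasDerivAt_cylK` this closes the linear system
behind the Riccati equation. -/
lemma hasDerivAt_cylH {c : ℝ} (hc : 0 ≤ c) (ζ : ℂ) :
    HasDerivAt (cylH c) (-c * cylK c ζ) ζ := by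
  have h1 := hasDerivAt_gaussMellin_one ζ (s := c + 1) (by linarith)
  have h2 := hasDerivAt_gaussMellin_one ζ (s := c + 2) (by linarith)
  refine (((hasDerivAt_id ζ).mul h1).add h2).congr_deriv ?_
  have := gaussMellin_recurrence (kernelDecay_one ζ) one_pos (s := c + 1) (by linarith)
  rw [show c + 1 + 1 = c + 2 by ring] at this ⊢
  rw [show c + 1 + 2 = c + 2 + 1 by ring] at this
  push_cast at this
  simp only [cylK, id]
  linear_combination this

lemma cylH_eq_mul_gaussMellin {c : ℝ} (hc : 0 < c) (ζ : ℂ) :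
    cylH c ζ = c * gaussMellin ζ 1 c := by
  rw [gaussMellin_recurrence (kernelDecay_one ζ) one_pos hc, cylH, one_mul]

/-- For c = 0 the system says H' = 0, and H(0) is the Gaussian moment ∫₀^∞ x e^{-x²/2} dx = 1. -/
lemma cylH_zero_left (ζ : ℂ) : cylH 0 ζ = 1 := by
  have h : ∀ z w, cylH 0 z = cylH 0 w := is_const_of_deriv_eq_zero
    (fun z => (hasDerivAt_cylH le_rfl z).differentiableAt)
    fun z => by rw [(hasDerivAt_cylH le_rfl z).deriv]; simp
  rw [h ζ 0, cylH, zero_mul, zero_add, gaussMellin_zero (by norm_num), gaussMoment]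
  norm_num

lemma kummerM_zero_left (b z : ℂ) : kummerM 0 b z = 1 := by
  rw [kummerM, tsum_eq_single 0]
  · simp
  · intro n hn
    simp [hn]

/-- The even and odd parts of the Taylor series of M_c are the two Kummer series in Whittaker's
formula. Legendre duplication at c/2 matches the coefficients. -/
lemma parabolicCylinderD_eq_integral {c : ℝ} (hc : 0 < c) (ζ : ℂ) :
    parabolicCylinderD (-(c : ℂ)) ζ =
      Complex.exp (-ζ ^ 2 / 4) / (Real.Gamma c : ℂ) * gaussMellin ζ 1 c := by
  have hG : Real.Gamma c ≠ 0 := (Real.Gamma_pos_of_pos hc).ne'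
  have hG1 : Real.Gamma (c / 2) ≠ 0 := (Real.Gamma_pos_of_pos (by positivity)).ne'
  have hG2 : Real.Gamma ((c + 1) / 2) ≠ 0 := (Real.Gamma_pos_of_pos (by positivity)).ne'
  have hdup := Real.Gamma_mul_Gamma_add_half (c / 2)
  rw [show c / 2 + 1 / 2 = (c + 1) / 2 by ring, show 2 * (c / 2) = c by ring] at hdup
  have e1 : 2 ^ (-c / 2) * (Real.sqrt Real.pi * (Real.Gamma ((c + 1) / 2))⁻¹) =
      gaussMoment c / Real.Gamma c := by
    rw [gaussMoment]
    field_simp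
    have hp : (2 : ℝ) ^ ((c - 2) / 2) * 2 ^ (1 - c) = 2 ^ (-(c / 2)) := by
      rw [← Real.rpow_add two_pos]; ring_nf
    linear_combination (-2 ^ ((c - 2) / 2)) * hdup - Real.Gamma c * Real.sqrt Real.pi * hp
  have e2 : 2 ^ (-c / 2) * (Real.sqrt (2 * Real.pi) * (Real.Gamma (c / 2))⁻¹) =
      gaussMoment (c + 1) / Real.Gamma c := by
    rw [gaussMoment]
    field_simp
    have hp : (2 : ℝ) ^ ((c + 1 - 2) / 2) * 2 ^ (1 - c) = 2 ^ (-(c / 2)) * Real.sqrt 2 := by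
      rw [Real.sqrt_eq_rpow, ← Real.rpow_add two_pos, ← Real.rpow_add two_pos]; ring_nf
    rw [Real.sqrt_mul two_pos.le]
    linear_combination (-2 ^ ((c + 1 - 2) / 2)) * hdup - Real.Gamma c * Real.sqrt Real.pi * hp
  have e1' := congrArg (fun x : ℝ => (x : ℂ)) e1
  have e2' := congrArg (fun x : ℝ => (x : ℂ)) e2
  push_cast [Complex.ofReal_cpow two_pos.le, ← Complex.Gamma_ofReal] at e1' e2'
  rw [parabolicCylinderD, gaussMellin_eq_kummerM ζ hc, neg_neg, sub_neg_eq_add, add_comm 1 (c : ℂ),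
    ← Complex.Gamma_ofReal]
  linear_combination (Complex.exp (-ζ ^ 2 / 4) * kummerM (c / 2) (1 / 2) (ζ ^ 2 / 2)) * e1' -
    (ζ * Complex.exp (-ζ ^ 2 / 4) * kummerM ((c + 1) / 2) (3 / 2) (ζ ^ 2 / 2)) * e2'

lemma parabolicCylinderD_eq_cylH {c : ℝ} (hc : 0 ≤ c) (ζ : ℂ) :
    parabolicCylinderD (-(c : ℂ)) ζ =
      Complex.exp (-ζ ^ 2 / 4) / (Real.Gamma (1 + c) : ℂ) * cylH c ζ := by
  rcases hc.eq_or_lt with rfl | hc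
  · rw [cylH_zero_left, parabolicCylinderD]
    -- At c = 0 the odd series drops out because the inverse of `Complex.Gamma 0` is 0 by
    -- convention.
    simp only [Complex.ofReal_zero, neg_zero, sub_zero, zero_div, Complex.Gamma_zero, inv_zero,
      kummerM_zero_left, add_zero, Real.Gamma_one, Complex.cpow_zero, Complex.Gamma_one_half_eq]
    have h : ((Real.sqrt Real.pi : ℝ) : ℂ) = (Real.pi : ℂ) ^ (1 / 2 : ℂ) := by
      rw [Real.sqrt_eq_rpow, Complex.ofReal_cpow Real.pi_pos.le]; simp
    have h0 : ((Real.sqrt Real.pi : ℝ) : ℂ) ≠ 0 := by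
      exact_mod_cast (Real.sqrt_pos.2 Real.pi_pos).ne'
    rw [← h]
    field_simp
    simp
  · rw [parabolicCylinderD_eq_integral hc, cylH_eq_mul_gaussMellin hc, add_comm 1 c,
      Real.Gamma_add_one hc.ne']
    have : ((Real.Gamma c : ℝ) : ℂ) ≠ 0 := by exact_mod_cast (Real.Gamma_pos_of_pos hc).ne'
    have : (c : ℂ) ≠ 0 := by exact_mod_cast hc.ne'
    push_cast
    field_simp

/-! ### Asymptotics -/

/-- The recurrence with b = 0 makes the derivative of the left side vanish on the right half-plane;
at w = 1 it is Euler's integral. -/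
lemma cpow_mul_gaussMellin_zero_right {w : ℂ} (hw : 0 < w.re) {s : ℝ} (hs : 0 < s) :
    w ^ (s : ℂ) * gaussMellin w 0 s = Real.Gamma s := by
  have hopen : IsOpen {w : ℂ | 0 < w.re} := isOpen_lt continuous_const Complex.continuous_re
  have hconv : Convex ℝ {w : ℂ | 0 < w.re} := convex_halfSpace_re_gt 0
  have hd : ∀ u : ℂ, 0 < u.re → HasDerivAt (fun w => w ^ (s : ℂ) * gaussMellin w 0 s) 0 u := by
    intro u hu
    have hmem : {v : ℂ | u.re / 2 < v.re} ∈ 𝓝 u :=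
      (isOpen_lt continuous_const Complex.continuous_re).mem_nhds (by simp; linarith)
    have h1 := hasDerivAt_gaussMellin (𝕜 := ℂ) (a := id) (a' := fun _ => 1) (b := fun _ => 0)
      (b' := fun _ => 0) hmem (A := 1) (C := 0) (κ := u.re / 2) (by positivity)
      (fun u _ => hasDerivAt_id u) (fun u _ => hasDerivAt_const _ _) (fun u _ => by simp)
      (fun u _ => by simp) (fun v hv => kernelDecay_of_le_re (le_of_lt hv) (by simp)) hs
    have h2 : HasDerivAt (fun w : ℂ => w ^ (s : ℂ)) (s * u ^ ((s : ℂ) - 1) * 1) u :=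
      (hasDerivAt_id u).cpow_const (Or.inl hu)
    refine (h2.mul h1).congr_deriv ?_
    have hrec := gaussMellin_recurrence (kernelDecay_of_le_re (a := u) (b := 0) le_rfl (by simp))
      hu hs
    have hu0 : u ≠ 0 := by rintro rfl; simp at hu
    have h3 : u ^ (s : ℂ) = u ^ ((s : ℂ) - 1) * u := by
      rw [Complex.cpow_sub _ _ hu0, Complex.cpow_one, div_mul_cancel₀ _ hu0]
    simp only [id]
    rw [h3]
    linear_combination u ^ ((s : ℂ) - 1) * hrec
  have hc : w ^ (s : ℂ) * gaussMellin w 0 s = 1 ^ (s : ℂ) * gaussMellin 1 0 s :=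
    hopen.is_const_of_deriv_eq_zero hconv.isPreconnected
      (fun u hu => (hd u hu).differentiableAt.differentiableWithinAt)
      (fun u hu => (hd u hu).deriv) hw (by simp)
  rw [hc, Complex.one_cpow, one_mul, gaussMellin, Real.Gamma_eq_integral hs,
    ← integral_complex_ofReal]
  refine setIntegral_congr_fun measurableSet_Ioi fun x _ => ?_
  simp

lemma norm_gaussMellin_zero_right {w : ℂ} (hw : 0 < w.re) {s : ℝ} (hs : 0 < s) :
    ‖gaussMellin w 0 s‖ = Real.Gamma s * ‖w‖ ^ (-s) := by
  have hw0 : w ≠ 0 := by rintro rfl; simp at hw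
  have h := congrArg norm (cpow_mul_gaussMellin_zero_right hw hs)
  rw [norm_mul, Complex.norm_cpow_of_ne_zero hw0, Complex.norm_real,
    Real.norm_of_nonneg (Real.Gamma_pos_of_pos hs).le] at h
  simp only [Complex.ofReal_re, Complex.ofReal_im, mul_zero, Real.exp_zero, div_one] at h
  rw [← h, Real.rpow_neg (norm_nonneg _)]
  have : ‖w‖ ^ s ≠ 0 := (Real.rpow_pos_of_pos (norm_pos_iff.2 hw0) _).ne'
  field_simp

lemma norm_exp_sub_one_le_of_re_nonpos {z : ℂ} (hz : z.re ≤ 0) : ‖Complex.exp z - 1‖ ≤ ‖z‖ := by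
  have := (convex_halfSpace_re_le 0).norm_image_sub_le_of_norm_hasDerivWithin_le (C := 1)
    (fun x _ => (Complex.hasDerivAt_exp x).hasDerivWithinAt)
    (fun x hx => by rw [Complex.norm_exp]; exact Real.exp_le_one_iff.2 hx)
    (show (0 : ℂ) ∈ {z : ℂ | z.re ≤ 0} by simp) (show z ∈ {z : ℂ | z.re ≤ 0} from hz)
  simpa using this

/-- Replacing e^{-bx²/2} by 1 costs at most ‖b‖x²/2, since exp is 1-Lipschitz on the left
half-plane. The factor x² raises s by 2. -/
lemma norm_gaussMellin_sub_le {w b : ℂ} (hw : 0 < w.re) (hb : 0 ≤ b.re) {s : ℝ} (hs : 0 < s) :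
    ‖gaussMellin w b s - gaussMellin w 0 s‖ ≤
      ‖b‖ / 2 * (Real.Gamma (s + 2) * w.re ^ (-(s + 2))) := by
  have i1 := integrableOn_gaussMellin (kernelDecay_of_le_re (a := w) le_rfl hb) hw hs
  have i2 := integrableOn_gaussMellin (kernelDecay_of_le_re (a := w) (b := 0) le_rfl (by simp)) hw hs
  rw [gaussMellin, gaussMellin, ← integral_sub i1 i2]
  have hval := integral_rpow_mul_exp_neg_mul_rpow (p := 1) (q := s + 2 - 1) (b := w.re) one_pos
    (by linarith) hw
  simp only [Real.rpow_one, div_one, sub_add_cancel, mul_one] at hval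
  have e : ‖b‖ / 2 * (Real.Gamma (s + 2) * w.re ^ (-(s + 2))) =
      ∫ x in Set.Ioi (0 : ℝ), ‖b‖ / 2 * (x ^ (s + 2 - 1) * Real.exp (-w.re * x)) := by
    rw [integral_const_mul, hval]; ring
  rw [e]
  refine norm_integral_le_of_norm_le
    ((integrableOn_rpow_mul_exp_neg_mul hw (by linarith)).const_mul _) ?_
  filter_upwards [ae_restrict_mem measurableSet_Ioi] with x hx
  have hx : 0 < x := hx
  rw [← sub_mul, sub_eq_add_neg (-w * (x : ℂ)), Complex.exp_add]
  simp only [zero_mul, zero_div, sub_zero]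
  have h1 : (-(b * (x : ℂ) ^ 2 / 2)).re ≤ 0 := by
    rw [← Complex.ofReal_pow]
    simp only [Complex.neg_re, Complex.div_ofNat_re, Complex.re_mul_ofReal]
    have := mul_nonneg hb (sq_nonneg x)
    linarith
  have h2 := norm_exp_sub_one_le_of_re_nonpos h1
  rw [← mul_sub_one, norm_mul, norm_mul, Complex.norm_exp, Complex.norm_real,
    Real.norm_of_nonneg (Real.rpow_nonneg hx.le _)]
  have h3 : ‖-(b * (x : ℂ) ^ 2 / 2)‖ = ‖b‖ / 2 * x ^ 2 := by
    rw [norm_neg, norm_div, norm_mul, norm_pow, Complex.norm_real, Real.norm_of_nonneg hx.le]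
    simp; ring
  have h4 : (-w * (x : ℂ)).re = -w.re * x := by simp
  rw [h3] at h2
  rw [h4, show s + 2 - 1 = (s - 1) + (2 : ℕ) by push_cast; ring, Real.rpow_add_natCast hx.ne']
  calc Real.exp (-w.re * x) * ‖Complex.exp (-(b * (x : ℂ) ^ 2 / 2)) - 1‖ * x ^ (s - 1)
      ≤ Real.exp (-w.re * x) * (‖b‖ / 2 * x ^ 2) * x ^ (s - 1) := by gcongr
    _ = _ := by ring

/-- Near the imaginary axis the plain Laplace estimate degenerates. Rotating the contour by π/8
moves ζ to w with Re w ≥ sin(π/8)‖ζ‖, while norms are unchanged. The resulting error is smaller than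
the main term by a factor of order ‖ζ‖⁻², uniformly on the closed right half-plane. -/
lemma abs_norm_gaussMellin_sub_le {ζ : ℂ} (hζ : 0 ≤ ζ.re) (h0 : ζ ≠ 0) {s : ℝ} (hs : 0 < s) :
    |‖gaussMellin ζ 1 s‖ - Real.Gamma s * ‖ζ‖ ^ (-s)| ≤
      1 / 2 * (Real.Gamma (s + 2) * (Real.sin (Real.pi / 8) * ‖ζ‖) ^ (-(s + 2))) := by
  have hpi := Real.pi_pos
  have hsin : 0 < Real.sin (Real.pi / 8) := Real.sin_pos_of_pos_of_lt_pi (by positivity)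
    (by linarith)
  have hcos : Real.sin (Real.pi / 8) ≤ Real.cos (Real.pi / 8) := by
    rw [← Real.cos_pi_div_two_sub]
    exact Real.cos_le_cos_of_nonneg_of_le_pi (by positivity) (by linarith) (by linarith)
  have hr : 0 < ‖ζ‖ := norm_pos_iff.2 h0
  -- The angle has sign opposite to that of Im ζ, so both terms of Re w = Re ζ cos α - Im ζ sin α
  -- are nonnegative.
  obtain ⟨α, hα, hre⟩ : ∃ α : ℝ, |α| ≤ Real.pi / 8 ∧
      Real.sin (Real.pi / 8) * ‖ζ‖ ≤ (ζ * Complex.exp (Complex.I * α)).re := by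
    have e : ∀ α : ℝ, (ζ * Complex.exp (Complex.I * α)).re =
        ζ.re * Real.cos α - ζ.im * Real.sin α := by
      intro α
      rw [mul_comm Complex.I, Complex.mul_re, Complex.exp_ofReal_mul_I_re,
        Complex.exp_ofReal_mul_I_im]
    have hn : ‖ζ‖ ≤ ζ.re + |ζ.im| := by
      have := Complex.norm_le_abs_re_add_abs_im ζ
      rwa [abs_of_nonneg hζ] at this
    rcases le_total 0 ζ.im with him | him
    · refine ⟨-(Real.pi / 8), by rw [abs_neg, abs_of_pos (by positivity)], ?_⟩
      rw [e, Real.cos_neg, Real.sin_neg]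
      rw [abs_of_nonneg him] at hn
      nlinarith [mul_le_mul_of_nonneg_left hn hsin.le, mul_le_mul_of_nonneg_left hcos hζ]
    · refine ⟨Real.pi / 8, by rw [abs_of_pos (by positivity)], ?_⟩
      rw [e]
      rw [abs_of_nonpos him] at hn
      nlinarith [mul_le_mul_of_nonneg_left hn hsin.le, mul_le_mul_of_nonneg_left hcos hζ]
  set w := ζ * Complex.exp (Complex.I * α) with hw
  have hpos : 0 < Real.sin (Real.pi / 8) * ‖ζ‖ := by positivity
  have hwre : 0 < w.re := hpos.trans_le hre
  have e1 : ∀ u : ℝ, ‖Complex.exp (Complex.I * u)‖ = 1 := fun u => by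
    rw [mul_comm, Complex.norm_exp_ofReal_mul_I]
  have hwn : ‖w‖ = ‖ζ‖ := by rw [hw, norm_mul, e1, mul_one]
  have e2 : (Complex.exp (2 * (Complex.I * α))).re = Real.cos (2 * α) := by
    rw [show 2 * (Complex.I * (α : ℂ)) = ((2 * α : ℝ) : ℂ) * Complex.I by push_cast; ring,
      Complex.exp_ofReal_mul_I_re]
  have e3 : ‖Complex.exp (2 * (Complex.I * α))‖ = 1 := by
    rw [show 2 * (Complex.I * (α : ℂ)) = ((2 * α : ℝ) : ℂ) * Complex.I by push_cast; ring,
      Complex.norm_exp_ofReal_mul_I]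
  obtain ⟨hα1, hα2⟩ := abs_le.1 hα
  have hb : 0 ≤ (Complex.exp (2 * (Complex.I * α))).re := by
    rw [e2]
    exact Real.cos_nonneg_of_neg_pi_div_two_le_of_le (by linarith) (by linarith)
  have hM : ‖gaussMellin ζ 1 s‖ = ‖gaussMellin w (Complex.exp (2 * (Complex.I * α))) s‖ := by
    rw [gaussMellin_rotate ζ hs hα, norm_mul, show Complex.I * (α : ℂ) * (s : ℂ) =
      Complex.I * ((α * s : ℝ) : ℂ) by push_cast; ring, e1, one_mul]
  rw [hM, ← hwn, ← norm_gaussMellin_zero_right hwre hs]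
  refine (abs_norm_sub_norm_le _ _).trans ((norm_gaussMellin_sub_le hwre hb hs).trans ?_)
  rw [e3, hwn]
  have hG := (Real.Gamma_pos_of_pos (show 0 < s + 2 by linarith)).le
  gcongr 1 / 2 * (Real.Gamma (s + 2) * ?_)
  exact Real.rpow_le_rpow_of_nonpos hpos hre (by linarith)

lemma tendsto_norm_gaussMellin_mul_rpow {s : ℝ} (hs : 0 < s) :
    Tendsto (fun ζ : ℂ => ‖gaussMellin ζ 1 s‖ * ‖ζ‖ ^ s)
      (Bornology.cobounded ℂ ⊓ 𝓟 {ζ : ℂ | 0 ≤ ζ.re}) (𝓝 (Real.Gamma s)) := by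
  set l := Bornology.cobounded ℂ ⊓ 𝓟 {ζ : ℂ | 0 ≤ ζ.re}
  have hnorm : Tendsto (fun ζ : ℂ => ‖ζ‖) l atTop := tendsto_norm_cobounded_atTop.mono_left inf_le_left
  set D := 1 / 2 * (Real.Gamma (s + 2) * (Real.sin (Real.pi / 8)) ^ (-(s + 2)))
  have hlim : Tendsto (fun ζ : ℂ => D * ‖ζ‖ ^ (-(2 : ℝ))) l (𝓝 0) := by
    rw [← mul_zero D]
    exact ((tendsto_rpow_neg_atTop two_pos).comp hnorm).const_mul D
  rw [tendsto_iff_norm_sub_tendsto_zero]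
  refine squeeze_zero' (Eventually.of_forall fun _ => norm_nonneg _) ?_ hlim
  have h1 : ∀ᶠ ζ in l, 0 ≤ ζ.re := mem_inf_of_right (mem_principal_self _)
  filter_upwards [h1, hnorm.eventually_gt_atTop 0] with ζ hre hpos
  have h := abs_norm_gaussMellin_sub_le hre (norm_pos_iff.1 hpos) hs
  have hsin : 0 < Real.sin (Real.pi / 8) := Real.sin_pos_of_pos_of_lt_pi (by positivity)
    (by linarith [Real.pi_pos])
  rw [Real.mul_rpow hsin.le hpos.le] at h
  have e1 : ‖ζ‖ ^ (-s) * ‖ζ‖ ^ s = 1 := by rw [← Real.rpow_add hpos]; simp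
  have e2 : ‖ζ‖ ^ (-(s + 2)) * ‖ζ‖ ^ s = ‖ζ‖ ^ (-(2 : ℝ)) := by
    rw [← Real.rpow_add hpos]; congr 1; ring
  have e3 : ‖gaussMellin ζ 1 s‖ * ‖ζ‖ ^ s - Real.Gamma s =
      (‖gaussMellin ζ 1 s‖ - Real.Gamma s * ‖ζ‖ ^ (-s)) * ‖ζ‖ ^ s := by
    linear_combination Real.Gamma s * e1
  rw [e3, Real.norm_eq_abs, abs_mul, abs_of_pos (Real.rpow_pos_of_pos hpos s)]
  calc _ ≤ _ := mul_le_mul_of_nonneg_right h (Real.rpow_pos_of_pos hpos s).le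
    _ = _ := by rw [← e2]; ring

lemma tendsto_gaussMellin_ratio {s : ℝ} (hs : 0 < s) :
    Tendsto (fun ζ : ℂ => gaussMellin ζ 1 (s + 1) / gaussMellin ζ 1 s)
      (Bornology.cobounded ℂ ⊓ 𝓟 {ζ : ℂ | 0 ≤ ζ.re}) (𝓝 0) := by
  have hnorm : Tendsto (fun ζ : ℂ => ‖ζ‖) (Bornology.cobounded ℂ ⊓ 𝓟 {ζ : ℂ | 0 ≤ ζ.re}) atTop :=
    tendsto_norm_cobounded_atTop.mono_left inf_le_left
  rw [tendsto_zero_iff_norm_tendsto_zero]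
  have h := ((tendsto_norm_gaussMellin_mul_rpow (s := s + 1) (by linarith)).div
    (tendsto_norm_gaussMellin_mul_rpow hs) (Real.Gamma_pos_of_pos hs).ne').mul
    (tendsto_inv_atTop_zero.comp hnorm)
  rw [mul_zero] at h
  refine h.congr' ?_
  filter_upwards [hnorm.eventually_gt_atTop 0] with ζ hpos
  have : ‖ζ‖ ^ s ≠ 0 := (Real.rpow_pos_of_pos hpos s).ne'
  simp only [Function.comp, Pi.div_apply]
  rw [Real.rpow_add_one hpos.ne', norm_div]
  field_simp

lemma eventually_gaussMellin_ne_zero {s : ℝ} (hs : 0 < s) :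
    ∀ᶠ ζ in Bornology.cobounded ℂ ⊓ 𝓟 {ζ : ℂ | 0 ≤ ζ.re}, gaussMellin ζ 1 s ≠ 0 := by
  filter_upwards [(tendsto_norm_gaussMellin_mul_rpow hs).eventually_ne
    (Real.Gamma_pos_of_pos hs).ne'] with ζ h h0
  simp [h0] at h

lemma tendsto_gaussMellin_zero {s : ℝ} (hs : 0 < s) :
    Tendsto (fun ζ : ℂ => gaussMellin ζ 1 s)
      (Bornology.cobounded ℂ ⊓ 𝓟 {ζ : ℂ | 0 ≤ ζ.re}) (𝓝 0) := by
  have hnorm : Tendsto (fun ζ : ℂ => ‖ζ‖) (Bornology.cobounded ℂ ⊓ 𝓟 {ζ : ℂ | 0 ≤ ζ.re}) atTop :=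
    tendsto_norm_cobounded_atTop.mono_left inf_le_left
  rw [tendsto_zero_iff_norm_tendsto_zero]
  have h := (tendsto_norm_gaussMellin_mul_rpow hs).mul ((tendsto_rpow_neg_atTop hs).comp hnorm)
  rw [mul_zero] at h
  refine h.congr' ?_
  filter_upwards [hnorm.eventually_gt_atTop 0] with ζ hpos
  simp only [Function.comp]
  rw [mul_assoc, ← Real.rpow_add hpos]
  simp

/-! ### The Wronskian, and the density on the real line -/

lemma gaussMellin_conj (ζ : ℂ) (s : ℝ) :
    gaussMellin (starRingEnd ℂ ζ) 1 s = starRingEnd ℂ (gaussMellin ζ 1 s) := by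
  rw [gaussMellin, gaussMellin, ← integral_conj]
  congr 1
  ext x
  simp [← Complex.exp_conj, map_ofNat (starRingEnd ℂ) 2]

lemma cylH_conj (c : ℝ) (ζ : ℂ) : cylH c (starRingEnd ℂ ζ) = starRingEnd ℂ (cylH c ζ) := by
  simp [cylH, gaussMellin_conj]

/-- By the system for K and H, the derivative of K·conj H along ζ = -il is -l·K·conj H plus i(|H|² -
c|K|²), which is purely imaginary. So the real part solves ω' = -lω; its value at 0 comes from
duplication at (c+1)/2. This identity gives both the absence of zeros and the closed form of the
density. -/
lemma wronskian_eq {c : ℝ} (hc : 0 ≤ c) (l : ℝ) :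
    (cylK c (-Complex.I * l) * starRingEnd ℂ (cylH c (-Complex.I * l))).re =
      Real.sqrt (Real.pi / 2) * Real.Gamma (1 + c) * Real.exp (-l ^ 2 / 2) := by
  have hI : ∀ l : ℝ, HasDerivAt (fun l : ℝ => -Complex.I * (l : ℂ)) (-Complex.I) l := fun l => by
    simpa using (Complex.ofRealCLM.hasDerivAt (x := l)).const_mul (-Complex.I)
  set k : ℝ → ℂ := fun l => cylK c (-Complex.I * l)
  set h : ℝ → ℂ := fun l => cylH c (-Complex.I * l)
  have hk : ∀ l, HasDerivAt k ((-Complex.I * l * k l - h l) * -Complex.I) l := fun l =>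
    (hasDerivAt_cylK hc _).comp l (hI l)
  have hh : ∀ l, HasDerivAt h ((-c * k l) * -Complex.I) l := fun l =>
    (hasDerivAt_cylH hc _).comp l (hI l)
  set ω : ℝ → ℝ := fun l => (k l * starRingEnd ℂ (h l)).re
  have hω : ∀ l, HasDerivAt ω (-l * ω l) l := by
    intro l
    have h1 : HasDerivAt (fun l => starRingEnd ℂ (h l))
        (starRingEnd ℂ ((-c * k l) * -Complex.I)) l := (hh l).star
    refine ((Complex.reCLM.hasFDerivAt.comp_hasDerivAt l ((hk l).mul h1))).congr_deriv ?_
    simp only [ω, Complex.reCLM_apply, Complex.add_re, Complex.mul_re, Complex.mul_im,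
      Complex.sub_re, Complex.sub_im, Complex.neg_re, Complex.neg_im, Complex.I_re, Complex.I_im,
      Complex.conj_re, Complex.conj_im, Complex.ofReal_re, Complex.ofReal_im]
    ring
  -- The integrating factor of ω' = -lω is e^{l²/2}.
  have hconst : ∀ x y, Real.exp (x ^ 2 / 2) * ω x = Real.exp (y ^ 2 / 2) * ω y := by
    have hd : ∀ l, HasDerivAt (fun x => Real.exp (x ^ 2 / 2) * ω x) 0 l := by
      intro l
      have h2 : HasDerivAt (fun x : ℝ => x ^ 2 / 2) l l := by
        have := (hasDerivAt_pow 2 l).div_const 2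
        simpa using this
      refine (h2.exp.mul (hω l)).congr_deriv ?_
      ring
    exact is_const_of_deriv_eq_zero (fun l => (hd l).differentiableAt) fun l => (hd l).deriv
  have h0 : ω 0 = Real.sqrt (Real.pi / 2) * Real.Gamma (1 + c) := by
    have e1 : k 0 = gaussMoment (c + 1) := by
      simp only [k, cylK, Complex.ofReal_zero, mul_zero]; exact gaussMellin_zero (by linarith)
    have e2 : h 0 = gaussMoment (c + 2) := by
      simp only [h, cylH, Complex.ofReal_zero, mul_zero, zero_mul, zero_add]
      exact gaussMellin_zero (by linarith)
    simp only [ω, e1, e2, Complex.conj_ofReal]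
    rw [← Complex.ofReal_mul, Complex.ofReal_re, gaussMoment, gaussMoment]
    have hdup := Real.Gamma_mul_Gamma_add_half ((c + 1) / 2)
    rw [show (c + 1) / 2 + 1 / 2 = (c + 2) / 2 by ring, show 2 * ((c + 1) / 2) = 1 + c by ring]
      at hdup
    have hp : (2 : ℝ) ^ ((c + 1) / 2 - 1) * 2 ^ ((c + 2) / 2 - 1) * 2 ^ (1 - (1 + c)) =
        (Real.sqrt 2)⁻¹ := by
      rw [← Real.rpow_add two_pos, ← Real.rpow_add two_pos, Real.sqrt_eq_rpow,
        ← Real.rpow_neg two_pos.le]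
      ring_nf
    rw [Real.sqrt_div Real.pi_pos.le, div_eq_mul_inv (Real.sqrt Real.pi), ← hp]
    linear_combination (2 : ℝ) ^ ((c + 1) / 2 - 1) * 2 ^ ((c + 2) / 2 - 1) * hdup
  have h3 := hconst l 0
  have h4 : Real.exp (-l ^ 2 / 2) * Real.exp (l ^ 2 / 2) = 1 := by
    rw [← Real.exp_add]; ring_nf; exact Real.exp_zero
  have h5 : Real.exp ((0 : ℝ) ^ 2 / 2) = 1 := by norm_num
  rw [h5, one_mul, h0] at h3
  change ω l = _
  linear_combination (-ω l) * h4 + Real.exp (-l ^ 2 / 2) * h3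

lemma cylH_ne_zero {c : ℝ} (hc : 0 ≤ c) (l : ℝ) : cylH c (-Complex.I * l) ≠ 0 := by
  intro h
  have := wronskian_eq hc l
  rw [h] at this
  have hG : 0 < Real.Gamma (1 + c) := Real.Gamma_pos_of_pos (by linarith)
  have h2 : 0 < Real.sqrt (Real.pi / 2) * Real.Gamma (1 + c) * Real.exp (-l ^ 2 / 2) := by
    have := Real.pi_pos
    positivity
  rw [map_zero, mul_zero, Complex.zero_re] at this
  exact h2.ne this

lemma norm_parabolicCylinderD {c : ℝ} (hc : 0 ≤ c) (l : ℝ) :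
    ‖parabolicCylinderD (-(c : ℂ)) (Complex.I * l)‖ =
      Real.exp (l ^ 2 / 4) / Real.Gamma (1 + c) * ‖cylH c (-Complex.I * l)‖ := by
  have h1 : (Complex.I * (l : ℂ)) = starRingEnd ℂ (-Complex.I * l) := by simp
  rw [parabolicCylinderD_eq_cylH hc, norm_mul, norm_div, Complex.norm_exp, Complex.norm_real,
    Real.norm_of_nonneg (Real.Gamma_pos_of_pos (by linarith)).le]
  congr 1
  · congr 2
    rw [mul_pow, Complex.I_sq, ← Complex.ofReal_pow]
    simp [-Complex.ofReal_pow]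
  · rw [h1, cylH_conj, Complex.norm_conj]

lemma crossoverDensity_eq {c : ℝ} (hc : 0 ≤ c) (l : ℝ) :
    crossoverDensity c l = Real.Gamma (1 + c) * Real.exp (-l ^ 2 / 2) /
      (Real.sqrt (2 * Real.pi) * ‖cylH c (-Complex.I * l)‖ ^ 2) := by
  have hG : Real.Gamma (1 + c) ≠ 0 := (Real.Gamma_pos_of_pos (by linarith)).ne'
  have hh := norm_ne_zero_iff.2 (cylH_ne_zero hc l)
  rw [crossoverDensity, norm_parabolicCylinderD hc, mul_pow, div_pow, ← Real.exp_nat_mul,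
    show ((2 : ℕ) : ℝ) * (l ^ 2 / 4) = -(-l ^ 2 / 2) by push_cast; ring, Real.exp_neg]
  have := Real.exp_ne_zero (-l ^ 2 / 2)
  field_simp

/-- Re(K/H) = Re(K·conj H)/|H|², whose numerator is the Wronskian. So the density is Im G/π on the
real line for G(z) = iK(-iz)/H(-iz). -/
lemma crossoverDensity_eq_re_div {c : ℝ} (hc : 0 ≤ c) (l : ℝ) :
    crossoverDensity c l =
      1 / Real.pi * (cylK c (-Complex.I * l) / cylH c (-Complex.I * l)).re := by
  have h1 : (cylK c (-Complex.I * l) / cylH c (-Complex.I * l)).re =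
      (cylK c (-Complex.I * l) * starRingEnd ℂ (cylH c (-Complex.I * l))).re /
        ‖cylH c (-Complex.I * l)‖ ^ 2 := by
    rw [Complex.div_re, Complex.mul_re, Complex.conj_re, Complex.conj_im, Complex.sq_norm]
    ring
  have hh := norm_ne_zero_iff.2 (cylH_ne_zero hc l)
  rw [h1, wronskian_eq hc, crossoverDensity_eq hc, Real.sqrt_div Real.pi_pos.le,
    Real.sqrt_mul two_pos.le]
  have h2 : Real.sqrt 2 ≠ 0 := (Real.sqrt_pos.2 two_pos).ne'
  have h3 : Real.sqrt Real.pi ≠ 0 := (Real.sqrt_pos.2 Real.pi_pos).ne'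
  have h4 := Real.pi_ne_zero
  have h5 : Real.sqrt Real.pi ^ 2 = Real.pi := Real.sq_sqrt Real.pi_pos.le
  field_simp
  rw [h5]

lemma crossoverDensity_pos {c : ℝ} (hc : 0 ≤ c) (l : ℝ) : 0 < crossoverDensity c l := by
  have hG : 0 < Real.Gamma (1 + c) := Real.Gamma_pos_of_pos (by linarith)
  have hh := norm_pos_iff.2 (cylH_ne_zero hc l)
  have := Real.pi_pos
  rw [crossoverDensity_eq hc]
  positivity

lemma continuous_cylH {c : ℝ} (hc : 0 ≤ c) : Continuous (cylH c) :=
  continuous_iff_continuousAt.2 fun ζ => (hasDerivAt_cylH hc ζ).continuousAt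

lemma continuous_cylK {c : ℝ} (hc : 0 ≤ c) : Continuous (cylK c) :=
  continuous_iff_continuousAt.2 fun ζ => (hasDerivAt_cylK hc ζ).continuousAt

lemma continuous_crossoverDensity {c : ℝ} (hc : 0 ≤ c) : Continuous (crossoverDensity c) := by
  have h1 := continuous_cylH hc
  have h2 : ∀ l : ℝ, Real.sqrt (2 * Real.pi) * ‖cylH c (-Complex.I * l)‖ ^ 2 ≠ 0 := fun l => by
    have hh := norm_pos_iff.2 (cylH_ne_zero hc l)
    have := Real.pi_pos
    positivity
  rw [show crossoverDensity c = _ from funext fun l => crossoverDensity_eq hc l]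
  exact Continuous.div (by fun_prop) (by fun_prop) h2

/-! ### Dependence on the parameter -/

lemma continuousAt_gaussMellin (ζ : ℂ) {s : ℝ} (hs : 0 < s) :
    ContinuousAt (fun s => gaussMellin ζ 1 s) s := by
  -- For t between s/2 and s+1 the power x^{t-1} is dominated by x^{s/2-1} when x ≤ 1 and by x^s
  -- when x ≥ 1.
  refine continuousAt_of_dominated (bound := fun x => Real.exp ((‖ζ‖ + 1) ^ 2 / (2 * 1)) *
    (x ^ (s / 2 - 1) * Real.exp (-1 * x)) + Real.exp ((‖ζ‖ + 1) ^ 2 / (2 * 1)) *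
    (x ^ (s + 1 - 1) * Real.exp (-1 * x))) (Eventually.of_forall fun s =>
      aestronglyMeasurable_gaussMellin_integrand _ _ _) ?_ ?_ ?_
  · filter_upwards [Ioo_mem_nhds (show s / 2 < s by linarith) (show s < s + 1 by linarith)]
      with t ht
    filter_upwards [ae_restrict_mem measurableSet_Ioi] with x hx
    have hx : 0 < x := hx
    refine (norm_gaussMellin_integrand_le (kernelDecay_one ζ) t hx).trans ?_
    rw [← mul_add, ← add_mul]
    gcongr
    rcases le_total 1 x with h1 | h1
    · have : x ^ (t - 1) ≤ x ^ (s + 1 - 1) :=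
        Real.rpow_le_rpow_of_exponent_le h1 (by linarith [ht.2])
      have := Real.rpow_nonneg hx.le (s / 2 - 1)
      linarith
    · have : x ^ (t - 1) ≤ x ^ (s / 2 - 1) :=
        Real.rpow_le_rpow_of_exponent_ge hx h1 (by linarith [ht.1])
      have := Real.rpow_nonneg hx.le (s + 1 - 1)
      linarith
  · exact ((integrableOn_rpow_mul_exp_neg_mul one_pos (by linarith)).const_mul _).add
      ((integrableOn_rpow_mul_exp_neg_mul one_pos (by linarith)).const_mul _)
  · filter_upwards [ae_restrict_mem measurableSet_Ioi] with x hx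
    refine ContinuousAt.mul continuousAt_const ?_
    refine Complex.continuous_ofReal.continuousAt.comp ?_
    exact (Real.continuousAt_const_rpow (ne_of_gt hx)).comp (by fun_prop)

lemma continuousOn_crossoverDensity_param (l : ℝ) :
    ContinuousOn (fun c : ℝ => crossoverDensity c l) (Set.Ici 0) := by
  have hcont : ContinuousOn (fun c : ℝ => Real.Gamma (1 + c) * Real.exp (-l ^ 2 / 2) /
      (Real.sqrt (2 * Real.pi) * ‖cylH c (-Complex.I * l)‖ ^ 2)) (Set.Ici 0) := by
    intro c hc
    have hc : 0 ≤ c := hc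
    apply ContinuousAt.continuousWithinAt
    have hG : ContinuousAt (fun c : ℝ => Real.Gamma (1 + c)) c := by
      have : ContinuousAt Real.Gamma (1 + c) :=
        (Real.differentiableAt_Gamma fun m => by
          have : (0 : ℝ) ≤ m := m.cast_nonneg
          linarith).continuousAt
      exact this.comp (f := fun c : ℝ => 1 + c) (by fun_prop)
    have hH : ContinuousAt (fun c : ℝ => cylH c (-Complex.I * l)) c := by
      have h1 : ContinuousAt (fun c : ℝ => gaussMellin (-Complex.I * l) 1 (c + 1)) c :=
        (continuousAt_gaussMellin _ (by linarith)).comp (f := fun c : ℝ => c + 1) (by fun_prop)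
      have h2 : ContinuousAt (fun c : ℝ => gaussMellin (-Complex.I * l) 1 (c + 2)) c :=
        (continuousAt_gaussMellin _ (by linarith)).comp (f := fun c : ℝ => c + 2) (by fun_prop)
      exact (continuousAt_const.mul h1).add h2
    refine (hG.mul continuousAt_const).div (continuousAt_const.mul (hH.norm.pow 2)) ?_
    have hh := norm_pos_iff.2 (cylH_ne_zero hc l)
    have := Real.pi_pos
    positivity
  exact hcont.congr fun c hc => crossoverDensity_eq hc l

lemma crossoverDensity_zero_left (l : ℝ) :
    crossoverDensity 0 l = Real.exp (-l ^ 2 / 2) / Real.sqrt (2 * Real.pi) := by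
  rw [crossoverDensity_eq le_rfl, cylH_zero_left]
  simp

/-! ### The Riccati equation on the upper half-plane -/

/-- Along z = iy the function |d|² has derivative 2(y + Im q)|d|², so it eventually increases; since
it tends to 0 it vanishes far up the axis. The identity theorem carries this to the whole
half-plane. -/
lemma eq_zero_of_linear_ode {d q : ℂ → ℂ}
    (hd : ∀ z : ℂ, 0 < z.im → HasDerivAt d (-(z + q z) * d z) z)
    (hq : Tendsto (fun y : ℝ => q (Complex.I * y)) atTop (𝓝 0))
    (hd0 : Tendsto (fun y : ℝ => d (Complex.I * y)) atTop (𝓝 0)) {z : ℂ} (hz : 0 < z.im) :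
    d z = 0 := by
  have hI : ∀ y : ℝ, HasDerivAt (fun y : ℝ => Complex.I * (y : ℂ)) Complex.I y := fun y => by
    simpa using (Complex.ofRealCLM.hasDerivAt (x := y)).const_mul Complex.I
  set φ : ℝ → ℝ := fun y => (starRingEnd ℂ (d (Complex.I * y)) * d (Complex.I * y)).re
  have hφ : ∀ y : ℝ, 0 < y →
      HasDerivAt φ (2 * (y + (q (Complex.I * y)).im) * φ y) y := by
    intro y hy
    have h1 : HasDerivAt (fun y : ℝ => d (Complex.I * y))
        ((-(Complex.I * y + q (Complex.I * y)) * d (Complex.I * y)) * Complex.I) y :=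
      (hd _ (by simpa using hy)).comp y (hI y)
    refine (Complex.reCLM.hasFDerivAt.comp_hasDerivAt y (h1.star.mul h1)).congr_deriv ?_
    simp only [φ, Complex.reCLM_apply, Complex.add_re, Complex.mul_re, Complex.mul_im,
      Complex.add_im, Complex.neg_re, Complex.neg_im, Complex.I_re, Complex.I_im,
      Complex.conj_re, Complex.conj_im, Complex.ofReal_re, Complex.ofReal_im, Complex.star_def]
    ring
  have hφn : ∀ y, φ y = ‖d (Complex.I * y)‖ ^ 2 := fun y => by
    simp only [φ]
    rw [mul_comm, Complex.mul_conj, Complex.ofReal_re, Complex.normSq_eq_norm_sq]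
  -- Beyond Y one has |q| < 1 ≤ y, hence y + Im q ≥ 0.
  obtain ⟨Y, hY1, hY⟩ : ∃ Y : ℝ, 1 ≤ Y ∧ ∀ y, Y ≤ y → ‖q (Complex.I * y)‖ < 1 := by
    have := (tendsto_zero_iff_norm_tendsto_zero.1 hq).eventually_lt_const one_pos
    obtain ⟨Y, hY⟩ := (this.and (eventually_ge_atTop 1)).exists_forall_of_atTop
    exact ⟨Y, (hY Y le_rfl).2, fun y hy => (hY y hy).1⟩
  have hmono : MonotoneOn φ (Set.Ici Y) := by
    refine monotoneOn_of_deriv_nonneg (convex_Ici Y)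
      (fun y hy => (hφ y (by linarith [Set.mem_Ici.1 hy])).continuousAt.continuousWithinAt) ?_ ?_
    · intro y hy
      rw [interior_Ici] at hy
      exact (hφ y (by linarith [Set.mem_Ioi.1 hy])).differentiableAt.differentiableWithinAt
    · intro y hy
      rw [interior_Ici] at hy
      have hy : Y < y := hy
      rw [(hφ y (by linarith)).deriv]
      have h1 := (Complex.abs_im_le_norm (q (Complex.I * y))).trans (hY y hy.le).le
      have h2 := neg_abs_le (q (Complex.I * y)).im
      have h3 : 0 ≤ φ y := by rw [hφn]; positivity
      have : 0 ≤ y + (q (Complex.I * y)).im := by linarith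
      positivity
  have hφ0 : Tendsto φ atTop (𝓝 0) := by
    have := (tendsto_zero_iff_norm_tendsto_zero.1 hd0).pow 2
    simp only [ne_eq, OfNat.ofNat_ne_zero, not_false_eq_true, zero_pow] at this
    exact this.congr fun y => (hφn y).symm
  have hzero : ∀ y : ℝ, Y ≤ y → d (Complex.I * y) = 0 := by
    intro y hy
    have h1 : φ y ≤ 0 := ge_of_tendsto hφ0 (by
      filter_upwards [eventually_ge_atTop y] with t ht
      exact hmono hy (hy.trans ht) ht)
    rw [hφn] at h1
    have : ‖d (Complex.I * y)‖ = 0 := by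
      have := sq_nonneg ‖d (Complex.I * y)‖
      exact pow_eq_zero_iff two_ne_zero |>.1 (le_antisymm h1 this)
    exact norm_eq_zero.1 this
  have hopen : IsOpen {z : ℂ | 0 < z.im} := isOpen_lt continuous_const Complex.continuous_im
  have han : AnalyticOnNhd ℂ d {z : ℂ | 0 < z.im} :=
    DifferentiableOn.analyticOnNhd
      (fun u hu => (hd u hu).differentiableAt.differentiableWithinAt) hopen
  refine han.eqOn_zero_of_preconnected_of_frequently_eq_zero
    (convex_halfSpace_im_gt 0).isPreconnected (z₀ := Complex.I * Y)
    (by simp; linarith) ?_ hz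
  have ht : Tendsto (fun t : ℝ => Complex.I * (t : ℂ)) (𝓝[>] Y) (𝓝[≠] (Complex.I * Y)) := by
    refine tendsto_nhdsWithin_iff.2 ⟨?_, ?_⟩
    · exact (((hI Y).continuousAt).tendsto).mono_left nhdsWithin_le_nhds
    · filter_upwards [self_mem_nhdsWithin] with t ht
      simp only [Set.mem_compl_iff, Set.mem_singleton_iff, mul_eq_mul_left_iff, Complex.ofReal_inj,
        Complex.I_ne_zero, or_false]
      exact ne_of_gt ht
  refine ht.frequently (Eventually.frequently ?_)
  filter_upwards [self_mem_nhdsWithin] with t ht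
  exact hzero t (le_of_lt ht)

/-- The Riccati equation on the upper half-plane. -/
def SolvesRiccatiUpper (c : ℝ) (G : ℂ → ℂ) : Prop :=
  ∀ z : ℂ, 0 < z.im → DifferentiableAt ℂ G z ∧ (c : ℂ) * G z ^ 2 + z * G z + deriv G z = -1

lemma SolvesRiccatiUpper.hasDerivAt {c : ℝ} {G : ℂ → ℂ} (h : SolvesRiccatiUpper c G) {z : ℂ}
    (hz : 0 < z.im) : HasDerivAt G (-1 - z * G z - c * G z ^ 2) z := by
  refine (h z hz).1.hasDerivAt.congr_deriv ?_
  linear_combination (h z hz).2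

/-- The difference d of two solutions satisfies d' = -(z + c(G₁ + G₂))d, so `eq_zero_of_linear_ode`
applies. Decay along the imaginary axis suffices. -/
lemma SolvesRiccatiUpper.unique {c : ℝ} {G₁ G₂ : ℂ → ℂ} (h₁ : SolvesRiccatiUpper c G₁)
    (h₂ : SolvesRiccatiUpper c G₂)
    (l₁ : Tendsto (fun y : ℝ => G₁ (Complex.I * y)) atTop (𝓝 0))
    (l₂ : Tendsto (fun y : ℝ => G₂ (Complex.I * y)) atTop (𝓝 0)) {z : ℂ} (hz : 0 < z.im) :
    G₁ z = G₂ z := by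
  rw [← sub_eq_zero]
  refine eq_zero_of_linear_ode (d := fun z => G₁ z - G₂ z) (q := fun z => c * (G₁ z + G₂ z))
    (fun z hz => ((h₁.hasDerivAt hz).sub (h₂.hasDerivAt hz)).congr_deriv (by ring)) ?_ ?_ hz
  · simpa using (l₁.add l₂).const_mul (c : ℂ)
  · simpa using l₁.sub l₂

lemma tendsto_ofReal_cobounded_inf :
    Tendsto (fun y : ℝ => (y : ℂ)) atTop (Bornology.cobounded ℂ ⊓ 𝓟 {ζ : ℂ | 0 ≤ ζ.re}) := by
  refine tendsto_inf.2 ⟨?_, ?_⟩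
  · rw [← tendsto_norm_atTop_iff_cobounded]
    simpa using tendsto_abs_atTop_atTop
  · refine tendsto_principal.2 ?_
    filter_upwards [eventually_ge_atTop 0] with y hy
    simpa using hy

/-- The function d = iK(-iz) - G(z)H(-iz) satisfies d' = -(z + cG)d. The cross-multiplied form makes
it unnecessary to know that H(-iz) has no zero in the upper half-plane. -/
lemma SolvesRiccatiUpper.mul_cylH {c : ℝ} (hc : 0 ≤ c) {G : ℂ → ℂ} (h : SolvesRiccatiUpper c G)
    (l : Tendsto (fun y : ℝ => G (Complex.I * y)) atTop (𝓝 0)) {z : ℂ} (hz : 0 < z.im) :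
    G z * cylH c (-Complex.I * z) = Complex.I * cylK c (-Complex.I * z) := by
  have hI : ∀ z : ℂ, HasDerivAt (fun z : ℂ => -Complex.I * z) (-Complex.I) z := fun z => by
    simpa using (hasDerivAt_id z).const_mul (-Complex.I)
  symm
  rw [← sub_eq_zero]
  have hy : ∀ y : ℝ, -Complex.I * (Complex.I * y) = y := fun y => by
    rw [← mul_assoc, neg_mul, Complex.I_mul_I]; simp
  refine eq_zero_of_linear_ode
    (d := fun z => Complex.I * cylK c (-Complex.I * z) - G z * cylH c (-Complex.I * z))
    (q := fun z => c * G z) (fun z hz => ?_) (by simpa using l.const_mul (c : ℂ)) ?_ hz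
  · refine ((((hasDerivAt_cylK hc _).comp z (hI z)).const_mul Complex.I).sub
      ((h.hasDerivAt hz).mul ((hasDerivAt_cylH hc _).comp z (hI z)))).congr_deriv ?_
    simp only [Function.comp]
    linear_combination ((cylK c (-Complex.I * z) * z * Complex.I) +
      cylH c (-Complex.I * z)) * Complex.I_sq
  · simp only [hy]
    have h1 : Tendsto (fun y : ℝ => cylK c (y : ℂ)) atTop (𝓝 0) :=
      (tendsto_gaussMellin_zero (by linarith)).comp tendsto_ofReal_cobounded_inf
    have h2 : Tendsto (fun y : ℝ => G (Complex.I * y) * cylH c (y : ℂ)) atTop (𝓝 0) := by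
      -- For c = 0 the function H is constantly 1 and only G decays; for c > 0 both factors do.
      rcases hc.eq_or_lt with rfl | hc
      · simpa [cylH_zero_left] using l
      · simp only [cylH_eq_mul_gaussMellin hc]
        simpa using l.mul
          (((tendsto_gaussMellin_zero hc).comp tendsto_ofReal_cobounded_inf).const_mul (c : ℂ))
    simpa using (h1.const_mul Complex.I).sub h2

/-! ### Stieltjes transforms of probability measures -/

/-- The Stieltjes transform of a measure. -/
def stieltjesOf (μ : Measure ℝ) (z : ℂ) : ℂ := ∫ l : ℝ, 1 / ((l : ℂ) - z) ∂μ

lemma abs_im_le_norm_sub (l : ℝ) (z : ℂ) : |z.im| ≤ ‖(l : ℂ) - z‖ := by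
  have := Complex.abs_im_le_norm ((l : ℂ) - z)
  simpa using this

lemma ofReal_sub_ne_zero {z : ℂ} (hz : z.im ≠ 0) (l : ℝ) : (l : ℂ) - z ≠ 0 := by
  intro h
  have := abs_im_le_norm_sub l z
  rw [h, norm_zero] at this
  exact hz (abs_nonpos_iff.1 this)

lemma norm_one_div_sub_le {z : ℂ} (hz : z.im ≠ 0) (l : ℝ) :
    ‖1 / ((l : ℂ) - z)‖ ≤ 1 / |z.im| := by
  rw [norm_div, norm_one]
  exact one_div_le_one_div_of_le (abs_pos.2 hz) (abs_im_le_norm_sub l z)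

lemma continuous_one_div_sub {z : ℂ} (hz : z.im ≠ 0) :
    Continuous fun l : ℝ => 1 / ((l : ℂ) - z) :=
  continuous_const.div (by fun_prop) (ofReal_sub_ne_zero hz)

lemma integrable_one_div_sub (μ : Measure ℝ) [IsFiniteMeasure μ] {z : ℂ} (hz : z.im ≠ 0) :
    Integrable (fun l : ℝ => 1 / ((l : ℂ) - z)) μ :=
  Integrable.of_bound (continuous_one_div_sub hz).aestronglyMeasurable _
    (Eventually.of_forall fun l => norm_one_div_sub_le hz l)

lemma norm_stieltjesOf_le (μ : Measure ℝ) [IsProbabilityMeasure μ] {z : ℂ} (hz : z.im ≠ 0) :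
    ‖stieltjesOf μ z‖ ≤ 1 / |z.im| := by
  have := norm_integral_le_of_norm_le_const (μ := μ)
    (Eventually.of_forall fun l => norm_one_div_sub_le hz l)
  simpa [stieltjesOf] using this

lemma tendsto_stieltjesOf (μ : Measure ℝ) [IsProbabilityMeasure μ] :
    Tendsto (fun y : ℝ => stieltjesOf μ (Complex.I * y)) atTop (𝓝 0) := by
  rw [tendsto_zero_iff_norm_tendsto_zero]
  refine squeeze_zero' (Eventually.of_forall fun _ => norm_nonneg _) ?_ tendsto_inv_atTop_zero
  filter_upwards [eventually_gt_atTop 0] with y hy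
  have := norm_stieltjesOf_le μ (z := Complex.I * y) (by simpa using hy.ne')
  simpa [abs_of_pos hy] using this

lemma hasDerivAt_stieltjesOf (μ : Measure ℝ) [IsFiniteMeasure μ] {z : ℂ} (hz : z.im ≠ 0) :
    HasDerivAt (stieltjesOf μ) (∫ l : ℝ, (1 / ((l : ℂ) - z)) ^ 2 ∂μ) z := by
  have hpos := abs_pos.2 hz
  have hU : {u : ℂ | |z.im| / 2 < |u.im|} ∈ 𝓝 z :=
    (isOpen_lt continuous_const (by fun_prop)).mem_nhds (show |z.im| / 2 < |z.im| by linarith)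
  have hne : ∀ u ∈ {u : ℂ | |z.im| / 2 < |u.im|}, u.im ≠ 0 := fun u hu => by
    have : |z.im| / 2 < |u.im| := hu
    exact abs_pos.1 (by linarith)
  refine (hasDerivAt_integral_of_dominated_loc_of_deriv_le (𝕜 := ℂ)
    (F := fun (u : ℂ) (l : ℝ) => 1 / ((l : ℂ) - u))
    (F' := fun (u : ℂ) (l : ℝ) => (1 / ((l : ℂ) - u)) ^ 2)
    (bound := fun _ => (1 / (|z.im| / 2)) ^ 2) hU ?_ (integrable_one_div_sub μ hz) ?_ ?_
    (integrable_const _) ?_).2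
  · filter_upwards [hU] with u hu
    exact (continuous_one_div_sub (hne u hu)).aestronglyMeasurable
  · exact ((continuous_one_div_sub hz).pow 2).aestronglyMeasurable
  · refine Eventually.of_forall fun l u hu => ?_
    rw [norm_pow]
    gcongr
    exact (norm_one_div_sub_le (hne u hu) l).trans
      (one_div_le_one_div_of_le (by linarith) (le_of_lt hu))
  · refine Eventually.of_forall fun l u hu => ?_
    have h0 := ofReal_sub_ne_zero (hne u hu) l
    have := ((hasDerivAt_id u).const_sub (l : ℂ)).inv h0
    simp only [id, neg_neg] at this
    simpa [one_div] using! this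

lemma stieltjesOf_conj (μ : Measure ℝ) (z : ℂ) :
    stieltjesOf μ (starRingEnd ℂ z) = starRingEnd ℂ (stieltjesOf μ z) := by
  rw [stieltjesOf, stieltjesOf, ← integral_conj]
  simp

lemma im_one_div_sub (l x y : ℝ) :
    (1 / ((l : ℂ) - (x + Complex.I * y))).im = y / ((l - x) ^ 2 + y ^ 2) := by
  have : (l : ℂ) - (x + Complex.I * y) = ((l - x : ℝ) : ℂ) + ((-y : ℝ) : ℂ) * Complex.I := by
    push_cast; ring
  rw [this, one_div, Complex.inv_im, Complex.normSq_add_mul_I]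
  simp

/-- The substitution x = l + ys moves the dependence on the height y from the Poisson kernel into
the argument of f. -/
lemma poisson_integral_eq {f : ℝ → ℝ} {y : ℝ} (hy : 0 < y) (l : ℝ) :
    ∫ x : ℝ, f x * (y / ((l - x) ^ 2 + y ^ 2)) = ∫ s : ℝ, f (l + y * s) * (1 + s ^ 2)⁻¹ := by
  have h1 := integral_add_left_eq_self (μ := (volume : Measure ℝ))
    (fun x : ℝ => f x * (y / ((l - x) ^ 2 + y ^ 2))) l
  have h2 := Measure.integral_comp_mul_left (fun x : ℝ => f (l + x) *
    (y / ((l - (l + x)) ^ 2 + y ^ 2))) y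
  rw [← h1]
  rw [abs_of_pos (inv_pos.2 hy), smul_eq_mul, eq_comm, inv_mul_eq_iff_eq_mul₀ hy.ne',
    ← integral_const_mul] at h2
  rw [h2]
  congr 1
  ext s
  have : (l - (l + y * s)) ^ 2 + y ^ 2 = y ^ 2 * (1 + s ^ 2) := by ring
  rw [this]
  have h3 : 1 + s ^ 2 ≠ 0 := by positivity
  field_simp

/-- Weak Stieltjes inversion. Im of the transform at height y, divided by π, is the Poisson
smoothing of μ; Fubini moves the smoothing onto f, where it converges boundedly to f. -/
lemma tendsto_integral_mul_im_stieltjesOf (μ : Measure ℝ) [IsProbabilityMeasure μ] {f : ℝ → ℝ}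
    (hf : Continuous f) (hfc : HasCompactSupport f) :
    Tendsto (fun y : ℝ => ∫ x : ℝ, f x * (1 / Real.pi * (stieltjesOf μ (x + Complex.I * y)).im))
      (𝓝[>] 0) (𝓝 (∫ x, f x ∂μ)) := by
  obtain ⟨C, hC⟩ := hfc.exists_bound_of_continuous hf
  have hfi : Integrable f := hf.integrable_of_hasCompactSupport hfc
  have hswap : ∀ y : ℝ, 0 < y →
      ∫ x : ℝ, f x * (1 / Real.pi * (stieltjesOf μ (x + Complex.I * y)).im) =
      ∫ l, (1 / Real.pi * ∫ s : ℝ, f (l + y * s) * (1 + s ^ 2)⁻¹) ∂μ := by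
    intro y hy
    have him : ∀ x : ℝ, ((x : ℂ) + Complex.I * y).im ≠ 0 := fun x => by simpa using hy.ne'
    have h1 : ∀ x : ℝ, f x * (1 / Real.pi * (stieltjesOf μ (x + Complex.I * y)).im) =
        ∫ l, 1 / Real.pi * (f x * (y / ((l - x) ^ 2 + y ^ 2))) ∂μ := by
      intro x
      have e : (stieltjesOf μ (x + Complex.I * y)).im = ∫ l, y / ((l - x) ^ 2 + y ^ 2) ∂μ := by
        rw [stieltjesOf, ← Complex.imCLM_apply,
          ← ContinuousLinearMap.integral_comp_comm _ (integrable_one_div_sub μ (him x))]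
        simp_rw [Complex.imCLM_apply, im_one_div_sub]
      rw [e, integral_const_mul, integral_const_mul]
      ring
    simp_rw [h1]
    rw [integral_integral_swap]
    · congr 1
      ext l
      rw [integral_const_mul, poisson_integral_eq hy]
    · have hg : Integrable (fun p : ℝ × ℝ => f p.1 * (fun _ : ℝ => (1 : ℝ)) p.2)
          (volume.prod μ) := hfi.mul_prod (integrable_const 1)
      refine Integrable.const_mul (Integrable.mono' (hg.norm.mul_const (1 / y)) ?_ ?_) _
      · refine Continuous.aestronglyMeasurable ?_
        refine (hf.comp continuous_fst).mul (continuous_const.div (by fun_prop) fun p => ?_)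
        positivity
      · refine Eventually.of_forall fun p => ?_
        rw [norm_mul, mul_one]
        refine mul_le_mul_of_nonneg_left ?_ (norm_nonneg _)
        rw [Real.norm_of_nonneg (by positivity), div_le_div_iff₀ (by positivity) hy]
        nlinarith [sq_nonneg (p.2 - p.1)]
  have hlim : Tendsto (fun y : ℝ => ∫ l, (1 / Real.pi * ∫ s : ℝ, f (l + y * s) * (1 + s ^ 2)⁻¹) ∂μ)
      (𝓝[>] 0) (𝓝 (∫ x, f x ∂μ)) := by
    have hmeas : ∀ y l : ℝ, AEStronglyMeasurable (fun s : ℝ => f (l + y * s) * (1 + s ^ 2)⁻¹)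
        volume := fun y l => by
      refine Continuous.aestronglyMeasurable ?_
      refine (hf.comp (by fun_prop)).mul (Continuous.inv₀ (by fun_prop) fun s => ?_)
      positivity
    have hbd : ∀ y l s : ℝ, ‖f (l + y * s) * (1 + s ^ 2)⁻¹‖ ≤ C * (1 + s ^ 2)⁻¹ := by
      intro y l s
      rw [norm_mul, Real.norm_of_nonneg (show 0 ≤ (1 + s ^ 2)⁻¹ by positivity)]
      exact mul_le_mul_of_nonneg_right (hC _) (by positivity)
    refine tendsto_integral_filter_of_dominated_convergence
      (fun _ => 1 / Real.pi * (C * Real.pi)) ?_ ?_ (integrable_const _) ?_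
    · refine Eventually.of_forall fun y => ?_
      refine Continuous.aestronglyMeasurable ?_
      refine continuous_const.mul ?_
      refine continuous_of_dominated (fun l => hmeas y l) (fun l => Eventually.of_forall (hbd y l))
        (integrable_inv_one_add_sq.const_mul C) (Eventually.of_forall fun s => ?_)
      exact (hf.comp (by fun_prop)).mul continuous_const
    · refine Eventually.of_forall fun y => Eventually.of_forall fun l => ?_
      rw [norm_mul, Real.norm_of_nonneg (by have := Real.pi_pos; positivity)]
      refine mul_le_mul_of_nonneg_left ?_ (by have := Real.pi_pos; positivity)
      rw [← integral_univ_inv_one_add_sq, ← integral_const_mul]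
      exact norm_integral_le_of_norm_le (integrable_inv_one_add_sq.const_mul C)
        (Eventually.of_forall (hbd y l))
    · refine Eventually.of_forall fun l => ?_
      have h2 : Tendsto (fun y : ℝ => ∫ s : ℝ, f (l + y * s) * (1 + s ^ 2)⁻¹) (𝓝[>] 0)
          (𝓝 (∫ s : ℝ, f l * (1 + s ^ 2)⁻¹)) := by
        refine tendsto_integral_filter_of_dominated_convergence (fun s => C * (1 + s ^ 2)⁻¹)
          (Eventually.of_forall fun y => hmeas y l)
          (Eventually.of_forall fun y => Eventually.of_forall (hbd y l))
          (integrable_inv_one_add_sq.const_mul C) (Eventually.of_forall fun s => ?_)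
        have : Continuous fun y : ℝ => f (l + y * s) * (1 + s ^ 2)⁻¹ :=
          (hf.comp (by fun_prop)).mul continuous_const
        have := (this.tendsto 0).mono_left (nhdsWithin_le_nhds (s := Set.Ioi 0))
        simpa using this
      have h3 := h2.const_mul (1 / Real.pi)
      rw [integral_const_mul, integral_univ_inv_one_add_sq] at h3
      convert! h3 using 2
      have := Real.pi_ne_zero
      field_simp
  refine hlim.congr' ?_
  filter_upwards [self_mem_nhdsWithin] with y hy
  exact (hswap y hy).symm

/-! ### Identification of the solution of the Riccati equation -/

/-- The measure with density `crossoverDensity c`. -/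
def crossoverMeasure (c : ℝ) : Measure ℝ :=
  volume.withDensity fun l => ENNReal.ofReal (crossoverDensity c l)

lemma integral_crossoverMeasure {E : Type*} [NormedAddCommGroup E] [NormedSpace ℝ E] {c : ℝ}
    (hc : 0 ≤ c) (g : ℝ → E) : ∫ l, g l ∂crossoverMeasure c = ∫ l, crossoverDensity c l • g l := by
  rw [crossoverMeasure, integral_withDensity_eq_integral_toReal_smul
    (continuous_crossoverDensity hc).measurable.ennreal_ofReal
    (Eventually.of_forall fun _ => ENNReal.ofReal_lt_top)]
  simp_rw [ENNReal.toReal_ofReal (crossoverDensity_pos hc _).le]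

lemma stieltjesOf_crossoverMeasure {c : ℝ} (hc : 0 ≤ c) (z : ℂ) :
    stieltjesOf (crossoverMeasure c) z = stieltjesTransform (crossoverDensity c) z := by
  rw [stieltjesOf, integral_crossoverMeasure hc, stieltjesTransform]
  congr 1
  ext l
  rw [Complex.real_smul, mul_one_div]

/-- The limit is taken jointly in height p.1 and position p.2; joint convergence yields the
uniformity on compact sets needed for dominated convergence. -/
lemma tendsto_im_cylK_div_cylH {c : ℝ} (hc : 0 ≤ c) (x : ℝ) :
    Tendsto (fun p : ℝ × ℝ => 1 / Real.pi * (Complex.I * cylK c (-Complex.I * (p.2 + Complex.I * p.1)) /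
      cylH c (-Complex.I * (p.2 + Complex.I * p.1))).im) (𝓝 (0, x))
      (𝓝 (crossoverDensity c x)) := by
  have h0 : -Complex.I * ((x : ℂ) + Complex.I * (0 : ℝ)) = -Complex.I * x := by simp
  have hK := continuous_cylK hc
  have hH := continuous_cylH hc
  have hcont : ContinuousAt (fun p : ℝ × ℝ =>
      1 / Real.pi * (Complex.I * cylK c (-Complex.I * (p.2 + Complex.I * p.1)) /
        cylH c (-Complex.I * (p.2 + Complex.I * p.1))).im) (0, x) := by
    refine continuousAt_const.mul (Complex.continuous_im.continuousAt.comp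
      (ContinuousAt.div (by fun_prop) (by fun_prop) ?_))
    simp only [h0]
    exact cylH_ne_zero hc x
  have := hcont.tendsto
  simp only [h0] at this
  rwa [mul_div_assoc, Complex.mul_im, Complex.I_re, Complex.I_im, zero_mul, zero_add, one_mul,
    ← crossoverDensity_eq_re_div hc] at this

lemma eventually_cylH_ne_zero {c : ℝ} (hc : 0 ≤ c) (x : ℝ) :
    ∀ᶠ p : ℝ × ℝ in 𝓝 (0, x), cylH c (-Complex.I * (p.2 + Complex.I * p.1)) ≠ 0 := by
  have hH := continuous_cylH hc
  have hcont : Continuous (fun p : ℝ × ℝ => cylH c (-Complex.I * (p.2 + Complex.I * p.1))) := by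
    fun_prop
  exact hcont.continuousAt.eventually_ne (by simpa using cylH_ne_zero hc x)

lemma SolvesRiccatiUpper.eq_div {c : ℝ} (hc : 0 ≤ c) {G : ℂ → ℂ} (h : SolvesRiccatiUpper c G)
    (l : Tendsto (fun y : ℝ => G (Complex.I * y)) atTop (𝓝 0)) {z : ℂ} (hz : 0 < z.im)
    (h0 : cylH c (-Complex.I * z) ≠ 0) :
    G z = Complex.I * cylK c (-Complex.I * z) / cylH c (-Complex.I * z) := by
  rw [eq_div_iff h0, h.mul_cylH hc l hz]

lemma tendsto_im_of_solvesRiccatiUpper {c : ℝ} (hc : 0 ≤ c) {G : ℂ → ℂ}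
    (h : SolvesRiccatiUpper c G) (l : Tendsto (fun y : ℝ => G (Complex.I * y)) atTop (𝓝 0))
    (x : ℝ) :
    Tendsto (fun y : ℝ => 1 / Real.pi * (G (x + Complex.I * y)).im) (𝓝[>] 0)
      (𝓝 (crossoverDensity c x)) := by
  have hp : Tendsto (fun y : ℝ => (y, x)) (𝓝[>] 0) (𝓝 (0, x)) :=
    ((continuous_id.prodMk continuous_const).tendsto (0 : ℝ)).mono_left nhdsWithin_le_nhds
  refine ((tendsto_im_cylK_div_cylH hc x).comp hp).congr' ?_
  filter_upwards [hp.eventually (eventually_cylH_ne_zero hc x), self_mem_nhdsWithin] with y hy hy0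
  rw [h.eq_div hc l (by simpa using hy0) hy]
  rfl

/-- The same integrals have two limits as y ↓ 0: weak Stieltjes inversion gives the integral against
μ, and the explicit quotient iK/H, valid near the real axis, gives the integral against the density.
-/
lemma integral_eq_of_solvesRiccatiUpper {c : ℝ} (hc : 0 ≤ c) {μ : Measure ℝ}
    [IsProbabilityMeasure μ] (h : SolvesRiccatiUpper c (stieltjesOf μ)) {f : ℝ → ℝ}
    (hf : Continuous f) (hfc : HasCompactSupport f) :
    ∫ x, f x ∂μ = ∫ x, crossoverDensity c x * f x := by
  have hl := tendsto_stieltjesOf μ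
  have hρ := continuous_crossoverDensity hc
  refine tendsto_nhds_unique (tendsto_integral_mul_im_stieltjesOf μ hf hfc) ?_
  -- Compactness of the support of f gives one strip in which H is nonzero over the support and Im
  -- G/π stays below the boundary density plus 1.
  have hev : ∀ᶠ y : ℝ in 𝓝 0, ∀ x ∈ tsupport f,
      cylH c (-Complex.I * (x + Complex.I * y)) ≠ 0 ∧
      ‖1 / Real.pi * (Complex.I * cylK c (-Complex.I * (x + Complex.I * y)) /
      cylH c (-Complex.I * (x + Complex.I * y))).im‖ < crossoverDensity c x + 1 := by
    refine IsCompact.eventually_forall_of_forall_eventually hfc fun x _ => ?_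
    refine (eventually_cylH_ne_zero hc x).and ?_
    refine (tendsto_im_cylK_div_cylH hc x).norm.eventually_lt
      ((hρ.comp continuous_snd).add continuous_const).continuousAt ?_
    change ‖crossoverDensity c x‖ < crossoverDensity c x + 1
    rw [Real.norm_of_nonneg (crossoverDensity_pos hc x).le]
    linarith
  refine tendsto_integral_filter_of_dominated_convergence
    (fun x => ‖f x‖ * (crossoverDensity c x + 1)) ?_ ?_ ?_ ?_
  · filter_upwards [self_mem_nhdsWithin] with y hy
    have hy : 0 < y := hy
    refine Continuous.aestronglyMeasurable (hf.mul (continuous_const.mul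
      (Complex.continuous_im.comp ?_)))
    refine continuous_iff_continuousAt.2 fun x => ?_
    have : ContinuousAt (stieltjesOf μ) (x + Complex.I * y) :=
      (hasDerivAt_stieltjesOf μ (by simpa using hy.ne')).continuousAt
    exact this.comp (f := fun x : ℝ => (x : ℂ) + Complex.I * y) (by fun_prop)
  · filter_upwards [hev.filter_mono nhdsWithin_le_nhds, self_mem_nhdsWithin] with y hy hy0
    refine Eventually.of_forall fun x => ?_
    by_cases hx : x ∈ tsupport f
    · rw [norm_mul]
      refine mul_le_mul_of_nonneg_left ?_ (norm_nonneg _)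
      rw [h.eq_div hc hl (by simpa using hy0) (hy x hx).1]
      exact (hy x hx).2.le
    · simp [image_eq_zero_of_notMem_tsupport hx]
  · have : Continuous fun x => ‖f x‖ * (crossoverDensity c x + 1) := by fun_prop
    refine this.integrable_of_hasCompactSupport ?_
    exact hfc.norm.mul_right
  · refine Eventually.of_forall fun x => ?_
    rw [mul_comm (crossoverDensity c x)]
    exact (tendsto_im_of_solvesRiccatiUpper hc h hl x).const_mul (f x)

lemma eq_crossoverMeasure {c : ℝ} (hc : 0 ≤ c) {μ : Measure ℝ}
    [IsProbabilityMeasure μ] (h : SolvesRiccatiUpper c (stieltjesOf μ)) :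
    μ = crossoverMeasure c := by
  have : IsLocallyFiniteMeasure (crossoverMeasure c) :=
    IsLocallyFiniteMeasure.withDensity_ofReal (continuous_crossoverDensity hc)
  refine Measure.ext_of_integral_eq_on_compactlySupported fun f => ?_
  rw [integral_crossoverMeasure hc]
  exact integral_eq_of_solvesRiccatiUpper hc h (map_continuous f) f.hasCompactSupport

/-! ### Reflection in the real axis, and decay at infinity -/

/-- The coefficients of the equation are real on the real axis, so z ↦ conj G(conj z) is again a
solution. This reduces the lower half-plane to the upper one. -/
lemma solvesRiccati_conj {c : ℝ} {G : ℂ → ℂ} (h : SolvesRiccati c G) :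
    SolvesRiccatiUpper c (starRingEnd ℂ ∘ G ∘ starRingEnd ℂ) := by
  intro z hz
  obtain ⟨h1, h2⟩ := h (starRingEnd ℂ z) (by simpa using hz.ne')
  constructor
  · simpa using h1.conj_conj
  · rw [show z = starRingEnd ℂ (starRingEnd ℂ z) by simp, (h1.hasDerivAt.conj_conj).deriv]
    have := congrArg (starRingEnd ℂ) h2
    simpa using this

lemma solvesRiccati_stieltjesOf {c : ℝ} {μ : Measure ℝ}
    [IsProbabilityMeasure μ] (h : SolvesRiccatiUpper c (stieltjesOf μ)) :
    SolvesRiccati c (stieltjesOf μ) := by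
  intro z hz
  have hd := hasDerivAt_stieltjesOf μ hz
  refine ⟨hd.differentiableAt, ?_⟩
  rcases lt_or_gt_of_ne hz with hz | hz
  · have h2 := (h (starRingEnd ℂ z) (by simpa using hz)).2
    have e : stieltjesOf μ = starRingEnd ℂ ∘ stieltjesOf μ ∘ starRingEnd ℂ := by
      ext u; simp [stieltjesOf_conj]
    have e2 : deriv (stieltjesOf μ) (starRingEnd ℂ z) =
        starRingEnd ℂ (deriv (stieltjesOf μ) z) := by
      conv_lhs => rw [e]
      exact hd.differentiableAt.hasDerivAt.conj_conj.deriv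
    rw [stieltjesOf_conj, e2] at h2
    have := congrArg (starRingEnd ℂ) h2
    simpa using this
  · exact (h z hz).2

/-- From G = iK/H one gets -zG = i/(i - z⁻¹ M_{c+2}/M_{c+1}) with both functions at -iz, and the
ratio tends to 0 on the right half-plane. The asymptotics of M_{c+1} also make H nonzero for large
|z|. -/
lemma tendsto_neg_mul_of_solvesRiccatiUpper {c : ℝ} (hc : 0 ≤ c) {G : ℂ → ℂ}
    (h : SolvesRiccatiUpper c G) (l : Tendsto (fun y : ℝ => G (Complex.I * y)) atTop (𝓝 0)) :
    Tendsto (fun z => -z * G z) (Bornology.cobounded ℂ ⊓ 𝓟 {z : ℂ | 0 < z.im}) (𝓝 1) := by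
  set L := Bornology.cobounded ℂ ⊓ 𝓟 {z : ℂ | 0 < z.im}
  have hpos : ∀ᶠ z in L, 0 < z.im := mem_inf_of_right (mem_principal_self _)
  have hmap : Tendsto (fun z : ℂ => -Complex.I * z) L
      (Bornology.cobounded ℂ ⊓ 𝓟 {ζ : ℂ | 0 ≤ ζ.re}) := by
    refine tendsto_inf.2 ⟨?_, tendsto_principal.2 ?_⟩
    · rw [← tendsto_norm_atTop_iff_cobounded]
      have : Tendsto (fun z : ℂ => ‖z‖) L atTop := tendsto_norm_cobounded_atTop.mono_left inf_le_left
      simpa using this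
    · filter_upwards [hpos] with z hz
      simpa using hz.le
  have hinv : Tendsto (fun z : ℂ => z⁻¹) L (𝓝 0) := tendsto_inv₀_cobounded.mono_left inf_le_left
  have hr := (tendsto_gaussMellin_ratio (s := c + 1) (by linarith)).comp hmap
  have hK := hmap.eventually (eventually_gaussMellin_ne_zero (s := c + 1) (by linarith))
  have hmain : Tendsto (fun z : ℂ => Complex.I / (Complex.I - z⁻¹ *
      (gaussMellin (-Complex.I * z) 1 (c + 1 + 1) / gaussMellin (-Complex.I * z) 1 (c + 1)))) L
      (𝓝 1) := by
    have := (tendsto_const_nhds (x := Complex.I)).div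
      ((tendsto_const_nhds (x := Complex.I)).sub (hinv.mul hr)) (by simp)
    simpa [Pi.div_def] using this
  refine hmain.congr' ?_
  have hne : ∀ᶠ z in L, z⁻¹ *
      (gaussMellin (-Complex.I * z) 1 (c + 1 + 1) / gaussMellin (-Complex.I * z) 1 (c + 1)) ≠
      Complex.I := by
    have := hinv.mul hr
    rw [zero_mul] at this
    exact this.eventually_ne Complex.I_ne_zero.symm
  filter_upwards [hpos, hK, hne] with z hz hk hn
  have hz0 : z ≠ 0 := by rintro rfl; simp at hz
  have hH : cylH c (-Complex.I * z) = -z * gaussMellin (-Complex.I * z) 1 (c + 1) *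
      (Complex.I - z⁻¹ * (gaussMellin (-Complex.I * z) 1 (c + 1 + 1) /
        gaussMellin (-Complex.I * z) 1 (c + 1))) := by
    rw [cylH, show c + 1 + 1 = c + 2 by ring]
    generalize gaussMellin (-Complex.I * z) 1 (c + 1) = M at hk
    field_simp
    ring
  have h3 := sub_ne_zero.2 hn.symm
  rw [h.eq_div hc l hz (by rw [hH]; exact mul_ne_zero (mul_ne_zero (neg_ne_zero.2 hz0) hk) h3), hH,
    cylK]
  generalize (Complex.I - z⁻¹ * (gaussMellin (-Complex.I * z) 1 (c + 1 + 1) /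
        gaussMellin (-Complex.I * z) 1 (c + 1))) = r at h3 ⊢
  generalize gaussMellin (-Complex.I * z) 1 (c + 1) = M at hk ⊢
  field_simp

lemma hasStieltjesDecay_of_tendsto {G : ℂ → ℂ}
    (h₁ : Tendsto (fun z => -z * G z) (Bornology.cobounded ℂ ⊓ 𝓟 {z : ℂ | 0 < z.im}) (𝓝 1))
    (h₂ : Tendsto (fun z => -z * G z) (Bornology.cobounded ℂ ⊓ 𝓟 {z : ℂ | z.im < 0}) (𝓝 1)) :
    HasStieltjesDecay G := by
  have hset : {z : ℂ | z.im ≠ 0} = {z : ℂ | 0 < z.im} ∪ {z : ℂ | z.im < 0} := by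
    ext z; simp [or_comm]
  rw [HasStieltjesDecay, hset, ← sup_principal, inf_sup_left]
  have h := h₁.sup h₂
  have hne : ∀ᶠ z : ℂ in Bornology.cobounded ℂ ⊓ 𝓟 {z : ℂ | 0 < z.im} ⊔
      Bornology.cobounded ℂ ⊓ 𝓟 {z : ℂ | z.im < 0}, -1 / z ≠ 0 := by
    rw [← inf_sup_left]
    have : ∀ᶠ z : ℂ in Bornology.cobounded ℂ, z ≠ 0 := by
      have := (tendsto_norm_cobounded_atTop (E := ℂ)).eventually_gt_atTop 0
      filter_upwards [this] with z hz using norm_pos_iff.1 hz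
    filter_upwards [this.filter_mono inf_le_left] with z hz
    exact div_ne_zero (by simp) hz
  rw [isEquivalent_iff_tendsto_one hne]
  refine h.congr fun z => ?_
  simp only [Pi.div_apply]
  rw [div_div_eq_mul_div, div_neg, div_one]
  ring

lemma HasStieltjesDecay.tendsto {G : ℂ → ℂ} (h : HasStieltjesDecay G) :
    Tendsto G (Bornology.cobounded ℂ ⊓ 𝓟 {z : ℂ | z.im ≠ 0}) (𝓝 0) := by
  refine h.symm.tendsto_nhds ?_
  have := (tendsto_inv₀_cobounded (α := ℂ)).neg.mono_left
    (inf_le_left (a := Bornology.cobounded ℂ) (b := 𝓟 {z : ℂ | z.im ≠ 0}))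
  simpa [neg_div] using this

lemma tendsto_I_mul_cobounded {ε : ℝ} (hε : ε = 1 ∨ ε = -1) :
    Tendsto (fun y : ℝ => ε * (Complex.I * (y : ℂ))) atTop
      (Bornology.cobounded ℂ ⊓ 𝓟 {z : ℂ | z.im ≠ 0}) := by
  refine tendsto_inf.2 ⟨?_, tendsto_principal.2 ?_⟩
  · rw [← tendsto_norm_atTop_iff_cobounded]
    rcases hε with rfl | rfl <;> simpa using tendsto_abs_atTop_atTop
  · filter_upwards [eventually_gt_atTop 0] with y hy
    rcases hε with rfl | rfl <;> simpa using hy.ne'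

lemma hasStieltjesDecay_stieltjesOf {c : ℝ} (hc : 0 ≤ c) {μ : Measure ℝ}
    [IsProbabilityMeasure μ] (h : SolvesRiccatiUpper c (stieltjesOf μ)) :
    HasStieltjesDecay (stieltjesOf μ) := by
  have h1 := tendsto_neg_mul_of_solvesRiccatiUpper hc h (tendsto_stieltjesOf μ)
  refine hasStieltjesDecay_of_tendsto h1 ?_
  have hmap : Tendsto (starRingEnd ℂ) (Bornology.cobounded ℂ ⊓ 𝓟 {z : ℂ | z.im < 0})
      (Bornology.cobounded ℂ ⊓ 𝓟 {z : ℂ | 0 < z.im}) := by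
    refine tendsto_inf.2 ⟨?_, tendsto_principal.2 ?_⟩
    · rw [← tendsto_norm_atTop_iff_cobounded]
      simpa using (tendsto_norm_cobounded_atTop (E := ℂ)).mono_left inf_le_left
    · have : ∀ᶠ z in Bornology.cobounded ℂ ⊓ 𝓟 {z : ℂ | z.im < 0}, z.im < 0 :=
        mem_inf_of_right (mem_principal_self _)
      filter_upwards [this] with z hz
      simpa using hz
  have h2 := (Complex.continuous_conj.tendsto 1).comp (h1.comp hmap)
  rw [map_one] at h2
  refine h2.congr fun z => ?_
  simp [stieltjesOf_conj]

lemma SolvesRiccati.unique {c : ℝ} {G₁ G₂ : ℂ → ℂ} (h₁ : SolvesRiccati c G₁)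
    (h₂ : SolvesRiccati c G₂) (d₁ : HasStieltjesDecay G₁) (d₂ : HasStieltjesDecay G₂) {z : ℂ}
    (hz : z.im ≠ 0) : G₁ z = G₂ z := by
  have hp : ∀ {G : ℂ → ℂ}, HasStieltjesDecay G →
      Tendsto (fun y : ℝ => G (Complex.I * y)) atTop (𝓝 0) := fun {G} d => by
    simpa [Function.comp_def] using d.tendsto.comp (tendsto_I_mul_cobounded (Or.inl rfl))
  have hm : ∀ {G : ℂ → ℂ}, HasStieltjesDecay G →
      Tendsto (fun y : ℝ => (starRingEnd ℂ ∘ G ∘ starRingEnd ℂ) (Complex.I * y)) atTop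
        (𝓝 0) := fun {G} d => by
    have := (Complex.continuous_conj.tendsto 0).comp
      (d.tendsto.comp (tendsto_I_mul_cobounded (Or.inr rfl)))
    simpa [Function.comp_def] using this
  rcases lt_or_gt_of_ne hz with hz | hz
  · have := SolvesRiccatiUpper.unique (solvesRiccati_conj h₁) (solvesRiccati_conj h₂) (hm d₁) (hm d₂)
      (z := starRingEnd ℂ z) (by simpa using hz)
    exact (starRingEnd ℂ).injective (by simpa using this)
  · exact SolvesRiccatiUpper.unique (fun z hz => h₁ z hz.ne') (fun z hz => h₂ z hz.ne') (hp d₁)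
      (hp d₂) hz

/-! ### The regularised Boltzmann weight -/

/-- The logarithm of the Boltzmann weight, with `|xᵢ - xⱼ|²` replaced by `|xᵢ - xⱼ|² + ε`. -/
def regLogWeight (β : ℝ) {N : ℕ} (ε : ℝ) (x : Fin N → ℝ) : ℝ :=
  β / 4 * ∑ i, ∑ j ∈ Finset.univ.erase i, Real.log ((x i - x j) ^ 2 + ε) - 1 / 2 * ∑ i, x i ^ 2

/-- The regularised Boltzmann weight. -/
def regWeight (β : ℝ) {N : ℕ} (ε : ℝ) (x : Fin N → ℝ) : ℝ := Real.exp (regLogWeight β ε x)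

section

variable {N : ℕ}

/-- `regLogWeight` runs over ordered pairs, hence its factor β/4; each unordered pair contributes
β/2, the exponent suited to squared distances. -/
lemma regWeight_eq_prod {β ε : ℝ} (hε : 0 < ε) (x : Fin N → ℝ) :
    regWeight β ε x = (∏ i : Fin N, ∏ j ∈ Finset.Ioi i, ((x i - x j) ^ 2 + ε) ^ (β / 2)) *
      Real.exp (-(1 / 2) * ∑ i : Fin N, x i ^ 2) := by
  have h1 : ∀ i j : Fin N, ((x i - x j) ^ 2 + ε) ^ (β / 2) =
      Real.exp (β / 2 * Real.log ((x i - x j) ^ 2 + ε)) := fun i j => by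
    rw [Real.rpow_def_of_pos (by positivity), mul_comm]
  simp_rw [h1]
  rw [regWeight, regLogWeight]
  simp_rw [← Real.exp_sum]
  rw [← Real.exp_add]
  congr 1
  have h2 := Finset.sum_sum_Ioi_add_eq_sum_sum_off_diag
    (fun i j : Fin N => Real.log ((x i - x j) ^ 2 + ε))
  have h3 : ∀ i : Fin N, ∑ j ∈ Finset.univ.erase i, Real.log ((x i - x j) ^ 2 + ε) =
      ∑ j ∈ {i}ᶜ, Real.log ((x j - x i) ^ 2 + ε) := fun i => by
    rw [Finset.compl_eq_univ_sdiff, Finset.sdiff_singleton_eq_erase]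
    refine Finset.sum_congr rfl fun j _ => ?_
    rw [← neg_sub, neg_sq]
  simp_rw [h3]
  rw [← h2, Finset.mul_sum, sub_eq_add_neg, neg_mul]
  congr 1
  refine Finset.sum_congr rfl fun i _ => ?_
  rw [Finset.mul_sum]
  refine Finset.sum_congr rfl fun j _ => ?_
  rw [← neg_sub (x i) (x j), neg_sq]
  ring

lemma tendsto_regWeight {c : ℝ} (hc : 0 ≤ c) (x : Fin N → ℝ) :
    Tendsto (fun ε => regWeight (2 * c / N) ε x) (𝓝[>] 0) (𝓝 (gibbsWeight c N x)) := by
  have h1 : ∀ t : ℝ, Tendsto (fun ε : ℝ => (t ^ 2 + ε) ^ (2 * c / N / 2)) (𝓝[>] 0)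
      (𝓝 (|t| ^ (2 * c / N))) := by
    intro t
    have e : |t| ^ (2 * c / N) = (t ^ 2 + 0) ^ (2 * c / N / 2) := by
      rw [add_zero, ← sq_abs, ← Real.rpow_natCast, ← Real.rpow_mul (abs_nonneg t)]
      congr 1
      push_cast
      ring
    rw [e]
    have hcont : ContinuousAt (fun ε : ℝ => (t ^ 2 + ε) ^ (2 * c / N / 2)) 0 :=
      ContinuousAt.rpow_const (by fun_prop) (Or.inr (by positivity))
    exact hcont.tendsto.mono_left nhdsWithin_le_nhds
  have h2 : Tendsto (fun ε => (∏ i : Fin N, ∏ j ∈ Finset.Ioi i,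
      ((x i - x j) ^ 2 + ε) ^ (2 * c / N / 2)) * Real.exp (-(1 / 2) * ∑ i : Fin N, x i ^ 2))
      (𝓝[>] 0) (𝓝 (gibbsWeight c N x)) :=
    (tendsto_finsetProd _ fun i _ => tendsto_finsetProd _ fun j _ => h1 _).mul_const _
  refine h2.congr' ?_
  filter_upwards [self_mem_nhdsWithin] with ε hε
  exact (regWeight_eq_prod hε x).symm

lemma hasLineDerivAt_regWeight (β : ℝ) {ε : ℝ} (hε : 0 < ε) (k : Fin N) (x : Fin N → ℝ) :
    HasLineDerivAt ℝ (regWeight β ε) (regWeight β ε x *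
      (-x k + β * ∑ j, (x k - x j) / ((x k - x j) ^ 2 + ε))) x (Pi.single k 1) := by
  have hx : ∀ i, HasDerivAt (fun t : ℝ => (x + t • (Pi.single k 1 : Fin N → ℝ)) i)
      ((Pi.single k 1 : Fin N → ℝ) i) 0 := fun i => by
    have := ((hasDerivAt_id (0 : ℝ)).mul_const ((Pi.single k 1 : Fin N → ℝ) i)).const_add (x i)
    simpa using! this
  have h0 : ∀ i, (x + (0 : ℝ) • (Pi.single k 1 : Fin N → ℝ)) i = x i := fun i => by simp
  set e : Fin N → ℝ := Pi.single k 1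
  have hlog : ∀ i j, HasDerivAt (fun t : ℝ => Real.log (((x + t • e) i - (x + t • e) j) ^ 2 + ε))
      (2 * (x i - x j) * (e i - e j) / ((x i - x j) ^ 2 + ε)) 0 := fun i j => by
    have h1 := ((((hx i).sub (hx j)).pow 2).add_const ε).log (by
      simp only [Pi.sub_apply, Pi.pow_apply, h0]; positivity)
    refine h1.congr_deriv ?_
    simp only [Pi.sub_apply, Pi.pow_apply, h0]
    push_cast
    ring
  have hs := ((HasDerivAt.fun_sum fun i (_ : i ∈ (Finset.univ : Finset (Fin N))) =>
    HasDerivAt.fun_sum fun j (_ : j ∈ Finset.univ.erase i) => hlog i j).const_mul (β / 4)).sub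
    ((HasDerivAt.fun_sum fun i (_ : i ∈ (Finset.univ : Finset (Fin N))) =>
      (hx i).pow 2).const_mul (1 / 2))
  have hmain := hs.exp
  refine HasDerivAt.congr_deriv (f' := _) hmain ?_
  have e1 : Real.exp (regLogWeight β ε (x + (0 : ℝ) • e)) = regWeight β ε x := by
    simp [regWeight]
  have e2 : ∀ i, ∑ j ∈ Finset.univ.erase i, 2 * (x i - x j) * (e i - e j) / ((x i - x j) ^ 2 + ε) =
      ∑ j, 2 * (x i - x j) * (e i - e j) / ((x i - x j) ^ 2 + ε) := fun i =>
    Finset.sum_erase _ (by simp)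
  -- The kernel t/(t² + ε) is odd, so the parts from e_i and e_j are equal and contribute 2 each;
  -- the 4 cancels the factor β/4.
  have e3 : ∑ i, ∑ j, 2 * (x i - x j) * (e i - e j) / ((x i - x j) ^ 2 + ε) =
      4 * ∑ j, (x k - x j) / ((x k - x j) ^ 2 + ε) := by
    have s1 : ∑ i, ∑ j, 2 * ((x i - x j) / ((x i - x j) ^ 2 + ε)) * e i =
        2 * ∑ j, (x k - x j) / ((x k - x j) ^ 2 + ε) := by
      simp_rw [← Finset.sum_mul, ← Finset.mul_sum]
      simp [e, Pi.single_apply]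
    have s2 : ∑ i, ∑ j, 2 * ((x i - x j) / ((x i - x j) ^ 2 + ε)) * e j =
        -(2 * ∑ j, (x k - x j) / ((x k - x j) ^ 2 + ε)) := by
      rw [Finset.sum_comm]
      simp_rw [← Finset.sum_mul, ← Finset.mul_sum]
      simp only [e, Pi.single_apply, mul_ite, mul_one, mul_zero, Finset.sum_ite_eq',
        Finset.mem_univ, if_true]
      rw [← mul_neg, ← Finset.sum_neg_distrib]
      congr 1
      refine Finset.sum_congr rfl fun j _ => ?_
      rw [← neg_sub (x k) (x j), neg_sq, neg_div]
    calc _ = ∑ i, ∑ j, 2 * ((x i - x j) / ((x i - x j) ^ 2 + ε)) * e i -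
        ∑ i, ∑ j, 2 * ((x i - x j) / ((x i - x j) ^ 2 + ε)) * e j := by
          rw [← Finset.sum_sub_distrib]
          refine Finset.sum_congr rfl fun i _ => ?_
          rw [← Finset.sum_sub_distrib]
          refine Finset.sum_congr rfl fun j _ => ?_
          ring
      _ = _ := by rw [s1, s2]; ring
  have e4 : ∑ i, ((2 : ℕ) : ℝ) * (x + (0 : ℝ) • e) i ^ (2 - 1) * e i = 2 * x k := by
    simp [e, Pi.single_apply]
  have e5 : Real.exp (((fun t : ℝ => β / 4 * ∑ i, ∑ j ∈ Finset.univ.erase i,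
      Real.log (((x + t • e) i - (x + t • e) j) ^ 2 + ε)) -
      fun t : ℝ => 1 / 2 * ∑ i, ((fun t : ℝ => (x + t • e) i) ^ 2) t) 0) = regWeight β ε x := e1
  rw [e5]
  simp_rw [e2]
  rw [e3, e4]
  ring

end

/-! ### Estimates uniform in the regularisation -/

/-- Apply log v ≤ v - 1 to v = δ(u+1). A small slope δ lets the Gaussian absorb the logarithmic
interaction. -/
lemma log_one_add_le {δ u : ℝ} (hδ : 0 < δ) (hδ1 : δ ≤ 1) (hu : 0 ≤ u) :
    Real.log (u + 1) ≤ δ * u - Real.log δ := by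
  have h := Real.log_le_sub_one_of_pos (show 0 < δ * (u + 1) by positivity)
  rw [Real.log_mul hδ.ne' (by positivity)] at h
  linarith

/-- A bound for the regularised weight which is uniform in `ε ∈ (0, 1]`, and which keeps one of the
factors `(|x_k - x_j|² + ε)^{β/4}`. -/
lemma exists_regWeight_le {β : ℝ} (hβ : 0 ≤ β) (N : ℕ) :
    ∃ C : ℝ, 0 < C ∧ ∀ ε : ℝ, 0 < ε → ε ≤ 1 → ∀ x : Fin N → ℝ,
      regWeight β ε x ≤ C * Real.exp (-(3 / 8) * ∑ i, x i ^ 2) ∧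
      ∀ k j : Fin N, k ≠ j → regWeight β ε x ≤ C * Real.exp (-(3 / 8) * ∑ i, x i ^ 2) *
        ((x k - x j) ^ 2 + ε) ^ (β / 4) := by
  -- This choice makes βδN ≤ 1/8: the interaction consumes at most 1/8 of the Gaussian rate 1/2,
  -- which leaves 3/8.
  set δ : ℝ := 1 / (8 * (β * N + 1)) with hδdef
  have hN : (0 : ℝ) ≤ N := N.cast_nonneg
  have hδ : 0 < δ := by positivity
  have hδ1 : δ ≤ 1 := by
    rw [hδdef, div_le_one (by positivity)]
    nlinarith [mul_nonneg hβ hN]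
  set K := -Real.log δ
  have hK : 0 ≤ K := by
    have := Real.log_nonpos hδ.le hδ1
    simp only [K]; linarith
  have hδβ : β * δ * N ≤ 1 / 8 := by
    rw [hδdef, mul_one_div, div_mul_eq_mul_div, div_le_iff₀ (by positivity)]
    nlinarith [mul_nonneg hβ hN]
  refine ⟨Real.exp (β / 4 * (N * (N * K))), Real.exp_pos _, fun ε hε hε1 x => ?_⟩
  have hterm : ∀ i j, Real.log ((x i - x j) ^ 2 + 1) ≤ 2 * δ * (x i ^ 2 + x j ^ 2) + K := by
    intro i j
    have h1 := log_one_add_le hδ hδ1 (sq_nonneg (x i - x j))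
    have h2 : (x i - x j) ^ 2 ≤ 2 * (x i ^ 2 + x j ^ 2) := by nlinarith [sq_nonneg (x i + x j)]
    have := mul_le_mul_of_nonneg_left h2 hδ.le
    simp only [K]; linarith
  have hnn : ∀ i j, 0 ≤ Real.log ((x i - x j) ^ 2 + 1) := fun i j =>
    Real.log_nonneg (by nlinarith [sq_nonneg (x i - x j)])
  have hle : ∀ i j, Real.log ((x i - x j) ^ 2 + ε) ≤ Real.log ((x i - x j) ^ 2 + 1) := fun i j =>
    Real.log_le_log (by positivity) (by linarith)
  have hsum : ∑ i, ∑ j ∈ Finset.univ.erase i, Real.log ((x i - x j) ^ 2 + 1) ≤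
      4 * δ * N * ∑ i, x i ^ 2 + N * (N * K) := by
    calc _ ≤ ∑ i, ∑ j, Real.log ((x i - x j) ^ 2 + 1) :=
          Finset.sum_le_sum fun i _ => Finset.sum_le_sum_of_subset_of_nonneg
            (Finset.erase_subset _ _) fun j _ _ => hnn i j
      _ ≤ ∑ i, ∑ j, (2 * δ * (x i ^ 2 + x j ^ 2) + K) :=
          Finset.sum_le_sum fun i _ => Finset.sum_le_sum fun j _ => hterm i j
      _ = _ := by
          simp only [Finset.sum_add_distrib, ← Finset.mul_sum, Finset.sum_const, Finset.card_univ,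
            Fintype.card_fin, nsmul_eq_mul]
          ring
  have hβsum : β / 4 * ∑ i, ∑ j ∈ Finset.univ.erase i, Real.log ((x i - x j) ^ 2 + 1) ≤
      1 / 8 * ∑ i, x i ^ 2 + β / 4 * (N * (N * K)) := by
    have h1 := mul_le_mul_of_nonneg_left hsum (show 0 ≤ β / 4 by positivity)
    have h2 := mul_le_mul_of_nonneg_right hδβ (Finset.sum_nonneg fun i (_ : i ∈ Finset.univ) =>
      sq_nonneg (x i))
    nlinarith
  constructor
  · rw [regWeight, ← Real.exp_add]
    refine Real.exp_le_exp.2 ?_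
    have h1 := mul_le_mul_of_nonneg_left (Finset.sum_le_sum fun i (_ : i ∈ Finset.univ) =>
      Finset.sum_le_sum fun j (_ : j ∈ Finset.univ.erase i) => hle i j)
      (show 0 ≤ β / 4 by positivity)
    rw [regLogWeight]
    linarith
  · intro k j hkj
    rw [regWeight, Real.rpow_def_of_pos (by positivity), ← Real.exp_add, ← Real.exp_add]
    refine Real.exp_le_exp.2 ?_
    have hg : ∀ i j, 0 ≤ Real.log ((x i - x j) ^ 2 + 1) - Real.log ((x i - x j) ^ 2 + ε) :=
      fun i j => sub_nonneg.2 (hle i j)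
    -- Replacing ε by 1 loses a nonnegative gap in each ordered pair. Keeping the gap of the single
    -- pair (k, j) retains the factor with exponent β/4.
    have h1 : Real.log ((x k - x j) ^ 2 + 1) - Real.log ((x k - x j) ^ 2 + ε) ≤
        ∑ i, ∑ j ∈ Finset.univ.erase i,
          (Real.log ((x i - x j) ^ 2 + 1) - Real.log ((x i - x j) ^ 2 + ε)) :=
      (Finset.single_le_sum (f := fun j => Real.log ((x k - x j) ^ 2 + 1) -
        Real.log ((x k - x j) ^ 2 + ε)) (fun j _ => hg k j)
        (Finset.mem_erase.2 ⟨hkj.symm, Finset.mem_univ _⟩)).trans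
      (Finset.single_le_sum (f := fun i => ∑ j ∈ Finset.univ.erase i,
          (Real.log ((x i - x j) ^ 2 + 1) - Real.log ((x i - x j) ^ 2 + ε)))
        (fun i _ => Finset.sum_nonneg fun j _ => hg i j) (Finset.mem_univ k))
    simp only [Finset.sum_sub_distrib] at h1
    have h2 := mul_le_mul_of_nonneg_left h1 (show 0 ≤ β / 4 by positivity)
    have h3 := mul_nonneg (show 0 ≤ β / 4 by positivity) (hnn k j)
    rw [regLogWeight]
    linarith

/-- The part of `|s|^{β/2-1}` near the origin. -/
def nearKernel (β s : ℝ) : ℝ := (Set.Ioo (-1 : ℝ) 1).indicator (fun s => |s| ^ (β / 2 - 1)) s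

lemma nearKernel_nonneg (β s : ℝ) : 0 ≤ nearKernel β s :=
  Set.indicator_nonneg (fun _ _ => Real.rpow_nonneg (abs_nonneg _) _) _

lemma measurable_nearKernel (β : ℝ) : Measurable (nearKernel β) :=
  (by fun_prop : Measurable fun s : ℝ => |s| ^ (β / 2 - 1)).indicator measurableSet_Ioo

lemma integrable_nearKernel {β : ℝ} (hβ : 0 < β) : Integrable (nearKernel β) := by
  have h : IntegrableOn (fun s : ℝ => |s| ^ (β / 2 - 1)) (Set.Ioo (-1) 1) := by
    have h1 : IntegrableOn (fun s : ℝ => |s| ^ (β / 2 - 1)) (Set.Ioo 0 1) := by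
      have := (intervalIntegral.intervalIntegrable_rpow' (a := 0) (b := 1)
        (r := β / 2 - 1) (by linarith))
      rw [intervalIntegrable_iff_integrableOn_Ioo_of_le zero_le_one] at this
      refine this.congr_fun (fun s hs => ?_) measurableSet_Ioo
      simp only [abs_of_pos hs.1]
    have h2 : IntegrableOn (fun s : ℝ => |s| ^ (β / 2 - 1)) (Set.Ioo (-1) 0) := by
      have := h1.comp_neg
      simp only [abs_neg] at this
      simpa using this
    rw [← Set.Ioc_union_Ioo_eq_Ioo (show (-1 : ℝ) < 0 by norm_num).le zero_lt_one]
    refine IntegrableOn.union ?_ h1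
    exact (integrableOn_Ioc_iff_integrableOn_Ioo (by finiteness)).2 h2
  exact (integrable_indicator_iff measurableSet_Ioo).2 h

/-- With t = x_k - x_j, the retained factor gives (t²+ε)^{β/4}·|t|/(t²+ε) ≤ (t²+ε)^{β/4-1/2}. For
|t| < 1 this is bounded if the exponent is nonnegative, and otherwise is at most |t|^{β/2-1}. That
power is integrable near 0 for β > 0, so the singular drift has an integrable majorant independent
of ε. -/
lemma exists_regWeight_mul_le {β : ℝ} (hβ : 0 ≤ β) (N : ℕ) :
    ∃ C : ℝ, 0 < C ∧ ∀ ε : ℝ, 0 < ε → ε ≤ 1 → ∀ x : Fin N → ℝ,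
      regWeight β ε x ≤ C * Real.exp (-(3 / 8) * ∑ i, x i ^ 2) ∧
      ∀ k j : Fin N, regWeight β ε x * |(x k - x j) / ((x k - x j) ^ 2 + ε)| ≤
        C * Real.exp (-(3 / 8) * ∑ i, x i ^ 2) * (1 + nearKernel β (x k - x j)) := by
  obtain ⟨C, hC, h⟩ := exists_regWeight_le hβ N
  have h21 : 1 ≤ (2 : ℝ) ^ (β / 4) := Real.one_le_rpow (by norm_num) (by positivity)
  refine ⟨C * 2 ^ (β / 4), by positivity, fun ε hε hε1 x => ?_⟩
  obtain ⟨h1, h2⟩ := h ε hε hε1 x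
  set W := C * Real.exp (-(3 / 8) * ∑ i, x i ^ 2)
  have hW : 0 < W := by positivity
  have e : C * 2 ^ (β / 4) * Real.exp (-(3 / 8) * ∑ i, x i ^ 2) = W * 2 ^ (β / 4) := by
    simp only [W]; ring
  rw [e]
  refine ⟨h1.trans (le_mul_of_one_le_right hW.le h21), fun k j => ?_⟩
  have hnk := nearKernel_nonneg β (x k - x j)
  by_cases hkj : x k - x j = 0
  · rw [hkj] at hnk ⊢
    simp only [zero_div, abs_zero, mul_zero]
    positivity
  have hne : k ≠ j := by rintro rfl; simp at hkj
  specialize h2 k j hne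
  set t := x k - x j
  have ht : 0 < |t| := abs_pos.2 hkj
  have htε : 0 < t ^ 2 + ε := by positivity
  have e1 : |t / (t ^ 2 + ε)| = |t| / (t ^ 2 + ε) := by rw [abs_div, abs_of_pos htε]
  rw [e1]
  have ht2 : t ^ 2 = |t| ^ 2 := (sq_abs t).symm
  by_cases h1t : 1 ≤ |t|
  · have h3 : |t| / (t ^ 2 + ε) ≤ 1 := by
      rw [div_le_one htε]; nlinarith
    have h4 : regWeight β ε x * (|t| / (t ^ 2 + ε)) ≤ W * 1 :=
      mul_le_mul h1 h3 (by positivity) hW.le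
    refine h4.trans ?_
    calc W * 1 ≤ W * (2 ^ (β / 4) * (1 + nearKernel β t)) :=
          mul_le_mul_of_nonneg_left (by nlinarith) hW.le
      _ = _ := by ring
  · push Not at h1t
    have hk : nearKernel β t = |t| ^ (β / 2 - 1) := by
      rw [nearKernel, Set.indicator_of_mem (show t ∈ Set.Ioo (-1 : ℝ) 1 from abs_lt.1 h1t)]
    have h3 : (t ^ 2 + ε) ^ (β / 4) * (|t| / (t ^ 2 + ε)) ≤
        2 ^ (β / 4) * (1 + nearKernel β t) := by
      have hs : |t| ≤ (t ^ 2 + ε) ^ (1 / 2 : ℝ) := by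
        rw [← Real.sqrt_eq_rpow]
        exact Real.le_sqrt_of_sq_le (by rw [sq_abs]; linarith)
      have h5 : (t ^ 2 + ε) ^ (β / 4) * (|t| / (t ^ 2 + ε)) ≤ (t ^ 2 + ε) ^ (β / 4 - 1 / 2) := by
        have e3 : (t ^ 2 + ε) ^ (β / 4 - 1 / 2) =
            (t ^ 2 + ε) ^ (β / 4) * ((t ^ 2 + ε) ^ (1 / 2 : ℝ) / (t ^ 2 + ε)) := by
          rw [show β / 4 - 1 / 2 = β / 4 + (1 / 2 - 1) by ring, Real.rpow_add htε,
            Real.rpow_sub_one htε.ne']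
        rw [e3]
        gcongr
      refine h5.trans ?_
      rcases le_total (β / 4 - 1 / 2) 0 with hb | hb
      · have h6 : (t ^ 2 + ε) ^ (β / 4 - 1 / 2) ≤ (|t| ^ 2) ^ (β / 4 - 1 / 2) :=
          Real.rpow_le_rpow_of_nonpos (by positivity) (by linarith) hb
        have e4 : (|t| ^ 2) ^ (β / 4 - 1 / 2) = nearKernel β t := by
          rw [hk, ← Real.rpow_natCast, ← Real.rpow_mul ht.le]
          congr 1; push_cast; ring
        rw [e4] at h6
        nlinarith
      · have h6 : (t ^ 2 + ε) ^ (β / 4 - 1 / 2) ≤ 2 ^ (β / 4 - 1 / 2) := by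
          refine Real.rpow_le_rpow htε.le ?_ hb
          nlinarith
        have h7 : (2 : ℝ) ^ (β / 4 - 1 / 2) ≤ 2 ^ (β / 4) :=
          Real.rpow_le_rpow_of_exponent_le (by norm_num) (by linarith)
        nlinarith
    calc regWeight β ε x * (|t| / (t ^ 2 + ε)) ≤
        W * (t ^ 2 + ε) ^ (β / 4) * (|t| / (t ^ 2 + ε)) := by gcongr
      _ = W * ((t ^ 2 + ε) ^ (β / 4) * (|t| / (t ^ 2 + ε))) := by ring
      _ ≤ W * (2 ^ (β / 4) * (1 + nearKernel β t)) := by gcongr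
      _ = _ := by ring

/-! ### Integrability of the dominating functions -/

section

variable {N : ℕ}

lemma integrable_exp_neg_sum_sq {q : ℝ} (hq : 0 < q) :
    Integrable fun x : Fin N → ℝ => Real.exp (-q * ∑ i, x i ^ 2) := by
  have h := Integrable.fintype_prod (𝕜 := ℝ) (ι := Fin N) (E := ℝ)
    (f := fun _ (t : ℝ) => Real.exp (-q * t ^ 2)) (μ := fun _ => volume)
    fun _ => integrable_exp_neg_mul_sq hq
  refine h.congr (ae_of_all _ fun x => ?_)
  simp only [← Real.exp_sum, Finset.mul_sum]

/-- The shear x_k ↦ x_k - x_j preserves volume. Once the Gaussian factor in x_k is dropped, the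
sheared majorant is a product of one-variable integrable functions. -/
lemma integrable_exp_mul_comp_sub {q : ℝ} (hq : 0 < q) {k j : Fin N} (hkj : k ≠ j) {h : ℝ → ℝ}
    (hm : Measurable h) (hh : Integrable h) :
    Integrable fun x : Fin N → ℝ => Real.exp (-q * ∑ i, x i ^ 2) * h (x k - x j) := by
  have h1 := Integrable.fintype_prod (𝕜 := ℝ) (ι := Fin N) (E := ℝ)
    (f := fun i (t : ℝ) => if i = k then h t else Real.exp (-q * t ^ 2)) (μ := fun _ => volume)
    fun i => by
      by_cases hi : i = k
      · simpa [hi] using hh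
      · simpa [hi] using integrable_exp_neg_mul_sq hq
  have h2 := (Real.volume_preserving_transvectionStruct
    (⟨k, j, hkj, -1⟩ : Matrix.TransvectionStruct (Fin N) ℝ)).integrable_comp_of_integrable h1
  have hT : ∀ (x : Fin N → ℝ) i, (Matrix.toLin'
      (⟨k, j, hkj, -1⟩ : Matrix.TransvectionStruct (Fin N) ℝ).toMatrix) x i =
      if i = k then x k - x j else x i := by
    intro x i
    rw [Matrix.TransvectionStruct.toMatrix, Matrix.transvection, Matrix.toLin'_apply,
      Matrix.add_mulVec, Matrix.one_mulVec, Pi.add_apply, Matrix.single_mulVec]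
    by_cases hi : i = k
    · subst hi
      simp [sub_eq_add_neg]
    · simp [hi]
  refine h2.mono ?_ (ae_of_all _ fun x => ?_)
  · exact (by fun_prop : Measurable _).aestronglyMeasurable
  · simp only [Function.comp_apply, hT, norm_prod]
    rw [norm_mul, Real.norm_of_nonneg (Real.exp_pos _).le, Finset.mul_sum, Real.exp_sum,
      ← Finset.mul_prod_erase _ _ (Finset.mem_univ k),
      ← Finset.mul_prod_erase Finset.univ (fun i => ‖if i = k then h (if i = k then x k - x j else x i)
        else Real.exp (-q * (if i = k then x k - x j else x i) ^ 2)‖) (Finset.mem_univ k)]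
    simp only [if_true]
    rw [mul_comm (‖h (x k - x j)‖)]
    refine mul_le_mul_of_nonneg_right ?_ (norm_nonneg _)
    have e : ∏ i ∈ Finset.univ.erase k, ‖if i = k then h (if i = k then x k - x j else x i)
        else Real.exp (-q * (if i = k then x k - x j else x i) ^ 2)‖ =
        ∏ i ∈ Finset.univ.erase k, Real.exp (-q * x i ^ 2) :=
      Finset.prod_congr rfl fun i hi => by
        rw [if_neg (Finset.ne_of_mem_erase hi), if_neg (Finset.ne_of_mem_erase hi),
          Real.norm_of_nonneg (Real.exp_pos _).le]
    rw [e]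
    refine mul_le_of_le_one_left (Finset.prod_nonneg fun i _ => (Real.exp_pos _).le) ?_
    exact Real.exp_le_one_iff.2 (by nlinarith [sq_nonneg (x k)])

/-- The factor β lets the statement include β = 0, where the kernel |s|⁻¹ itself is not locally
integrable. -/
lemma integrable_exp_mul_nearKernel {q β : ℝ} (hq : 0 < q) (hβ : 0 ≤ β) (k j : Fin N) :
    Integrable fun x : Fin N → ℝ =>
      β * (Real.exp (-q * ∑ i, x i ^ 2) * (1 + nearKernel β (x k - x j))) := by
  rcases hβ.eq_or_lt with rfl | hβ
  · simp
  refine Integrable.const_mul ?_ β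
  simp_rw [mul_add, mul_one]
  refine (integrable_exp_neg_sum_sq hq).add ?_
  by_cases hkj : k = j
  · subst hkj
    simpa using (integrable_exp_neg_sum_sq hq).mul_const _
  · exact integrable_exp_mul_comp_sub hq hkj (measurable_nearKernel β) (integrable_nearKernel hβ)

/-! ### The Boltzmann weight -/

lemma continuous_gibbsWeight {c : ℝ} (hc : 0 ≤ c) : Continuous (gibbsWeight c N) := by
  have h : ∀ i j : Fin N, Continuous fun x : Fin N → ℝ => |x i - x j| ^ (2 * c / (N : ℝ)) :=
    fun _ _ => Continuous.rpow_const (by fun_prop) fun _ => Or.inr (by positivity)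
  exact (continuous_finsetProd _ fun _ _ => continuous_finsetProd _ fun _ _ => h _ _).mul
    (by fun_prop)

lemma gibbsWeight_nonneg (c : ℝ) (x : Fin N → ℝ) : 0 ≤ gibbsWeight c N x :=
  mul_nonneg (Finset.prod_nonneg fun _ _ => Finset.prod_nonneg fun _ _ =>
    Real.rpow_nonneg (abs_nonneg _) _) (Real.exp_pos _).le

lemma gibbsWeight_pos (c : ℝ) {x : Fin N → ℝ} (hx : Function.Injective x) :
    0 < gibbsWeight c N x :=
  mul_pos (Finset.prod_pos fun _ _ => Finset.prod_pos fun _ hj => Real.rpow_pos_of_pos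
    (abs_pos.2 (sub_ne_zero.2 (hx.ne (Finset.mem_Ioi.1 hj).ne))) _) (Real.exp_pos _)

lemma gibbsWeight_eq_zero {c : ℝ} (hc : 0 < c) {x : Fin N → ℝ} {k j : Fin N} (hkj : k ≠ j)
    (hx : x k = x j) : gibbsWeight c N x = 0 := by
  wlog h : k < j generalizing k j
  · exact this hkj.symm hx.symm (lt_of_le_of_ne (not_lt.1 h) hkj.symm)
  have hN : (0 : ℝ) < N := by exact_mod_cast k.pos
  rw [gibbsWeight, Finset.prod_eq_zero (Finset.mem_univ k), zero_mul]
  refine Finset.prod_eq_zero (Finset.mem_Ioi.2 h) ?_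
  rw [hx, sub_self, abs_zero, Real.zero_rpow (by positivity)]

/-- The case t = 0 is included because 1/0 = 0; diagonal terms and collisions need no separate
treatment. -/
lemma tendsto_sub_div_sq_add (t : ℝ) :
    Tendsto (fun ε : ℝ => t / (t ^ 2 + ε)) (𝓝[>] 0) (𝓝 (1 / t)) := by
  rcases eq_or_ne t 0 with rfl | ht
  · simp
  have h : ContinuousAt (fun ε : ℝ => t / (t ^ 2 + ε)) 0 :=
    ContinuousAt.div (by fun_prop) (by fun_prop) (by simpa using ht)
  have e : t / (t ^ 2 + 0) = 1 / t := by field_simp; ring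
  rw [← e]
  exact h.tendsto.mono_left nhdsWithin_le_nhds

lemma exists_gibbsWeight_le {c : ℝ} (hc : 0 ≤ c) (N : ℕ) :
    ∃ C : ℝ, 0 < C ∧ ∀ x : Fin N → ℝ,
      gibbsWeight c N x ≤ C * Real.exp (-(3 / 8) * ∑ i, x i ^ 2) ∧
      ∀ k j : Fin N, gibbsWeight c N x * |1 / (x k - x j)| ≤
        C * Real.exp (-(3 / 8) * ∑ i, x i ^ 2) * (1 + nearKernel (2 * c / N) (x k - x j)) := by
  obtain ⟨C, hC, h⟩ := exists_regWeight_mul_le (β := 2 * c / N) (by positivity) N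
  have hev : ∀ᶠ ε : ℝ in 𝓝[>] 0, 0 < ε ∧ ε ≤ 1 := by
    filter_upwards [Ioc_mem_nhdsGT (zero_lt_one (α := ℝ))] with ε hε using hε
  refine ⟨C, hC, fun x => ⟨?_, fun k j => ?_⟩⟩
  · exact le_of_tendsto (tendsto_regWeight hc x) (hev.mono fun ε hε => (h ε hε.1 hε.2 x).1)
  · exact le_of_tendsto ((tendsto_regWeight hc x).mul (tendsto_sub_div_sq_add _).abs)
      (hev.mono fun ε hε => (h ε hε.1 hε.2 x).2 k j)

section

variable {E : Type*} [NormedAddCommGroup E] [NormedSpace ℝ E]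

/-- Test fields may grow like e^{S/8}: against the weight's decay e^{-3S/8} this leaves e^{-S/4}. -/
lemma exp_mul_le_of_bounds {C A S w v : ℝ} (hw : w ≤ C * Real.exp (-(3 / 8) * S))
    (hv : v ≤ A * Real.exp (1 / 8 * S)) (hv0 : 0 ≤ v) (hC : 0 ≤ C) :
    w * v ≤ C * A * Real.exp (-(1 / 4) * S) := by
  calc w * v ≤ C * Real.exp (-(3 / 8) * S) * (A * Real.exp (1 / 8 * S)) :=
        mul_le_mul hw hv hv0 (by positivity)
    _ = C * A * (Real.exp (-(3 / 8) * S) * Real.exp (1 / 8 * S)) := by ring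
    _ = _ := by rw [← Real.exp_add]; ring_nf

lemma integrable_gibbsWeight_smul {c A : ℝ} (hc : 0 ≤ c) {v : (Fin N → ℝ) → E}
    (hv : AEStronglyMeasurable v)
    (hvA : ∀ x, ‖v x‖ ≤ A * Real.exp (1 / 8 * ∑ i, x i ^ 2)) :
    Integrable fun x => gibbsWeight c N x • v x := by
  obtain ⟨C, hC, h⟩ := exists_gibbsWeight_le hc N
  refine ((integrable_exp_neg_sum_sq (show (0 : ℝ) < 1 / 4 by norm_num)).const_mul (C * A)).mono'
    ((continuous_gibbsWeight hc).aestronglyMeasurable.smul hv) (ae_of_all _ fun x => ?_)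
  rw [norm_smul, Real.norm_of_nonneg (gibbsWeight_nonneg c x)]
  exact exp_mul_le_of_bounds (h x).1 (hvA x) (norm_nonneg _) hC.le

lemma integrable_gibbsWeight_smul_div {c A : ℝ} (hc : 0 ≤ c) {v : (Fin N → ℝ) → E}
    (hv : AEStronglyMeasurable v)
    (hvA : ∀ x, ‖v x‖ ≤ A * Real.exp (1 / 8 * ∑ i, x i ^ 2)) (k j : Fin N) :
    Integrable fun x => (2 * c / N * (1 / (x k - x j))) • gibbsWeight c N x • v x := by
  obtain ⟨C, hC, h⟩ := exists_gibbsWeight_le hc N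
  refine ((integrable_exp_mul_nearKernel (show (0 : ℝ) < 1 / 4 by norm_num)
    (show 0 ≤ 2 * c / (N : ℝ) by positivity) k j).const_mul (C * A)).mono'
    (AEStronglyMeasurable.smul (by fun_prop : Measurable _).aestronglyMeasurable
      ((continuous_gibbsWeight hc).aestronglyMeasurable.smul hv)) (ae_of_all _ fun x => ?_)
  have hβ : 0 ≤ 2 * c / (N : ℝ) := by positivity
  rw [norm_smul, norm_smul, norm_mul, Real.norm_of_nonneg (gibbsWeight_nonneg c x),
    Real.norm_of_nonneg hβ, Real.norm_eq_abs]
  have h1 : gibbsWeight c N x * |1 / (x k - x j)| ≤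
      (C * (1 + nearKernel (2 * c / N) (x k - x j))) * Real.exp (-(3 / 8) * ∑ i, x i ^ 2) :=
    ((h x).2 k j).trans_eq (by ring)
  have hn := nearKernel_nonneg (2 * c / N) (x k - x j)
  have h2 := exp_mul_le_of_bounds h1 (hvA x) (norm_nonneg _) (by positivity)
  calc _ = 2 * c / N * (gibbsWeight c N x * |1 / (x k - x j)| * ‖v x‖) := by ring
    _ ≤ _ := mul_le_mul_of_nonneg_left h2 hβ
    _ = _ := by ring

end

end

/-! ### Integration by parts against the Boltzmann weight -/

section

variable {N : ℕ}

lemma abs_le_exp_sum_sq (x : Fin N → ℝ) (k : Fin N) :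
    |x k| ≤ 4 * Real.exp (1 / 8 * ∑ i, x i ^ 2) := by
  have h1 : x k ^ 2 ≤ ∑ i, x i ^ 2 :=
    Finset.single_le_sum (f := fun i => x i ^ 2) (fun i _ => sq_nonneg _) (Finset.mem_univ k)
  have := Real.add_one_le_exp (1 / 8 * ∑ i, x i ^ 2)
  nlinarith [sq_abs (x k), sq_nonneg (|x k| - 4)]

lemma abs_mul_exp_le (x : Fin N → ℝ) (k : Fin N) :
    |x k| * Real.exp (-(1 / 4) * ∑ i, x i ^ 2) ≤ 4 * Real.exp (-(1 / 8) * ∑ i, x i ^ 2) := by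
  set S := ∑ i, x i ^ 2
  calc _ ≤ 4 * Real.exp (1 / 8 * S) * Real.exp (-(1 / 4) * S) := by
        gcongr; exact abs_le_exp_sum_sq x k
    _ = 4 * (Real.exp (1 / 8 * S) * Real.exp (-(1 / 4) * S)) := by ring
    _ = _ := by rw [← Real.exp_add]; ring_nf

lemma continuous_regWeight (β : ℝ) {ε : ℝ} (hε : 0 < ε) :
    Continuous (regWeight β ε : (Fin N → ℝ) → ℝ) := by
  unfold regWeight regLogWeight
  refine Real.continuous_exp.comp (Continuous.sub (continuous_const.mul ?_) (by fun_prop))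
  refine continuous_finsetSum _ fun i _ => continuous_finsetSum _ fun j _ => ?_
  exact Continuous.log (by fun_prop) fun x => by positivity

lemma regWeight_pos (β ε : ℝ) (x : Fin N → ℝ) : 0 < regWeight β ε x := Real.exp_pos _

variable {E : Type*} [NormedAddCommGroup E] [NormedSpace ℝ E]

/-- For small β the Boltzmann weight fails to be differentiable at collisions. The identity is
proved for the smooth regularised weight and passes to the limit ε ↓ 0 by dominated convergence,
with the majorants of `exists_regWeight_mul_le`. -/
theorem integral_gibbsWeight_smul_add_eq_zero [CompleteSpace E] {c A : ℝ} (hc : 0 ≤ c) (k : Fin N)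
    {v v' : (Fin N → ℝ) → E} (hv : AEStronglyMeasurable v) (hv' : AEStronglyMeasurable v')
    (hd : ∀ x, HasLineDerivAt ℝ v (v' x) x (Pi.single k 1))
    (hvA : ∀ x, ‖v x‖ ≤ A * Real.exp (1 / 8 * ∑ i, x i ^ 2))
    (hvA' : ∀ x, ‖v' x‖ ≤ A * Real.exp (1 / 8 * ∑ i, x i ^ 2)) :
    ∫ x, gibbsWeight c N x • v' x +
      (-x k + 2 * c / N * ∑ j, 1 / (x k - x j)) • gibbsWeight c N x • v x = 0 := by
  set β : ℝ := 2 * c / N with hβdef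
  have hβ : 0 ≤ β := by positivity
  obtain ⟨C, hC, h⟩ := exists_regWeight_mul_le hβ N
  have hA : 0 ≤ A := by
    have := (norm_nonneg _).trans (hvA 0)
    simpa using this
  have hq : (0 : ℝ) < 1 / 4 := by norm_num
  have hq8 : (0 : ℝ) < 1 / 8 := by norm_num
  -- the drift of the regularised weight
  set d : ℝ → (Fin N → ℝ) → ℝ := fun ε x =>
    -x k + β * ∑ j, (x k - x j) / ((x k - x j) ^ 2 + ε) with hd_def
  have hdm : ∀ ε, Measurable (d ε) := fun ε => by
    simp only [d]; fun_prop
  have hrm : ∀ ε > 0, AEStronglyMeasurable (regWeight β ε : (Fin N → ℝ) → ℝ) := fun ε hε =>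
    (continuous_regWeight β hε).aestronglyMeasurable
  set B₁ : (Fin N → ℝ) → ℝ := fun x => C * A * Real.exp (-(1 / 4) * ∑ i, x i ^ 2)
  set B₂ : (Fin N → ℝ) → ℝ := fun x => C * A * (4 * Real.exp (-(1 / 8) * ∑ i, x i ^ 2) +
    ∑ j, β * (Real.exp (-(1 / 4) * ∑ i, x i ^ 2) * (1 + nearKernel β (x k - x j))))
  have hB₁ : Integrable B₁ := (integrable_exp_neg_sum_sq hq).const_mul _
  have hB₂ : Integrable B₂ := (((integrable_exp_neg_sum_sq hq8).const_mul _).add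
    (integrable_finsetSum _ fun j _ => integrable_exp_mul_nearKernel hq hβ k j)).const_mul _
  have hb : ∀ (u : (Fin N → ℝ) → E), (∀ x, ‖u x‖ ≤ A * Real.exp (1 / 8 * ∑ i, x i ^ 2)) →
      ∀ ε > 0, ε ≤ 1 → ∀ x, ‖regWeight β ε x • u x‖ ≤ B₁ x := by
    intro u hu ε hε hε1 x
    rw [norm_smul, Real.norm_of_nonneg (regWeight_pos β ε x).le]
    exact exp_mul_le_of_bounds (h ε hε hε1 x).1 (hu x) (norm_nonneg _) hC.le
  have hb₂ : ∀ ε > 0, ε ≤ 1 → ∀ x, ‖(regWeight β ε x * d ε x) • v x‖ ≤ B₂ x := by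
    intro ε hε hε1 x
    have hr := (regWeight_pos β ε x).le
    have h1 : |d ε x| ≤ |x k| + ∑ j, β * |(x k - x j) / ((x k - x j) ^ 2 + ε)| := by
      refine (abs_add_le _ _).trans ?_
      rw [abs_neg, Finset.mul_sum]
      refine add_le_add_right ((Finset.abs_sum_le_sum_abs _ _).trans_eq ?_) _
      exact Finset.sum_congr rfl fun j _ => by rw [abs_mul, abs_of_nonneg hβ]
    -- The confining drift costs |x_k| ≤ 4e^{S/8} and lowers the Gaussian rate from 1/4 to 1/8.
    have h2 : regWeight β ε x * ‖v x‖ * |x k| ≤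
        C * A * (4 * Real.exp (-(1 / 8) * ∑ i, x i ^ 2)) := by
      have e1 := exp_mul_le_of_bounds (h ε hε hε1 x).1 (hvA x) (norm_nonneg _) hC.le
      calc _ ≤ C * A * Real.exp (-(1 / 4) * ∑ i, x i ^ 2) * |x k| :=
            mul_le_mul_of_nonneg_right e1 (abs_nonneg _)
        _ = C * A * (|x k| * Real.exp (-(1 / 4) * ∑ i, x i ^ 2)) := by ring
        _ ≤ _ := mul_le_mul_of_nonneg_left (abs_mul_exp_le x k) (by positivity)
    have h3 : ∀ j, regWeight β ε x * ‖v x‖ * (β * |(x k - x j) / ((x k - x j) ^ 2 + ε)|) ≤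
        C * A * (β * (Real.exp (-(1 / 4) * ∑ i, x i ^ 2) * (1 + nearKernel β (x k - x j)))) := by
      intro j
      have e1 : regWeight β ε x * |(x k - x j) / ((x k - x j) ^ 2 + ε)| ≤
          (C * (1 + nearKernel β (x k - x j))) * Real.exp (-(3 / 8) * ∑ i, x i ^ 2) :=
        ((h ε hε hε1 x).2 k j).trans_eq (by ring)
      have hn := nearKernel_nonneg β (x k - x j)
      have e2 := exp_mul_le_of_bounds e1 (hvA x) (norm_nonneg _) (by positivity)
      calc _ = β * (regWeight β ε x * |(x k - x j) / ((x k - x j) ^ 2 + ε)| * ‖v x‖) := by ring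
        _ ≤ _ := mul_le_mul_of_nonneg_left e2 hβ
        _ = _ := by ring
    rw [norm_smul, norm_mul, Real.norm_of_nonneg hr, Real.norm_eq_abs]
    calc _ = regWeight β ε x * ‖v x‖ * |d ε x| := by ring
      _ ≤ regWeight β ε x * ‖v x‖ *
          (|x k| + ∑ j, β * |(x k - x j) / ((x k - x j) ^ 2 + ε)|) := by gcongr
      _ = regWeight β ε x * ‖v x‖ * |x k| +
          ∑ j, regWeight β ε x * ‖v x‖ * (β * |(x k - x j) / ((x k - x j) ^ 2 + ε)|) := by
          rw [mul_add, Finset.mul_sum]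
      _ ≤ _ := by
          simp only [B₂]
          refine (add_le_add h2 (Finset.sum_le_sum fun j _ => h3 j)).trans_eq ?_
          rw [← Finset.mul_sum, ← mul_add]
  have hzero : ∀ ε > 0, ε ≤ 1 →
      ∫ x, regWeight β ε x • v' x + (regWeight β ε x * d ε x) • v x = 0 := by
    intro ε hε hε1
    have i1 : Integrable fun x => regWeight β ε x • v' x :=
      hB₁.mono' ((hrm ε hε).smul hv') (ae_of_all _ (hb v' hvA' ε hε hε1))
    have i0 : Integrable fun x => regWeight β ε x • v x :=
      hB₁.mono' ((hrm ε hε).smul hv) (ae_of_all _ (hb v hvA ε hε hε1))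
    have i2 : Integrable fun x => (regWeight β ε x * d ε x) • v x :=
      hB₂.mono' (((hrm ε hε).mul (hdm ε).aestronglyMeasurable).smul hv)
        (ae_of_all _ (hb₂ ε hε hε1))
    have := integral_bilinear_hasLineDerivAt_right_eq_neg_left_of_integrable
      (μ := (volume : Measure (Fin N → ℝ))) (B := ContinuousLinearMap.lsmul ℝ ℝ)
      (f := regWeight β ε) (f' := fun x => regWeight β ε x * d ε x) (g := v) (g' := v')
      (v := Pi.single k 1) i2 i1 i0
      (fun x _ => hasLineDerivAt_regWeight β hε k x) (fun x _ => hd x)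
    simp only [ContinuousLinearMap.lsmul_apply] at this
    rw [integral_add i1 i2, this, neg_add_cancel]
  have hev : ∀ᶠ ε : ℝ in 𝓝[>] 0, 0 < ε ∧ ε ≤ 1 := by
    filter_upwards [Ioc_mem_nhdsGT (zero_lt_one (α := ℝ))] with ε hε using hε
  have hlim : Tendsto (fun ε => ∫ x, regWeight β ε x • v' x + (regWeight β ε x * d ε x) • v x)
      (𝓝[>] 0) (𝓝 (∫ x, gibbsWeight c N x • v' x +
      (-x k + β * ∑ j, 1 / (x k - x j)) • gibbsWeight c N x • v x)) := by
    refine tendsto_integral_filter_of_dominated_convergence (fun x => B₁ x + B₂ x)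
      (hev.mono fun ε hε => ?_) (hev.mono fun ε hε => ae_of_all _ fun x => ?_) (hB₁.add hB₂)
      (ae_of_all _ fun x => ?_)
    · exact ((hrm ε hε.1).smul hv').add
        (((hrm ε hε.1).mul (hdm ε).aestronglyMeasurable).smul hv)
    · exact (norm_add_le _ _).trans (add_le_add (hb v' hvA' ε hε.1 hε.2 x) (hb₂ ε hε.1 hε.2 x))
    · have hw := tendsto_regWeight hc x
      have hdl : Tendsto (fun ε => d ε x) (𝓝[>] 0)
          (𝓝 (-x k + β * ∑ j, 1 / (x k - x j))) :=
        ((tendsto_finsetSum _ fun j _ => tendsto_sub_div_sq_add _).const_mul β).const_add _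
      have := (hw.smul_const (v' x)).add ((hw.mul hdl).smul_const (v x))
      rw [smul_smul, mul_comm _ (gibbsWeight c N x)]
      exact this
  refine tendsto_nhds_unique hlim (tendsto_const_nhds.congr' (hev.mono fun ε hε => ?_))
  exact (hzero ε hε.1 hε.2).symm

end

/-! ### The `β`-ensemble -/

section

variable {N : ℕ} {E : Type*} [NormedAddCommGroup E] [NormedSpace ℝ E]

lemma one_le_exp_sum_sq (x : Fin N → ℝ) : 1 ≤ Real.exp (1 / 8 * ∑ i, x i ^ 2) :=
  Real.one_le_exp (mul_nonneg (by norm_num) (Finset.sum_nonneg fun i _ => sq_nonneg (x i)))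

lemma integrable_gibbsWeight {c : ℝ} (hc : 0 ≤ c) (N : ℕ) : Integrable (gibbsWeight c N) := by
  have := integrable_gibbsWeight_smul (N := N) (A := 1) (v := fun _ => (1 : ℝ)) hc
    aestronglyMeasurable_const fun x => by simpa using one_le_exp_sum_sq x
  simpa using this

lemma partitionFunction_pos {c : ℝ} (hc : 0 ≤ c) (N : ℕ) : 0 < partitionFunction c N := by
  rw [partitionFunction, integral_pos_iff_support_of_nonneg (fun x => gibbsWeight_nonneg c x)
    (integrable_gibbsWeight hc N)]
  refine (continuous_gibbsWeight hc).isOpen_support.measure_pos _ ⟨fun i => (i : ℝ), ?_⟩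
  refine (gibbsWeight_pos c fun i j hij => ?_).ne'
  exact Fin.ext (by exact_mod_cast hij)

lemma isProbabilityMeasure_betaEnsemble {c : ℝ} (hc : 0 ≤ c) (N : ℕ) :
    IsProbabilityMeasure (betaEnsemble c N) := by
  have hZ := partitionFunction_pos hc N
  refine isProbabilityMeasure_iff.2 ?_
  rw [betaEnsemble, withDensity_apply _ MeasurableSet.univ, Measure.restrict_univ,
    ← ofReal_integral_eq_lintegral_ofReal ((integrable_gibbsWeight hc N).div_const _)
      (ae_of_all _ fun x => div_nonneg (gibbsWeight_nonneg c x) hZ.le), integral_div,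
    ← partitionFunction, div_self hZ.ne', ENNReal.ofReal_one]

lemma measurable_ofReal_gibbsWeight_div {c : ℝ} (hc : 0 ≤ c) :
    Measurable fun x : Fin N → ℝ =>
      Real.toNNReal (gibbsWeight c N x / partitionFunction c N) :=
  ((continuous_gibbsWeight hc).measurable.div_const _).real_toNNReal

lemma integrable_betaEnsemble_iff {c : ℝ} (hc : 0 ≤ c) {g : (Fin N → ℝ) → E} :
    Integrable g (betaEnsemble c N) ↔ Integrable fun x => gibbsWeight c N x • g x := by
  have hZ := partitionFunction_pos hc N
  have h := integrable_withDensity_iff_integrable_smul (μ := volume) (E := E) (g := g)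
    (measurable_ofReal_gibbsWeight_div (N := N) hc)
  refine h.trans ?_
  have e : (fun x : Fin N → ℝ => Real.toNNReal (gibbsWeight c N x / partitionFunction c N) • g x) =
      (partitionFunction c N)⁻¹ • fun x => gibbsWeight c N x • g x := by
    ext x
    rw [NNReal.smul_def, Real.coe_toNNReal _ (div_nonneg (gibbsWeight_nonneg c x) hZ.le),
      Pi.smul_apply, smul_smul, div_eq_inv_mul]
  rw [e]
  exact integrable_smul_iff (inv_ne_zero hZ.ne') _

lemma integral_betaEnsemble {c : ℝ} (hc : 0 ≤ c) (g : (Fin N → ℝ) → E) :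
    ∫ x, g x ∂betaEnsemble c N = (partitionFunction c N)⁻¹ • ∫ x, gibbsWeight c N x • g x := by
  have hZ := partitionFunction_pos hc N
  have h := integral_withDensity_eq_integral_smul (μ := volume)
    (measurable_ofReal_gibbsWeight_div (N := N) hc) g
  refine Eq.trans h ?_
  rw [← integral_smul]
  congr 1
  ext x
  rw [NNReal.smul_def, Real.coe_toNNReal _ (div_nonneg (gibbsWeight_nonneg c x) hZ.le),
    smul_smul, div_eq_inv_mul]

/-- For c > 0 the density vanishes at every collision; no argument about null sets of Lebesgue
measure is needed. -/
lemma ae_betaEnsemble_injective {c : ℝ} (hc : 0 < c) :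
    ∀ᵐ x ∂betaEnsemble c N, Function.Injective x := by
  rw [betaEnsemble, ae_withDensity_iff
    ((continuous_gibbsWeight hc.le).measurable.div_const _).ennreal_ofReal]
  refine ae_of_all _ fun x hx i j hij => ?_
  by_contra hne
  rw [gibbsWeight_eq_zero hc hne hij] at hx
  simp at hx

lemma integrable_betaEnsemble {c A : ℝ} (hc : 0 ≤ c) {v : (Fin N → ℝ) → E}
    (hv : AEStronglyMeasurable v)
    (hvA : ∀ x, ‖v x‖ ≤ A * Real.exp (1 / 8 * ∑ i, x i ^ 2)) :
    Integrable v (betaEnsemble c N) :=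
  (integrable_betaEnsemble_iff hc).2 (integrable_gibbsWeight_smul hc hv hvA)

lemma integrable_coord_smul_betaEnsemble {c A : ℝ} (hc : 0 ≤ c) {v : (Fin N → ℝ) → E}
    (hv : AEStronglyMeasurable v)
    (hvA : ∀ x, ‖v x‖ ≤ A * Real.exp (1 / 8 * ∑ i, x i ^ 2)) (k : Fin N) :
    Integrable (fun x => x k • v x) (betaEnsemble c N) := by
  rw [integrable_betaEnsemble_iff hc]
  obtain ⟨C, hC, h⟩ := exists_gibbsWeight_le hc N
  have hA : 0 ≤ A := by
    have := (norm_nonneg _).trans (hvA 0)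
    simpa using this
  refine ((integrable_exp_neg_sum_sq (show (0 : ℝ) < 1 / 8 by norm_num)).const_mul
    (C * A * 4)).mono' ((continuous_gibbsWeight hc).aestronglyMeasurable.smul
    ((continuous_apply k).aestronglyMeasurable.smul hv)) (ae_of_all _ fun x => ?_)
  rw [norm_smul, norm_smul, Real.norm_of_nonneg (gibbsWeight_nonneg c x), Real.norm_eq_abs]
  calc _ = gibbsWeight c N x * ‖v x‖ * |x k| := by ring
    _ ≤ C * A * Real.exp (-(1 / 4) * ∑ i, x i ^ 2) * |x k| :=
        mul_le_mul_of_nonneg_right (exp_mul_le_of_bounds (h x).1 (hvA x) (norm_nonneg _) hC.le)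
          (abs_nonneg _)
    _ = C * A * (|x k| * Real.exp (-(1 / 4) * ∑ i, x i ^ 2)) := by ring
    _ ≤ C * A * (4 * Real.exp (-(1 / 8) * ∑ i, x i ^ 2)) :=
        mul_le_mul_of_nonneg_left (abs_mul_exp_le x k) (by positivity)
    _ = _ := by ring

theorem betaEnsemble_integral_by_parts [CompleteSpace E] {c A : ℝ} (hc : 0 ≤ c) (k : Fin N)
    {v v' : (Fin N → ℝ) → E} (hv : AEStronglyMeasurable v) (hv' : AEStronglyMeasurable v')
    (hd : ∀ x, HasLineDerivAt ℝ v (v' x) x (Pi.single k 1))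
    (hvA : ∀ x, ‖v x‖ ≤ A * Real.exp (1 / 8 * ∑ i, x i ^ 2))
    (hvA' : ∀ x, ‖v' x‖ ≤ A * Real.exp (1 / 8 * ∑ i, x i ^ 2)) :
    Integrable (fun x => v' x + (-x k + 2 * c / N * ∑ j, 1 / (x k - x j)) • v x)
      (betaEnsemble c N) ∧
    ∫ x, (v' x + (-x k + 2 * c / N * ∑ j, 1 / (x k - x j)) • v x) ∂betaEnsemble c N = 0 := by
  constructor
  · have h1 := integrable_betaEnsemble hc hv' hvA'
    have h2 := (integrable_coord_smul_betaEnsemble hc hv hvA k).neg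
    have h3 : Integrable (fun x => ∑ j, (2 * c / N * (1 / (x k - x j))) • v x)
        (betaEnsemble c N) := by
      refine integrable_finsetSum _ fun j _ => (integrable_betaEnsemble_iff hc).2 ?_
      simp_rw [smul_comm (gibbsWeight c N _) (2 * c / (N : ℝ) * _)]
      exact integrable_gibbsWeight_smul_div hc hv hvA k j
    refine (h1.add (h2.add h3)).congr (ae_of_all _ fun x => ?_)
    simp only [Pi.add_apply, Pi.neg_apply]
    rw [add_smul, neg_smul, Finset.mul_sum, Finset.sum_smul]
  · rw [integral_betaEnsemble hc]
    have := integral_gibbsWeight_smul_add_eq_zero hc k hv hv' hd hvA hvA'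
    simp_rw [smul_add, smul_comm (gibbsWeight c N _) (_ + _ : ℝ)]
    rw [this, smul_zero]

/-- The generator is one half of the sum over k of the integration-by-parts expressions with v = ∂_k
f. -/
theorem isStationaryFokkerPlanck_betaEnsemble {c : ℝ} (hc : 0 ≤ c) (N : ℕ) :
    IsStationaryFokkerPlanck c N (betaEnsemble c N) := by
  intro f hf hfc
  have hp : ∀ i, ContDiff ℝ 1 (partialD i f) := fun i =>
    (hf.fderiv_right (m := 1) (by norm_num)).clm_apply contDiff_const
  have hpc : ∀ i, HasCompactSupport (partialD i f) := fun i =>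
    hfc.fderiv_apply (𝕜 := ℝ) (Pi.single i 1)
  have hp2 : ∀ i, Continuous (partialD i (partialD i f)) := fun i =>
    ((hp i).continuous_fderiv (by norm_num)).clm_apply continuous_const
  have hp2c : ∀ i, HasCompactSupport (partialD i (partialD i f)) := fun i =>
    (hpc i).fderiv_apply (𝕜 := ℝ) (Pi.single i 1)
  have key : ∀ i, Integrable (fun x => partialD i (partialD i f) x +
      (-x i + 2 * c / N * ∑ j, 1 / (x i - x j)) • partialD i f x) (betaEnsemble c N) ∧
      ∫ x, (partialD i (partialD i f) x +
        (-x i + 2 * c / N * ∑ j, 1 / (x i - x j)) • partialD i f x) ∂betaEnsemble c N = 0 := by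
    intro i
    obtain ⟨A, hA⟩ := (hpc i).exists_bound_of_continuous (hp i).continuous
    obtain ⟨A', hA'⟩ := (hp2c i).exists_bound_of_continuous (hp2 i)
    refine betaEnsemble_integral_by_parts (A := max (max A A') 0) hc i
      (hp i).continuous.aestronglyMeasurable (hp2 i).aestronglyMeasurable (fun x => ?_)
      (fun x => ?_) (fun x => ?_)
    · exact (((hp i).differentiable (by norm_num)) x).hasFDerivAt.hasLineDerivAt _
    · exact ((hA x).trans ((le_max_left _ _).trans (le_max_left _ _))).trans
        (le_mul_of_one_le_right (le_max_right _ _) (one_le_exp_sum_sq x))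
    · exact ((hA' x).trans ((le_max_right _ _).trans (le_max_left _ _))).trans
        (le_mul_of_one_le_right (le_max_right _ _) (one_le_exp_sum_sq x))
  have e : dysonGenerator c N f = fun x => ∑ i, 1 / 2 * (partialD i (partialD i f) x +
      (-x i + 2 * c / N * ∑ j, 1 / (x i - x j)) • partialD i f x) := by
    ext x
    refine Finset.sum_congr rfl fun i _ => ?_
    -- The diagonal term 1/(x_i - x_i) is 0, so the sum over j ≠ i equals the full sum.
    rw [Finset.sum_erase _ (by simp), smul_eq_mul]
    ring
  rw [e]
  constructor
  · exact integrable_finsetSum _ fun i _ => (key i).1.const_mul _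
  · rw [integral_finsetSum _ fun i _ => (key i).1.const_mul _]
    refine Finset.sum_eq_zero fun i _ => ?_
    rw [integral_const_mul, (key i).2, mul_zero]

/-! ### Symmetrisation of the interaction, and the second moment -/

/-- Exchanging k and j changes the sign of the kernel; averaging both forms produces difference
quotients, which stay bounded for smooth w. -/
lemma sum_sum_div_sub_smul (x : Fin N → ℝ) (w : Fin N → E) :
    ∑ k, ∑ j, (1 / (x k - x j)) • w k =
      (1 / 2 : ℝ) • ∑ k, ∑ j, (1 / (x k - x j)) • (w k - w j) := by
  have h : ∑ k, ∑ j, (1 / (x k - x j)) • w j = -∑ k, ∑ j, (1 / (x k - x j)) • w k := by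
    rw [Finset.sum_comm, ← Finset.sum_neg_distrib]
    refine Finset.sum_congr rfl fun k _ => ?_
    rw [← Finset.sum_neg_distrib]
    refine Finset.sum_congr rfl fun j _ => ?_
    rw [← neg_smul, ← neg_sub (x k) (x j), one_div, one_div, inv_neg]
  simp_rw [smul_sub, Finset.sum_sub_distrib]
  rw [h, sub_neg_eq_add, ← two_smul ℝ, smul_smul]
  norm_num

/-- Integrate by parts with v = x_k and sum over k. After symmetrisation every interaction quotient
is at most 1, so the interaction contributes at most (2c/N)·N²/2 = cN. -/
theorem integral_sum_sq_betaEnsemble_le {c : ℝ} (hc : 0 ≤ c) (N : ℕ) :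
    Integrable (fun x => ∑ i, x i ^ 2) (betaEnsemble c N) ∧
    ∫ x, ∑ i, x i ^ 2 ∂betaEnsemble c N ≤ N * (1 + c) := by
  have := isProbabilityMeasure_betaEnsemble hc N
  have hx : ∀ (x : Fin N → ℝ) (k : Fin N), ‖x k‖ ≤ 4 * Real.exp (1 / 8 * ∑ i, x i ^ 2) :=
    abs_le_exp_sum_sq
  have hI : Integrable (fun x => ∑ i, x i ^ 2) (betaEnsemble c N) := by
    refine integrable_finsetSum _ fun i _ => ?_
    have := integrable_coord_smul_betaEnsemble hc (v := fun x : Fin N → ℝ => x i)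
      (continuous_apply i).aestronglyMeasurable (fun x => hx x i) i
    simpa [sq] using this
  refine ⟨hI, ?_⟩
  have key : ∀ k : Fin N, _ := fun k => betaEnsemble_integral_by_parts (c := c) (A := 4) hc k
    (v := fun x => x k) (v' := fun _ => (1 : ℝ)) (continuous_apply k).aestronglyMeasurable
    aestronglyMeasurable_const
    (fun x => by
      have := ((hasDerivAt_id (0 : ℝ)).const_add (x k))
      simpa [HasLineDerivAt] using! this) (fun x => hx x k)
    (fun x => by
      rw [norm_one]; nlinarith [one_le_exp_sum_sq x])
  have hsum := integral_finsetSum (μ := betaEnsemble c N) Finset.univ fun k _ => (key k).1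
  rw [Finset.sum_eq_zero fun k _ => (key k).2] at hsum
  have hle : ∀ x : Fin N → ℝ, ∑ k, ((1 : ℝ) + (-x k + 2 * c / N * ∑ j, 1 / (x k - x j)) • x k) ≤
      N * (1 + c) - ∑ i, x i ^ 2 := by
    intro x
    have h1 : ∑ k, ∑ j, (1 / (x k - x j)) • x k ≤ 1 / 2 * (N * N) := by
      rw [sum_sum_div_sub_smul, smul_eq_mul]
      refine mul_le_mul_of_nonneg_left ?_ (by norm_num)
      calc _ ≤ ∑ k : Fin N, ∑ j : Fin N, (1 : ℝ) :=
            Finset.sum_le_sum fun k _ => Finset.sum_le_sum fun j _ => by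
              rw [smul_eq_mul, one_div_mul_eq_div]; exact div_self_le_one _
        _ = _ := by simp
    have h2 : ∑ k, ((1 : ℝ) + (-x k + 2 * c / N * ∑ j, 1 / (x k - x j)) • x k) =
        N - ∑ i, x i ^ 2 + 2 * c / N * ∑ k, ∑ j, (1 / (x k - x j)) • x k := by
      have : ∀ k, (1 : ℝ) + (-x k + 2 * c / N * ∑ j, 1 / (x k - x j)) • x k =
          1 - x k ^ 2 + 2 * c / N * ∑ j, (1 / (x k - x j)) • x k := fun k => by
        simp only [smul_eq_mul, ← Finset.sum_mul]; ring
      simp_rw [this, Finset.sum_add_distrib, Finset.sum_sub_distrib, ← Finset.mul_sum]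
      simp
    rw [h2]
    have h3 := mul_le_mul_of_nonneg_left h1 (show 0 ≤ 2 * c / (N : ℝ) by positivity)
    have h4 : 2 * c / (N : ℝ) * (1 / 2 * (N * N)) = c * N := by
      rcases eq_or_ne (N : ℝ) 0 with h | h
      · simp [h]
      · field_simp
    linarith
  have h := integral_mono (integrable_finsetSum Finset.univ fun k _ => (key k).1)
    ((integrable_const _).sub hI) hle
  simp only [Pi.sub_apply] at h
  rw [hsum, integral_sub (integrable_const _) hI] at h
  simp at h
  linarith

end

/-! ### The loop equation -/

section

variable {N : ℕ}

/-- The Stieltjes transform of the empirical measure of `x`. -/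
def empStieltjes (z : ℂ) (x : Fin N → ℝ) : ℂ := 1 / (N : ℂ) * ∑ i, 1 / ((x i : ℂ) - z)

/-- The derivative in `z` of the Stieltjes transform of the empirical measure of `x`. -/
def empStieltjesDeriv (z : ℂ) (x : Fin N → ℝ) : ℂ :=
  1 / (N : ℂ) * ∑ i, (1 / ((x i : ℂ) - z)) ^ 2

/-- The defect of the empirical Stieltjes transform in the Riccati equation. -/
def loopDefect (c : ℝ) (z : ℂ) (x : Fin N → ℝ) : ℂ :=
  c * empStieltjes z x ^ 2 + z * empStieltjes z x + empStieltjesDeriv z x + 1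

/-- The partial derivatives of `loopDefect`. -/
def loopDefectDeriv (c : ℝ) (z : ℂ) (k : Fin N) (x : Fin N → ℝ) : ℂ :=
  -(1 / (N : ℂ) * ((2 * c * empStieltjes z x + z) * (1 / ((x k : ℂ) - z)) ^ 2 +
    2 * (1 / ((x k : ℂ) - z)) ^ 3))

lemma norm_one_div_mul_sum_le {b : ℝ} (hb : 0 ≤ b) {u : Fin N → ℂ} (hu : ∀ i, ‖u i‖ ≤ b) :
    ‖1 / (N : ℂ) * ∑ i, u i‖ ≤ b := by
  have h : ‖∑ i, u i‖ ≤ N * b := by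
    refine (norm_sum_le _ _).trans ((Finset.sum_le_sum fun i _ => hu i).trans_eq ?_)
    simp
  rw [norm_mul, norm_div, norm_one, Complex.norm_natCast]
  rcases Nat.eq_zero_or_pos N with rfl | hN
  · simpa using hb
  · have hN' : (0 : ℝ) < N := by exact_mod_cast hN
    calc 1 / (N : ℝ) * ‖∑ i, u i‖ ≤ 1 / (N : ℝ) * (N * b) := by gcongr
      _ = b := by field_simp

lemma norm_empStieltjes_le {z : ℂ} (hz : z.im ≠ 0) (x : Fin N → ℝ) :
    ‖empStieltjes z x‖ ≤ 1 / |z.im| :=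
  norm_one_div_mul_sum_le (by positivity) fun i => norm_one_div_sub_le hz (x i)

lemma norm_empStieltjesDeriv_le {z : ℂ} (hz : z.im ≠ 0) (x : Fin N → ℝ) :
    ‖empStieltjesDeriv z x‖ ≤ (1 / |z.im|) ^ 2 :=
  norm_one_div_mul_sum_le (by positivity) fun i => by
    rw [norm_pow]
    exact pow_le_pow_left₀ (norm_nonneg _) (norm_one_div_sub_le hz (x i)) 2

lemma norm_loopDefect_le {c : ℝ} (hc : 0 ≤ c) {z : ℂ} (hz : z.im ≠ 0) (x : Fin N → ℝ) :
    ‖loopDefect c z x‖ ≤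
      c * (1 / |z.im|) ^ 2 + ‖z‖ * (1 / |z.im|) + (1 / |z.im|) ^ 2 + 1 := by
  have hG := norm_empStieltjes_le hz x
  have hS := norm_empStieltjesDeriv_le hz x
  refine (norm_add₃_le.trans (add_le_add_left (add_le_add_left (norm_add_le _ _) _) _)).trans ?_
  rw [norm_mul, norm_mul, norm_pow, norm_one, Complex.norm_of_nonneg hc]
  gcongr

lemma norm_loopDefectDeriv_le {c : ℝ} (hc : 0 ≤ c) {z : ℂ} (hz : z.im ≠ 0) (k : Fin N)
    (x : Fin N → ℝ) : ‖loopDefectDeriv c z k x‖ ≤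
      1 / N * ((2 * c * (1 / |z.im|) + ‖z‖) * (1 / |z.im|) ^ 2 + 2 * (1 / |z.im|) ^ 3) := by
  have hG := norm_empStieltjes_le hz x
  have hu := norm_one_div_sub_le hz (x k)
  rw [loopDefectDeriv, norm_neg, norm_mul, norm_div, norm_one, Complex.norm_natCast]
  refine mul_le_mul_of_nonneg_left ((norm_add_le _ _).trans ?_) (by positivity)
  rw [norm_mul, norm_mul, norm_pow, norm_pow, Complex.norm_ofNat]
  have : ‖2 * (c : ℂ) * empStieltjes z x + z‖ ≤ 2 * c * (1 / |z.im|) + ‖z‖ := by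
    refine (norm_add_le _ _).trans ?_
    rw [norm_mul, norm_mul, Complex.norm_of_nonneg hc, Complex.norm_ofNat]
    gcongr
  gcongr

lemma continuous_empStieltjes {z : ℂ} (hz : z.im ≠ 0) :
    Continuous (empStieltjes z : (Fin N → ℝ) → ℂ) :=
  continuous_const.mul (continuous_finsetSum _ fun i _ =>
    (continuous_one_div_sub hz).comp (continuous_apply i))

lemma continuous_loopDefect (c : ℝ) {z : ℂ} (hz : z.im ≠ 0) :
    Continuous (loopDefect c z : (Fin N → ℝ) → ℂ) := by
  have h1 := continuous_empStieltjes (N := N) hz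
  have h2 : Continuous (empStieltjesDeriv z : (Fin N → ℝ) → ℂ) :=
    continuous_const.mul (continuous_finsetSum _ fun i _ =>
      ((continuous_one_div_sub hz).comp (continuous_apply i)).pow 2)
  unfold loopDefect
  fun_prop

lemma continuous_loopDefectDeriv (c : ℝ) {z : ℂ} (hz : z.im ≠ 0) (k : Fin N) :
    Continuous (loopDefectDeriv c z k : (Fin N → ℝ) → ℂ) := by
  have h1 := continuous_empStieltjes (N := N) hz
  have h2 : Continuous fun x : Fin N → ℝ => 1 / ((x k : ℂ) - z) :=
    (continuous_one_div_sub hz).comp (continuous_apply k)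
  unfold loopDefectDeriv
  fun_prop

lemma hasLineDerivAt_one_div_sub {z : ℂ} (hz : z.im ≠ 0) (i k : Fin N) (x : Fin N → ℝ) :
    HasLineDerivAt ℝ (fun x : Fin N → ℝ => 1 / ((x i : ℂ) - z))
      (-((Pi.single k 1 : Fin N → ℝ) i : ℂ) * (1 / ((x i : ℂ) - z)) ^ 2) x (Pi.single k 1) := by
  have h1 : HasDerivAt (fun t : ℝ => (x + t • (Pi.single k 1 : Fin N → ℝ)) i)
      ((Pi.single k 1 : Fin N → ℝ) i) 0 := by
    have := ((hasDerivAt_id (0 : ℝ)).mul_const ((Pi.single k 1 : Fin N → ℝ) i)).const_add (x i)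
    simpa using! this
  have h2 := (h1.ofReal_comp.sub_const z).fun_inv (by simpa using ofReal_sub_ne_zero hz (x i))
  simp only [← one_div] at h2
  refine HasDerivAt.congr_deriv (f' := _) h2 ?_
  simp only [zero_smul, add_zero]
  have := ofReal_sub_ne_zero hz (x i)
  field_simp

lemma hasLineDerivAt_loopDefect (c : ℝ) {z : ℂ} (hz : z.im ≠ 0) (k : Fin N) (x : Fin N → ℝ) :
    HasLineDerivAt ℝ (loopDefect c z) (loopDefectDeriv c z k x) x (Pi.single k 1) := by
  have hu := fun i => hasLineDerivAt_one_div_sub hz i k x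
  have h0 : x + (0 : ℝ) • (Pi.single k 1 : Fin N → ℝ) = x := by simp
  unfold HasLineDerivAt at hu ⊢
  have hG := (HasDerivAt.fun_sum fun i (_ : i ∈ (Finset.univ : Finset (Fin N))) =>
    hu i).const_mul (1 / (N : ℂ))
  have hS := (HasDerivAt.fun_sum fun i (_ : i ∈ (Finset.univ : Finset (Fin N))) =>
    (hu i).pow 2).const_mul (1 / (N : ℂ))
  have := ((((hG.pow 2).const_mul (c : ℂ)).add (hG.const_mul z)).add hS).add_const 1
  refine HasDerivAt.congr_deriv (f' := _) this ?_
  have s1 : ∀ f : Fin N → ℂ, ∑ i, ((Pi.single k 1 : Fin N → ℝ) i : ℂ) * f i = f k := fun f => by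
    rw [Finset.sum_eq_single k (fun i _ hi => by simp [hi]) (by simp)]
    simp
  have s2 : ∑ i, -((Pi.single k 1 : Fin N → ℝ) i : ℂ) * (1 / ((x i : ℂ) - z)) ^ 2 =
      -(1 / ((x k : ℂ) - z)) ^ 2 := by
    simp_rw [neg_mul, Finset.sum_neg_distrib]
    rw [s1]
  have s3 : ∑ i, ((2 : ℕ) : ℂ) * (1 / ((x i : ℂ) - z)) ^ (2 - 1) *
      (-((Pi.single k 1 : Fin N → ℝ) i : ℂ) * (1 / ((x i : ℂ) - z)) ^ 2) =
      -2 * (1 / ((x k : ℂ) - z)) ^ 3 := by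
    rw [← s1 fun i => -2 * (1 / ((x i : ℂ) - z)) ^ 3]
    refine Finset.sum_congr rfl fun i _ => ?_
    push_cast
    ring
  simp only [h0, s2]
  rw [s3, loopDefectDeriv, empStieltjes]
  push_cast
  ring

/-- The drift terms of the loop equation. -/
lemma loop_identity {c : ℝ} {z : ℂ} (hz : z.im ≠ 0) (hN : 0 < N) {x : Fin N → ℝ}
    (hx : c = 0 ∨ Function.Injective x) :
    ∑ k, ((-x k + 2 * c / N * ∑ j, 1 / (x k - x j) : ℝ) : ℂ) * (1 / ((x k : ℂ) - z)) -
      ∑ k, (1 / ((x k : ℂ) - z)) ^ 2 = -N * loopDefect c z x + c * empStieltjesDeriv z x := by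
  have hN' : (N : ℂ) ≠ 0 := by exact_mod_cast hN.ne'
  set u : Fin N → ℂ := fun i => 1 / ((x i : ℂ) - z)
  have hu : ∀ i, (x i : ℂ) * u i = 1 + z * u i := fun i => by
    have := ofReal_sub_ne_zero hz (x i)
    simp only [u]
    field_simp
    ring
  have hsum : ∑ k, u k = N * empStieltjes z x := by
    rw [empStieltjes]; field_simp; rfl
  have hsq : ∑ k, u k ^ 2 = N * empStieltjesDeriv z x := by
    rw [empStieltjesDeriv]; field_simp; simp [u]
  have h1 : ∑ k, (x k : ℂ) * u k = N + z * (N * empStieltjes z x) := by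
    simp_rw [hu, Finset.sum_add_distrib, ← Finset.mul_sum, hsum]
    simp
  have h2 : (c : ℂ) * ∑ k, ∑ j, (1 / (x k - x j)) • u k =
      (c : ℂ) * (-(1 / 2) * ((N * empStieltjes z x) ^ 2 - N * empStieltjesDeriv z x)) := by
    -- For c = 0 collisions are not excluded, but the interaction carries the factor c.
    rcases hx with rfl | hx
    · simp
    congr 1
    rw [sum_sum_div_sub_smul]
    -- Off the diagonal the difference quotient of 1/(x - z) is -u_k u_j. On the diagonal the left
    -- side is 0 by convention, so u_k² is added back; this is the source of the term c·G' of
    -- relative order 1/N.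
    have h3 : ∀ k j, (1 / (x k - x j)) • (u k - u j) = -(u k * u j) + if k = j then u k ^ 2 else 0 := by
      intro k j
      split_ifs with hkj
      · subst hkj; simp [sq]
      · have hne : (x k : ℂ) - x j ≠ 0 := by
          rw [← Complex.ofReal_sub]
          exact_mod_cast sub_ne_zero.2 (hx.ne hkj)
        have hk := ofReal_sub_ne_zero hz (x k)
        have hj := ofReal_sub_ne_zero hz (x j)
        rw [Complex.real_smul]
        push_cast
        simp only [u]
        field_simp
        ring
    simp_rw [h3, Finset.sum_add_distrib, Finset.sum_neg_distrib, ← Finset.mul_sum,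
      ← Finset.sum_mul]
    simp only [Finset.sum_ite_eq, Finset.mem_univ, if_true]
    rw [hsum, hsq, Complex.real_smul]
    push_cast
    ring
  have h4 : ∑ k, ((-x k + 2 * c / N * ∑ j, 1 / (x k - x j) : ℝ) : ℂ) * u k =
      -∑ k, (x k : ℂ) * u k + 2 / N * (c * ∑ k, ∑ j, (1 / (x k - x j)) • u k) := by
    simp_rw [← Finset.sum_smul, Complex.real_smul]
    rw [Finset.mul_sum, Finset.mul_sum, ← Finset.sum_neg_distrib, ← Finset.sum_add_distrib]
    refine Finset.sum_congr rfl fun k _ => ?_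
    push_cast
    ring
  rw [h4, h1, h2, hsq, loopDefect]
  field_simp
  ring

/-- Let R be the defect and u_k = 1/(x_k - z). Integration by parts with v_k = conj(R) u_k, summed
over k, gives N·E|R|² = E T with T bounded independently of N, because each ∂_k R is O(1/N). Putting
conj(R) into the test field yields the second moment of R directly, with no separate concentration
estimate. -/
theorem exists_integral_norm_loopDefect_sq_le {c : ℝ} (hc : 0 ≤ c) {z : ℂ} (hz : z.im ≠ 0) :
    ∃ C : ℝ, ∀ N : ℕ, 0 < N →
      Integrable (fun x => ‖loopDefect c z x‖ ^ 2) (betaEnsemble c N) ∧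
      ∫ x, ‖loopDefect c z x‖ ^ 2 ∂betaEnsemble c N ≤ C / N := by
  set b := 1 / |z.im| with hb_def
  have hb : 0 ≤ b := by positivity
  set M := c * b ^ 2 + ‖z‖ * b + b ^ 2 + 1
  have hM : 0 ≤ M := by positivity
  set D := (2 * c * b + ‖z‖) * b ^ 2 + 2 * b ^ 3
  have hD : 0 ≤ D := by positivity
  refine ⟨D * b + M * (c * b ^ 2), fun N hN => ?_⟩
  have hN' : (0 : ℝ) < N := by exact_mod_cast hN
  have hN1 : (1 : ℝ) ≤ N := by exact_mod_cast hN
  have := isProbabilityMeasure_betaEnsemble hc N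
  have hR := fun x : Fin N → ℝ => norm_loopDefect_le hc hz x
  have hR' := fun (k : Fin N) (x : Fin N → ℝ) => norm_loopDefectDeriv_le hc hz k x
  have hu := fun (k : Fin N) (x : Fin N → ℝ) => norm_one_div_sub_le hz (x k)
  have huc : ∀ k : Fin N, Continuous fun x : Fin N → ℝ => 1 / ((x k : ℂ) - z) := fun k =>
    (continuous_one_div_sub hz).comp (continuous_apply k)
  have hRc := continuous_loopDefect (N := N) c hz
  have hRc' := continuous_loopDefectDeriv (N := N) c hz
  have hI : Integrable (fun x => ‖loopDefect c z x‖ ^ 2) (betaEnsemble c N) :=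
    Integrable.of_bound (hRc.norm.pow 2).aestronglyMeasurable (M ^ 2) (ae_of_all _ fun x => by
      rw [Real.norm_of_nonneg (by positivity)]
      exact pow_le_pow_left₀ (norm_nonneg _) (hR x) 2)
  refine ⟨hI, ?_⟩
  have key : ∀ k : Fin N, _ := fun k => betaEnsemble_integral_by_parts (c := c)
    (A := M * b + D * b + M * b ^ 2) hc k
    (v := fun x => star (loopDefect c z x) * (1 / ((x k : ℂ) - z)))
    (v' := fun x => star (loopDefectDeriv c z k x) * (1 / ((x k : ℂ) - z)) +
      star (loopDefect c z x) * (-(1 / ((x k : ℂ) - z)) ^ 2))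
    (hRc.star.mul (huc k)).aestronglyMeasurable
    (((hRc' k).star.mul (huc k)).add (hRc.star.mul ((huc k).pow 2).neg)).aestronglyMeasurable
    (fun x => by
      have h1 := hasLineDerivAt_loopDefect c hz k x
      have h2 := hasLineDerivAt_one_div_sub hz k k x
      unfold HasLineDerivAt at h1 h2 ⊢
      have h3 := h1.star.mul h2
      simpa using! h3)
    (fun x => by
      rw [norm_mul, norm_star]
      have h1 := mul_le_mul (hR x) (hu k x) (norm_nonneg _) hM
      have h2 := one_le_exp_sum_sq x
      have h3 : M * b ≤ M * b + D * b + M * b ^ 2 := by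
        have : 0 ≤ D * b + M * b ^ 2 := by positivity
        linarith
      exact (h1.trans h3).trans (le_mul_of_one_le_right (by positivity) h2))
    (fun x => by
      have h2 := one_le_exp_sum_sq x
      refine le_trans ?_ (le_mul_of_one_le_right (by positivity) h2)
      refine (norm_add_le _ _).trans ?_
      rw [norm_mul, norm_star, norm_mul, norm_star, norm_neg, norm_pow]
      have h3 : ‖loopDefectDeriv c z k x‖ ≤ D :=
        (hR' k x).trans (mul_le_of_le_one_left hD ((div_le_one hN').2 hN1))
      have h4 := mul_le_mul h3 (hu k x) (norm_nonneg _) hD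
      have h5 := mul_le_mul (hR x) (pow_le_pow_left₀ (norm_nonneg _) (hu k x) 2) (by positivity) hM
      have h6 : 0 ≤ M * b := by positivity
      linarith)
  have hsum := integral_finsetSum (μ := betaEnsemble c N) Finset.univ fun k _ => (key k).1
  rw [Finset.sum_eq_zero fun k _ => (key k).2] at hsum
  have hinj : ∀ᵐ x ∂betaEnsemble c N, c = 0 ∨ Function.Injective x := by
    rcases hc.eq_or_lt with rfl | hc
    · exact ae_of_all _ fun _ => Or.inl rfl
    · exact (ae_betaEnsemble_injective hc).mono fun x hx => Or.inr hx
  -- T collects the derivatives falling on conj(R) and the diagonal correction from `loop_identity`.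
  set T : (Fin N → ℝ) → ℂ := fun x =>
    ∑ k, star (loopDefectDeriv c z k x) * (1 / ((x k : ℂ) - z)) +
      star (loopDefect c z x) * (c * empStieltjesDeriv z x)
  have hT : ∀ x, ‖T x‖ ≤ D * b + M * (c * b ^ 2) := by
    intro x
    refine (norm_add_le _ _).trans (add_le_add ?_ ?_)
    · refine (norm_sum_le _ _).trans ?_
      calc _ ≤ ∑ k : Fin N, 1 / (N : ℝ) * D * b := Finset.sum_le_sum fun k _ => by
            rw [norm_mul, norm_star]
            exact mul_le_mul (hR' k x) (hu k x) (norm_nonneg _) (by positivity)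
        _ = _ := by
            rw [Finset.sum_const, Finset.card_univ, Fintype.card_fin, nsmul_eq_mul]
            field_simp
    · rw [norm_mul, norm_star, norm_mul, Complex.norm_of_nonneg hc]
      exact mul_le_mul (hR x) (mul_le_mul_of_nonneg_left (norm_empStieltjesDeriv_le hz x) hc)
        (by positivity) hM
  have hpt : ∀ᵐ x ∂betaEnsemble c N, ∑ k, (star (loopDefectDeriv c z k x) * (1 / ((x k : ℂ) - z)) +
      star (loopDefect c z x) * (-(1 / ((x k : ℂ) - z)) ^ 2) +
      (-x k + 2 * c / N * ∑ j, 1 / (x k - x j)) •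
        (star (loopDefect c z x) * (1 / ((x k : ℂ) - z)))) =
      T x - N * ((‖loopDefect c z x‖ ^ 2 : ℝ) : ℂ) := by
    filter_upwards [hinj] with x hx
    have h1 := loop_identity hz hN hx
    have h2 : ((‖loopDefect c z x‖ ^ 2 : ℝ) : ℂ) = star (loopDefect c z x) * loopDefect c z x := by
      rw [Complex.star_def, Complex.conj_mul']
      push_cast
      rfl
    have h3 : ∑ k, (star (loopDefectDeriv c z k x) * (1 / ((x k : ℂ) - z)) +
      star (loopDefect c z x) * (-(1 / ((x k : ℂ) - z)) ^ 2) +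
      (-x k + 2 * c / N * ∑ j, 1 / (x k - x j)) •
        (star (loopDefect c z x) * (1 / ((x k : ℂ) - z)))) =
        ∑ k, star (loopDefectDeriv c z k x) * (1 / ((x k : ℂ) - z)) + star (loopDefect c z x) *
        (∑ k, ((-x k + 2 * c / N * ∑ j, 1 / (x k - x j) : ℝ) : ℂ) * (1 / ((x k : ℂ) - z)) -
        ∑ k, (1 / ((x k : ℂ) - z)) ^ 2) := by
      rw [mul_sub, Finset.mul_sum, Finset.mul_sum, ← Finset.sum_sub_distrib,
        ← Finset.sum_add_distrib]
      refine Finset.sum_congr rfl fun k _ => ?_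
      rw [Complex.real_smul]
      ring
    rw [h3, h1, h2]
    ring
  have hTc : Continuous T := by
    have h2 : Continuous (empStieltjesDeriv z : (Fin N → ℝ) → ℂ) :=
      continuous_const.mul (continuous_finsetSum _ fun i _ => (huc i).pow 2)
    exact (continuous_finsetSum _ fun k _ => (hRc' k).star.mul (huc k)).add
      (hRc.star.mul (continuous_const.mul h2))
  have hTi : Integrable T (betaEnsemble c N) :=
    Integrable.of_bound hTc.aestronglyMeasurable _ (ae_of_all _ hT)
  have hRi : Integrable (fun x => (N : ℂ) * ((‖loopDefect c z x‖ ^ 2 : ℝ) : ℂ))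
      (betaEnsemble c N) := hI.ofReal.const_mul _
  rw [integral_congr_ae hpt, integral_sub hTi hRi, integral_const_mul,
    integral_complex_ofReal] at hsum
  have h5 := norm_integral_le_of_norm_le_const (μ := betaEnsemble c N) (ae_of_all _ hT)
  rw [sub_eq_zero.1 hsum, norm_mul, Complex.norm_natCast,
    Complex.norm_of_nonneg (integral_nonneg fun x => by positivity)] at h5
  rw [le_div_iff₀ hN', mul_comm]
  simpa using h5

end

/-! ### Convergence of the empirical measures -/

/-- The defect of the Stieltjes transform of `μ` in the Riccati equation. -/
def riccatiDefect (c : ℝ) (z : ℂ) (μ : Measure ℝ) : ℂ :=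
  c * stieltjesOf μ z ^ 2 + z * stieltjesOf μ z + ∫ l : ℝ, (1 / ((l : ℂ) - z)) ^ 2 ∂μ + 1

/-- Off the real axis the kernel 1/(l - z) and its square are bounded and continuous in l, so weak
convergence passes to the defect. -/
lemma continuous_riccatiDefect (c : ℝ) {z : ℂ} (hz : z.im ≠ 0) :
    Continuous fun μ : ProbabilityMeasure ℝ => riccatiDefect c z μ := by
  have hc : ∀ {f : ℝ → ℂ}, Continuous f → ∀ C : ℝ, (∀ l, ‖f l‖ ≤ C) →
      Continuous fun μ : ProbabilityMeasure ℝ => ∫ l, f l ∂(μ : Measure ℝ) := by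
    intro f hf C hC
    refine continuous_iff_continuousAt.2 fun μ => ?_
    exact (ProbabilityMeasure.tendsto_iff_forall_integral_rclike_tendsto ℂ).1
      (tendsto_id (x := 𝓝 μ)) (BoundedContinuousFunction.ofNormedAddCommGroup f hf C hC)
  have h1 : Continuous fun μ : ProbabilityMeasure ℝ => stieltjesOf μ z :=
    hc (continuous_one_div_sub hz) _ (norm_one_div_sub_le hz)
  have h2 : Continuous fun μ : ProbabilityMeasure ℝ =>
      ∫ l : ℝ, (1 / ((l : ℂ) - z)) ^ 2 ∂(μ : Measure ℝ) :=
    hc ((continuous_one_div_sub hz).pow 2) ((1 / |z.im|) ^ 2) fun l => by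
      rw [norm_pow]
      exact pow_le_pow_left₀ (norm_nonneg _) (norm_one_div_sub_le hz l) 2
  unfold riccatiDefect
  fun_prop

lemma solvesRiccatiUpper_of_riccatiDefect_eq_zero {c : ℝ} {μ : Measure ℝ} [IsFiniteMeasure μ]
    (h : ∀ z : ℂ, 0 < z.im → riccatiDefect c z μ = 0) : SolvesRiccatiUpper c (stieltjesOf μ) := by
  intro z hz
  have hd := hasDerivAt_stieltjesOf μ hz.ne'
  refine ⟨hd.differentiableAt, ?_⟩
  rw [hd.deriv]
  have := h z hz
  rw [riccatiDefect] at this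
  linear_combination this

/-- The probability measures with second moment at most `M`. -/
def momentBall (M : ℝ) : Set (ProbabilityMeasure ℝ) :=
  {μ | ∫⁻ l : ℝ, ENNReal.ofReal (l ^ 2) ∂(μ : Measure ℝ) ≤ ENNReal.ofReal M}

/-- Chebyshev's inequality gives tightness, and Prokhorov's theorem compactness. -/
lemma isCompact_closure_momentBall (M : ℝ) : IsCompact (closure (momentBall M)) := by
  refine isCompact_closure_of_isTightMeasureSet
    (isTightMeasureSet_iff_exists_isCompact_measure_compl_le.2 fun ε hε => ?_)
  have hlim : Tendsto (fun r : ℝ => ENNReal.ofReal (M / r ^ 2)) atTop (𝓝 0) := by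
    rw [← ENNReal.ofReal_zero]
    exact ENNReal.tendsto_ofReal (tendsto_const_nhds.div_atTop (tendsto_pow_atTop two_ne_zero))
  obtain ⟨r, hr, hr0⟩ := ((hlim.eventually_le_const hε).and (eventually_gt_atTop 0)).exists
  refine ⟨Set.Icc (-r) r, isCompact_Icc, ?_⟩
  rintro _ ⟨μ, hμ, rfl⟩
  refine le_trans ?_ hr
  have h1 : (Set.Icc (-r) r)ᶜ ⊆ {l : ℝ | ENNReal.ofReal (r ^ 2) ≤ ENNReal.ofReal (l ^ 2)} := by
    intro l hl
    refine ENNReal.ofReal_le_ofReal (sq_le_sq.2 ?_)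
    rw [abs_of_pos hr0]
    by_contra hlt
    exact hl (abs_le.1 (not_le.1 hlt).le)
  refine (measure_mono h1).trans ?_
  have hr2 : 0 < r ^ 2 := by positivity
  refine (meas_ge_le_lintegral_div (by fun_prop) (by simpa using hr0.ne') (by finiteness)).trans ?_
  rw [ENNReal.ofReal_div_of_pos hr2]
  gcongr
  exact hμ

section

variable {N : ℕ}

/-- The empirical measure of `x`. -/
def empMeasure (x : Fin N → ℝ) : Measure ℝ := (N : ENNReal)⁻¹ • ∑ i, Measure.dirac (x i)

lemma isProbabilityMeasure_empMeasure (hN : 0 < N) (x : Fin N → ℝ) :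
    IsProbabilityMeasure (empMeasure x) := by
  refine isProbabilityMeasure_iff.2 ?_
  rw [empMeasure, Measure.smul_apply, Measure.finsetSum_apply]
  simp only [measure_univ, Finset.sum_const, Finset.card_univ, Fintype.card_fin, nsmul_eq_mul,
    mul_one, smul_eq_mul]
  exact ENNReal.inv_mul_cancel (by exact_mod_cast hN.ne') (by finiteness)

lemma integral_empMeasure {E : Type*} [NormedAddCommGroup E] [NormedSpace ℝ E] [CompleteSpace E]
    (x : Fin N → ℝ) (f : ℝ → E) :
    ∫ l, f l ∂empMeasure x = (1 / (N : ℝ)) • ∑ i, f (x i) := by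
  rw [empMeasure, integral_smul_measure, integral_finsetSum_measure fun i _ =>
    integrable_dirac (by finiteness)]
  simp

lemma lintegral_empMeasure (x : Fin N → ℝ) {f : ℝ → ENNReal} (hf : Measurable f) :
    ∫⁻ l, f l ∂empMeasure x = (N : ENNReal)⁻¹ * ∑ i, f (x i) := by
  rw [empMeasure, lintegral_smul_measure, lintegral_finsetSum_measure]
  simp [lintegral_dirac' _ hf]

lemma riccatiDefect_empMeasure (c : ℝ) (z : ℂ) (x : Fin N → ℝ) :
    riccatiDefect c z (empMeasure x) = loopDefect c z x := by
  rw [riccatiDefect, stieltjesOf, integral_empMeasure, integral_empMeasure, loopDefect,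
    empStieltjes, empStieltjesDeriv, Complex.real_smul, Complex.real_smul]
  push_cast
  rfl

end

/-- The event that the empirical measure lies in `K`. -/
def empEvent (N : ℕ) (K : Set (ProbabilityMeasure ℝ)) : Set (Fin N → ℝ) :=
  {x | ∃ μ ∈ K, (μ : Measure ℝ) = empMeasure x}

lemma tendsto_measure_loopDefect {c : ℝ} (hc : 0 ≤ c) {z : ℂ} (hz : z.im ≠ 0) {δ : ℝ} (hδ : 0 < δ) :
    Tendsto (fun N : ℕ => betaEnsemble c N {x | δ < ‖loopDefect c z x‖}) atTop (𝓝 0) := by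
  obtain ⟨C, hC⟩ := exists_integral_norm_loopDefect_sq_le hc hz
  have hlim : Tendsto (fun N : ℕ => ENNReal.ofReal (C / N / δ ^ 2)) atTop (𝓝 0) := by
    rw [← ENNReal.ofReal_zero]
    refine ENNReal.tendsto_ofReal ?_
    simpa using (tendsto_const_div_atTop_nhds_zero_nat C).div_const (δ ^ 2)
  refine tendsto_of_tendsto_of_tendsto_of_le_of_le' tendsto_const_nhds hlim
    (Eventually.of_forall fun _ => zero_le) ?_
  filter_upwards [eventually_gt_atTop 0] with N hN
  have := isProbabilityMeasure_betaEnsemble hc N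
  obtain ⟨hI, hle⟩ := hC N hN
  have h1 := mul_meas_ge_le_integral_of_nonneg (ae_of_all _ fun x => sq_nonneg _) hI (δ ^ 2)
  refine (measure_mono (t := {x | δ ^ 2 ≤ ‖loopDefect c z x‖ ^ 2}) fun x hx =>
    pow_le_pow_left₀ hδ.le (le_of_lt hx) 2).trans ?_
  rw [← ofReal_measureReal]
  refine ENNReal.ofReal_le_ofReal ?_
  rw [le_div_iff₀ (by positivity), mul_comm]
  exact h1.trans hle

/-- Each measure in the compact set has nonzero defect at some z. Finitely many open conditions
|defect at z| > 1/(n+1) therefore cover it, and each of the corresponding events has probability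
tending to 0. -/
lemma tendsto_measure_empEvent {c : ℝ} (hc : 0 ≤ c) (M : ℝ) {K : Set (ProbabilityMeasure ℝ)}
    (hK : IsClosed K) (hne : ∀ μ ∈ K, ¬ ∀ z : ℂ, 0 < z.im → riccatiDefect c z μ = 0) :
    Tendsto (fun N : ℕ => betaEnsemble c N (empEvent N (momentBall M ∩ K))) atTop (𝓝 0) := by
  have hcomp : IsCompact (closure (momentBall M) ∩ K) :=
    (isCompact_closure_momentBall M).inter_right hK
  let U : {z : ℂ // 0 < z.im} × ℕ → Set (ProbabilityMeasure ℝ) := fun p =>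
    {μ | 1 / ((p.2 : ℝ) + 1) < ‖riccatiDefect c p.1 μ‖}
  have hU : ∀ p, IsOpen (U p) := fun p =>
    isOpen_lt continuous_const (continuous_riccatiDefect c p.1.2.ne').norm
  obtain ⟨t, ht⟩ := hcomp.elim_finite_subcover U hU fun μ hμ => by
    have := hne μ hμ.2
    push Not at this
    obtain ⟨z, hz, hne⟩ := this
    obtain ⟨n, hn⟩ := exists_nat_one_div_lt (norm_pos_iff.2 hne)
    exact Set.mem_iUnion.2 ⟨(⟨z, hz⟩, n), hn⟩
  have hlim : Tendsto (fun N : ℕ => ∑ p ∈ t,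
      betaEnsemble c N {x | 1 / ((p.2 : ℝ) + 1) < ‖loopDefect c p.1 x‖}) atTop (𝓝 0) := by
    have := tendsto_finsetSum t fun p _ => tendsto_measure_loopDefect hc p.1.2.ne'
      (show (0 : ℝ) < 1 / ((p.2 : ℝ) + 1) by positivity)
    simpa only [Finset.sum_const_zero] using this
  refine tendsto_of_tendsto_of_tendsto_of_le_of_le tendsto_const_nhds hlim
    (fun _ => zero_le) fun N => ?_
  refine (measure_mono ?_).trans (measure_biUnion_finset_le t _)
  rintro x ⟨μ, hμ, hx⟩
  have hm := ht ⟨subset_closure hμ.1, hμ.2⟩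
  simp only [Set.mem_iUnion] at hm ⊢
  obtain ⟨p, hp, hpU⟩ := hm
  refine ⟨p, hp, ?_⟩
  simp only [U, Set.mem_ofPred_eq, hx, riccatiDefect_empMeasure] at hpU
  exact hpU

lemma betaEnsemble_sum_sq_gt_le {c : ℝ} (hc : 0 ≤ c) {M : ℝ} (hM : 0 < M) {N : ℕ} (hN : 0 < N) :
    betaEnsemble c N {x : Fin N → ℝ | M * N < ∑ i, x i ^ 2} ≤ ENNReal.ofReal ((1 + c) / M) := by
  have := isProbabilityMeasure_betaEnsemble hc N
  have hN' : (0 : ℝ) < N := by exact_mod_cast hN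
  obtain ⟨hI, hle⟩ := integral_sum_sq_betaEnsemble_le hc N
  have h1 := mul_meas_ge_le_integral_of_nonneg (μ := betaEnsemble c N)
    (f := fun x : Fin N → ℝ => ∑ i, x i ^ 2) (ae_of_all _ fun x =>
      Finset.sum_nonneg fun i _ => sq_nonneg (x i)) hI (M * N)
  refine (measure_mono (t := {x : Fin N → ℝ | M * N ≤ ∑ i, x i ^ 2}) fun x hx => le_of_lt
    (show M * N < ∑ i, x i ^ 2 from hx)).trans ?_
  rw [← ofReal_measureReal]
  refine ENNReal.ofReal_le_ofReal ?_
  rw [le_div_iff₀ hM]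
  have h2 := h1.trans hle
  refine le_of_mul_le_mul_left ?_ hN'
  linarith

lemma mem_momentBall_of_sum_sq_le {N : ℕ} (hN : 0 < N) {M : ℝ} {x : Fin N → ℝ}
    (hx : ∑ i, x i ^ 2 ≤ M * N) {μ : ProbabilityMeasure ℝ} (hμ : (μ : Measure ℝ) = empMeasure x) :
    μ ∈ momentBall M := by
  have hN' : (0 : ℝ) < N := by exact_mod_cast hN
  rw [momentBall, Set.mem_ofPred_eq, hμ, lintegral_empMeasure x (by fun_prop),
    ← ENNReal.ofReal_sum_of_nonneg fun i _ => sq_nonneg (x i), ← ENNReal.ofReal_natCast,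
    ← ENNReal.ofReal_inv_of_pos hN', ← ENNReal.ofReal_mul (by positivity)]
  refine ENNReal.ofReal_le_ofReal ?_
  rw [inv_mul_le_iff₀ hN']
  linarith

lemma measure_empEvent_compl_le {c : ℝ} (hc : 0 ≤ c) {M : ℝ} (hM : 0 < M) {N : ℕ} (hN : 0 < N)
    (K : Set (ProbabilityMeasure ℝ)) :
    betaEnsemble c N (empEvent N K) ≤
      betaEnsemble c N (empEvent N (momentBall M ∩ K)) + ENNReal.ofReal ((1 + c) / M) := by
  refine (measure_mono (t := empEvent N (momentBall M ∩ K) ∪ {x | M * N < ∑ i, x i ^ 2}) ?_).trans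
    ((measure_union_le _ _).trans (add_le_add_right (betaEnsemble_sum_sq_gt_le hc hM hN) _))
  rintro x ⟨μ, hμ, hx⟩
  by_cases h : ∑ i, x i ^ 2 ≤ M * N
  · exact Or.inl ⟨μ, ⟨mem_momentBall_of_sum_sq_le hN h hx, hμ⟩, hx⟩
  · exact Or.inr (not_le.1 h)

/-- The moment restriction is removed by Markov's inequality: its failure has probability at most
(1+c)/M, uniformly in N. -/
lemma tendsto_measure_empEvent_zero {c : ℝ} (hc : 0 ≤ c) {K : Set (ProbabilityMeasure ℝ)}
    (hK : IsClosed K) (hne : ∀ μ ∈ K, ¬ ∀ z : ℂ, 0 < z.im → riccatiDefect c z μ = 0) :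
    Tendsto (fun N : ℕ => betaEnsemble c N (empEvent N K)) atTop (𝓝 0) := by
  refine ENNReal.tendsto_nhds_zero.2 fun ε hε => ?_
  have hlim : Tendsto (fun M : ℝ => ENNReal.ofReal ((1 + c) / M)) atTop (𝓝 0) := by
    rw [← ENNReal.ofReal_zero]
    exact ENNReal.tendsto_ofReal (tendsto_const_nhds.div_atTop tendsto_id)
  have hε2 : 0 < ε / 2 := ENNReal.half_pos hε.ne'
  obtain ⟨M, hM, hM0⟩ := ((hlim.eventually_le_const hε2).and (eventually_gt_atTop 0)).exists
  filter_upwards [(tendsto_measure_empEvent hc M hK hne).eventually_le_const hε2,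
    eventually_gt_atTop 0] with N h1 hN
  calc _ ≤ _ := measure_empEvent_compl_le hc hM0 hN K
    _ ≤ ε / 2 + ε / 2 := add_le_add h1 hM
    _ = ε := ENNReal.add_halves ε

lemma empEvent_univ {N : ℕ} (hN : 0 < N) : empEvent N Set.univ = Set.univ :=
  Set.eq_univ_of_forall fun x =>
    ⟨⟨empMeasure x, isProbabilityMeasure_empMeasure hN x⟩, Set.mem_univ _, rfl⟩

/-- Were there no solution, the closed set of all probability measures would qualify, and an event
of probability one would have probability tending to 0. -/
theorem exists_solvesRiccatiUpper {c : ℝ} (hc : 0 ≤ c) :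
    ∃ μ : ProbabilityMeasure ℝ, SolvesRiccatiUpper c (stieltjesOf (μ : Measure ℝ)) := by
  by_contra hcon
  push Not at hcon
  have h := tendsto_measure_empEvent_zero hc isClosed_univ fun μ _ hμ =>
    hcon μ (solvesRiccatiUpper_of_riccatiDefect_eq_zero hμ)
  refine zero_ne_one (α := ENNReal) (tendsto_nhds_unique h (tendsto_const_nhds.congr' ?_))
  filter_upwards [eventually_gt_atTop 0] with N hN
  have := isProbabilityMeasure_betaEnsemble hc N
  rw [empEvent_univ hN, measure_univ]

/-- The solution found by compactness is identified with the explicit measure, which thereby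
inherits total mass one and the Riccati equation. -/
theorem solvesRiccatiUpper_crossoverMeasure {c : ℝ} (hc : 0 ≤ c) :
    IsProbabilityMeasure (crossoverMeasure c) ∧
      SolvesRiccatiUpper c (stieltjesOf (crossoverMeasure c)) := by
  obtain ⟨μ, hμ⟩ := exists_solvesRiccatiUpper hc
  rw [← eq_crossoverMeasure hc hμ]
  exact ⟨inferInstance, hμ⟩

/-- The measures whose integral of f deviates by at least ε form a weakly closed set, and the only
possible Riccati solution is not among them. -/
theorem tendsto_betaEnsemble_empirical {c : ℝ} (hc : 0 ≤ c) (f : BoundedContinuousFunction ℝ ℝ)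
    {ε : ℝ} (hε : 0 < ε) :
    Tendsto (fun N : ℕ => betaEnsemble c N
      {x | ε ≤ |(1 / (N : ℝ)) * ∑ i : Fin N, f (x i) - ∫ l, f l * crossoverDensity c l|})
      atTop (𝓝 0) := by
  set m := ∫ l, f l * crossoverDensity c l with hm
  have hK : IsClosed {μ : ProbabilityMeasure ℝ | ε ≤ |∫ l, f l ∂(μ : Measure ℝ) - m|} :=
    isClosed_le continuous_const
      ((ProbabilityMeasure.continuous_integral_boundedContinuousFunction f).sub
        continuous_const).abs
  have h := tendsto_measure_empEvent_zero hc hK fun μ hμ h0 => by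
    have h1 := eq_crossoverMeasure hc (solvesRiccatiUpper_of_riccatiDefect_eq_zero h0)
    rw [Set.mem_ofPred_eq, h1, integral_crossoverMeasure hc] at hμ
    simp only [smul_eq_mul, mul_comm (crossoverDensity c _), ← hm] at hμ
    rw [sub_self, abs_zero] at hμ
    exact absurd hμ (not_le.2 hε)
  refine h.congr' ?_
  filter_upwards [eventually_gt_atTop 0] with N hN
  congr 1
  ext x
  constructor
  · rintro ⟨μ, hμ, hx⟩
    rw [Set.mem_ofPred_eq, hx, integral_empMeasure] at hμ
    exact hμ
  · intro hx
    refine ⟨⟨empMeasure x, isProbabilityMeasure_empMeasure hN x⟩, ?_, rfl⟩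
    change ε ≤ |∫ l, f l ∂empMeasure x - m|
    rw [integral_empMeasure]
    exact hx

theorem isLimitingStationaryDensity_crossoverDensity {c : ℝ} (hc : 0 ≤ c) :
    IsLimitingStationaryDensity c (crossoverDensity c) := by
  have hP := (solvesRiccatiUpper_crossoverMeasure hc).1
  have hpos := crossoverDensity_pos hc
  have hI : Integrable (crossoverDensity c) := by
    refine ⟨(continuous_crossoverDensity hc).aestronglyMeasurable, ?_⟩
    rw [hasFiniteIntegral_iff_ofReal (ae_of_all _ fun l => (hpos l).le), ← setLIntegral_univ,
      ← withDensity_apply _ MeasurableSet.univ]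
    exact measure_lt_top (crossoverMeasure c) _
  refine ⟨ae_of_all _ fun l => (hpos l).le, hI, ?_, fun f ε hε =>
    tendsto_betaEnsemble_empirical hc f hε⟩
  have h := integral_crossoverMeasure hc fun _ => (1 : ℝ)
  simpa using h.symm

theorem isLimitingStationaryDensity_iff {c : ℝ} (hc : 0 ≤ c) (ρ : ℝ → ℝ) :
    IsLimitingStationaryDensity c ρ ↔ ρ =ᵐ[volume] crossoverDensity c := by
  have h := isLimitingStationaryDensity_crossoverDensity hc
  constructor
  · intro hρ
    have heq : ∀ f : BoundedContinuousFunction ℝ ℝ,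
        ∫ l, f l * ρ l = ∫ l, f l * crossoverDensity c l := by
      intro f
      by_contra hne
      set a := ∫ l, f l * ρ l
      set b := ∫ l, f l * crossoverDensity c l with hb
      -- If the two limits differed, every configuration would deviate from one of them by at least
      -- half their distance, so the two probabilities would sum to at least 1 for every N.
      have hd : 0 < |a - b| / 2 := half_pos (abs_pos.2 (sub_ne_zero.2 hne))
      have ht := (hρ.2.2.2 f _ hd).add (h.2.2.2 f _ hd)
      rw [add_zero] at ht
      refine not_le.2 (zero_lt_one (α := ENNReal))
        (ge_of_tendsto ht (Eventually.of_forall fun N => ?_))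
      have := isProbabilityMeasure_betaEnsemble hc N
      rw [← measure_univ (μ := betaEnsemble c N)]
      refine (measure_mono fun x _ => ?_).trans (measure_union_le _ _)
      by_contra hx
      simp only [Set.mem_union, Set.mem_ofPred_eq, not_or, not_le] at hx
      obtain ⟨h1, h2⟩ := hx
      have h3 := abs_sub_le a (1 / (N : ℝ) * ∑ i : Fin N, f (x i)) b
      rw [abs_sub_comm a (_ * _)] at h3
      linarith
    -- Smooth compactly supported functions are among the bounded continuous ones and already
    -- determine a locally integrable density almost everywhere.
    have h0 := ae_eq_zero_of_integral_contDiff_smul_eq_zero (μ := volume)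
      (f := fun l => ρ l - crossoverDensity c l) (hρ.2.1.sub h.2.1).locallyIntegrable
      fun g hg hgc => by
        obtain ⟨C, hC⟩ := hgc.exists_bound_of_continuous hg.continuous
        have e := heq (BoundedContinuousFunction.ofNormedAddCommGroup g hg.continuous C hC)
        simp only [BoundedContinuousFunction.coe_ofNormedAddCommGroup] at e
        simp_rw [smul_eq_mul, mul_sub]
        rw [integral_sub (hρ.2.1.bdd_mul hg.continuous.aestronglyMeasurable (ae_of_all _ hC))
          (h.2.1.bdd_mul hg.continuous.aestronglyMeasurable (ae_of_all _ hC)), e, sub_self]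
    filter_upwards [h0] with l hl
    exact sub_eq_zero.1 hl
  · intro hρ
    have e : ∀ f : BoundedContinuousFunction ℝ ℝ,
        ∫ l, f l * ρ l = ∫ l, f l * crossoverDensity c l := fun f =>
      integral_congr_ae (hρ.mono fun l hl => by simp only [hl])
    refine ⟨?_, h.2.1.congr hρ.symm, (integral_congr_ae hρ).trans h.2.2.1, fun f ε hε => ?_⟩
    · filter_upwards [hρ] with l hl
      rw [hl]
      exact (crossoverDensity_pos hc l).le
    · rw [e f]
      exact h.2.2.2 f ε hε

/-! ### A product formula for the parabolic cylinder function -/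

lemma integrableOn_rpow_mul_inv_sq {κ : ℝ} (hκ : 0 < κ) :
    IntegrableOn (fun τ : ℝ => τ ^ (-(1 / 2) : ℝ) * ((1 + κ * τ) ^ 2)⁻¹) (Set.Ioi 0) := by
  have hm : Measurable fun τ : ℝ => τ ^ (-(1 / 2) : ℝ) * ((1 + κ * τ) ^ 2)⁻¹ := by fun_prop
  rw [← Set.Ioc_union_Ioi_eq_Ioi zero_le_one]
  refine IntegrableOn.union ?_ ?_
  · have h := intervalIntegral.intervalIntegrable_rpow' (a := 0) (b := 1)
      (r := (-(1 / 2) : ℝ)) (by norm_num)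
    rw [intervalIntegrable_iff_integrableOn_Ioc_of_le zero_le_one] at h
    refine Integrable.mono' h hm.aestronglyMeasurable ?_
    filter_upwards [ae_restrict_mem measurableSet_Ioc] with τ hτ
    have h0 : 0 < τ := hτ.1
    rw [Real.norm_of_nonneg (by positivity)]
    refine mul_le_of_le_one_right (by positivity) (inv_le_one_of_one_le₀ ?_)
    exact one_le_pow₀ (by nlinarith)
  · have h := (integrableOn_Ioi_rpow_of_lt (a := (-2 : ℝ)) (by norm_num) one_pos).const_mul
      ((κ ^ 2)⁻¹)
    refine Integrable.mono' h hm.aestronglyMeasurable ?_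
    filter_upwards [ae_restrict_mem measurableSet_Ioi] with τ hτ
    have h1 : 1 < τ := hτ
    have h0 : 0 < τ := by linarith
    rw [Real.norm_of_nonneg (by positivity)]
    have e : τ ^ (-2 : ℝ) = (τ ^ 2)⁻¹ := by
      rw [Real.rpow_neg h0.le]
      norm_cast
    rw [e, ← mul_inv, ← mul_pow]
    have h2 : τ ^ (-(1 / 2) : ℝ) ≤ 1 := Real.rpow_le_one_of_one_le_of_nonpos h1.le (by norm_num)
    have h3 : ((1 + κ * τ) ^ 2)⁻¹ ≤ ((κ * τ) ^ 2)⁻¹ := by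
      gcongr
      linarith
    calc _ ≤ 1 * ((κ * τ) ^ 2)⁻¹ := mul_le_mul h2 h3 (by positivity) one_pos.le
      _ = _ := one_mul _

lemma one_add_rpow_neg_le {c τ : ℝ} (hc : 2 ≤ c) (hτ : 0 ≤ τ) :
    (1 + τ) ^ (-c) ≤ ((1 + 1 * τ) ^ 2)⁻¹ := by
  rw [one_mul, ← Real.rpow_natCast, ← Real.rpow_neg (by linarith)]
  exact Real.rpow_le_rpow_of_exponent_le (by linarith) (by push_cast; linarith)

lemma integrableOn_rpow_mul_one_add_rpow {c : ℝ} (hc : 2 ≤ c) :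
    IntegrableOn (fun τ : ℝ => τ ^ (-(1 / 2) : ℝ) * (1 + τ) ^ (-c)) (Set.Ioi 0) := by
  refine Integrable.mono' (integrableOn_rpow_mul_inv_sq one_pos)
    (by fun_prop : Measurable _).aestronglyMeasurable ?_
  filter_upwards [ae_restrict_mem measurableSet_Ioi] with τ hτ
  have h0 : 0 < τ := hτ
  rw [Real.norm_of_nonneg (by positivity)]
  exact mul_le_mul_of_nonneg_left (one_add_rpow_neg_le hc h0.le) (by positivity)

/-- The substitution w = t(t - s) maps (max 0 s, ∞) bijectively onto (0, ∞); its inverse is the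
larger root of the quadratic in t. -/
lemma integral_Ioi_comp_mul_sub (g : ℝ → ℝ) (s : ℝ) :
    ∫ t in Set.Ioi (max 0 s), g (t * (t - s)) =
      ∫ w in Set.Ioi (0 : ℝ), (1 / Real.sqrt (s ^ 2 + 4 * w)) * g w := by
  set T : ℝ → ℝ := fun w => (s + Real.sqrt (s ^ 2 + 4 * w)) / 2 with hT
  have hpos : ∀ w ∈ Set.Ioi (0 : ℝ), 0 < s ^ 2 + 4 * w := fun w hw => by
    have : 0 < w := hw
    positivity
  have hmul : ∀ w ∈ Set.Ioi (0 : ℝ), T w * (T w - s) = w := fun w hw => by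
    have := Real.sq_sqrt (hpos w hw).le
    simp only [T]
    nlinarith
  have hderiv : ∀ w ∈ Set.Ioi (0 : ℝ),
      HasDerivWithinAt T (1 / Real.sqrt (s ^ 2 + 4 * w)) (Set.Ioi 0) w := fun w hw => by
    have h1 : HasDerivAt (fun w : ℝ => s ^ 2 + 4 * w) 4 w := by
      simpa using ((hasDerivAt_id w).const_mul 4).const_add (s ^ 2)
    have h2 := (((h1.sqrt (hpos w hw).ne').const_add s).div_const 2)
    refine (h2.congr_deriv ?_).hasDerivWithinAt
    have := (Real.sqrt_pos.2 (hpos w hw)).ne'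
    field_simp
    norm_num
  have hinj : Set.InjOn T (Set.Ioi 0) := fun a ha b hb hab => by
    rw [← hmul a ha, ← hmul b hb, hab]
  have himage : T '' Set.Ioi 0 = Set.Ioi (max 0 s) := by
    ext t
    constructor
    · rintro ⟨w, hw, rfl⟩
      have hw0 : 0 < w := hw
      have : |s| < Real.sqrt (s ^ 2 + 4 * w) := by
        rw [← Real.sqrt_sq_eq_abs]
        exact Real.sqrt_lt_sqrt (sq_nonneg s) (by linarith)
      obtain ⟨h1, h2⟩ := abs_lt.1 this
      have a1 : 0 < T w := by simp only [T]; linarith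
      have a2 : s < T w := by simp only [T]; linarith
      exact max_lt a1 a2
    · intro ht
      obtain ⟨h0, hs⟩ := max_lt_iff.1 (Set.mem_Ioi.1 ht)
      refine ⟨t * (t - s), mul_pos h0 (sub_pos.2 hs), ?_⟩
      have e : s ^ 2 + 4 * (t * (t - s)) = (2 * t - s) ^ 2 := by ring
      simp only [T]
      rw [e, Real.sqrt_sq (by linarith)]
      ring
  rw [← himage, integral_image_eq_integral_abs_deriv_smul measurableSet_Ioi hderiv hinj]
  refine setIntegral_congr_fun measurableSet_Ioi fun w hw => ?_
  have h1 := Real.sqrt_pos.2 (hpos w hw)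
  simp only [smul_eq_mul]
  rw [hmul w hw, abs_of_pos (by positivity)]

/-- Write (s² + 4w)^{-1/2} as a Gamma integral of order 1/2 in a new variable τ. By Tonelli the
w-integral comes first and equals Γ(c)(1+τ)^{-c}. The assumption c ≥ 2 gives the simple majorant
(1+τ)^{-2}. -/
lemma integral_div_sqrt_eq {c : ℝ} (hc : 2 ≤ c) (s : ℝ) :
    ∫ w in Set.Ioi (0 : ℝ), (1 / Real.sqrt (s ^ 2 + 4 * w)) * (w ^ (c - 1) * Real.exp (-w)) =
      Real.Gamma c / (2 * Real.sqrt Real.pi) * ∫ τ in Set.Ioi (0 : ℝ),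
        τ ^ (-(1 / 2) : ℝ) * (1 + τ) ^ (-c) * Real.exp (-(s ^ 2 / 4 * τ)) := by
  have hpi : 0 < Real.sqrt Real.pi := Real.sqrt_pos.2 Real.pi_pos
  set F : ℝ → ℝ → ℝ := fun w τ => w ^ (c - 1) * Real.exp (-w) *
    (τ ^ (-(1 / 2) : ℝ) * Real.exp (-((s ^ 2 / 4 + w) * τ))) with hF
  have hτint : ∀ w ∈ Set.Ioi (0 : ℝ), (1 / Real.sqrt (s ^ 2 + 4 * w)) *
      (w ^ (c - 1) * Real.exp (-w)) =
      1 / (2 * Real.sqrt Real.pi) * ∫ τ in Set.Ioi (0 : ℝ), F w τ := fun w hw => by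
    have hw0 : 0 < w := hw
    have hr : 0 < s ^ 2 / 4 + w := by positivity
    have h1 := Real.integral_rpow_mul_exp_neg_mul_Ioi (a := 1 / 2) (by norm_num) hr
    rw [show (1 / 2 - 1 : ℝ) = -(1 / 2) by norm_num, Real.Gamma_one_half_eq,
      ← Real.sqrt_eq_rpow] at h1
    simp only [F]
    rw [integral_const_mul, h1, show s ^ 2 + 4 * w = 2 ^ 2 * (s ^ 2 / 4 + w) by ring,
      Real.sqrt_mul (by norm_num), Real.sqrt_sq (by norm_num), Real.sqrt_div zero_le_one,
      Real.sqrt_one]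
    have := (Real.sqrt_pos.2 hr).ne'
    field_simp
  have hwint : ∀ τ ∈ Set.Ioi (0 : ℝ), ∫ w in Set.Ioi (0 : ℝ), F w τ = Real.Gamma c *
      (τ ^ (-(1 / 2) : ℝ) * (1 + τ) ^ (-c) * Real.exp (-(s ^ 2 / 4 * τ))) := fun τ hτ => by
    have hτ0 : 0 < τ := hτ
    have h1 := Real.integral_rpow_mul_exp_neg_mul_Ioi (a := c) (r := 1 + τ) (by linarith)
      (by linarith)
    have h2 : ∀ w, F w τ = τ ^ (-(1 / 2) : ℝ) * Real.exp (-(s ^ 2 / 4 * τ)) *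
        (w ^ (c - 1) * Real.exp (-((1 + τ) * w))) := fun w => by
      have : Real.exp (-w) * Real.exp (-((s ^ 2 / 4 + w) * τ)) =
          Real.exp (-(s ^ 2 / 4 * τ)) * Real.exp (-((1 + τ) * w)) := by
        rw [← Real.exp_add, ← Real.exp_add]; ring_nf
      simp only [F]
      linear_combination (w ^ (c - 1) * τ ^ (-(1 / 2) : ℝ)) * this
    simp_rw [h2]
    rw [one_div, Real.inv_rpow (by linarith), ← Real.rpow_neg (by linarith)] at h1
    rw [integral_const_mul, h1]
    ring
  have hnn : ∀ w ∈ Set.Ioi (0 : ℝ), ∀ τ ∈ Set.Ioi (0 : ℝ), 0 ≤ F w τ := fun w hw τ hτ => by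
    have hτ0 : 0 < τ := hτ
    have hw0 : 0 < w := hw
    simp only [F]
    positivity
  have hK : IntegrableOn (fun τ : ℝ => τ ^ (-(1 / 2) : ℝ) * (1 + τ) ^ (-c) *
      Real.exp (-(s ^ 2 / 4 * τ))) (Set.Ioi 0) := by
    refine Integrable.mono' (integrableOn_rpow_mul_one_add_rpow hc)
      (by fun_prop : Measurable _).aestronglyMeasurable ?_
    filter_upwards [ae_restrict_mem measurableSet_Ioi] with τ hτ
    have h0 : 0 < τ := hτ
    rw [Real.norm_of_nonneg (by positivity)]
    exact mul_le_of_le_one_right (by positivity) (Real.exp_le_one_iff.2 (by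
      have : 0 ≤ s ^ 2 / 4 * τ := by positivity
      linarith))
  have hFi : Integrable (Function.uncurry F)
      ((volume.restrict (Set.Ioi 0)).prod (volume.restrict (Set.Ioi 0))) := by
    have hm : Measurable (Function.uncurry F) := by
      simp only [F, Function.uncurry_def]
      fun_prop
    rw [integrable_prod_iff' hm.aestronglyMeasurable]
    constructor
    · filter_upwards [ae_restrict_mem measurableSet_Ioi] with τ hτ
      have hτ0 : 0 < τ := hτ
      refine Integrable.mono' ((integrableOn_rpow_mul_exp_neg_mul one_pos
        (show 0 < c by linarith)).mul_const (τ ^ (-(1 / 2) : ℝ)))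
        (hm.comp measurable_prodMk_right).aestronglyMeasurable ?_
      filter_upwards [ae_restrict_mem measurableSet_Ioi] with w hw
      have hw0 : 0 < w := hw
      simp only [Function.uncurry_apply_pair]
      rw [Real.norm_of_nonneg (hnn w hw τ hτ)]
      simp only [F]
      rw [neg_one_mul]
      gcongr
      refine mul_le_of_le_one_right (by positivity) (Real.exp_le_one_iff.2 ?_)
      have : 0 ≤ (s ^ 2 / 4 + w) * τ := by positivity
      linarith
    · refine (hK.const_mul (Real.Gamma c)).congr ?_
      filter_upwards [ae_restrict_mem measurableSet_Ioi] with τ hτ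
      rw [← hwint τ hτ]
      refine setIntegral_congr_fun measurableSet_Ioi fun w hw => ?_
      exact (Real.norm_of_nonneg (hnn w hw τ hτ)).symm
  rw [setIntegral_congr_fun measurableSet_Ioi hτint, integral_const_mul,
    integral_integral_swap hFi, setIntegral_congr_fun measurableSet_Ioi hwint, integral_const_mul]
  ring

/-- |M_c|² is the integral of the convolution of the integrand with its reflected conjugate. Since
t²/2 + (t-s)²/2 = s²/2 + t(t-s), the inner integral depends on t only through t(t-s). -/
lemma norm_gaussMellin_sq_eq_convolution {c : ℝ} (hc : 0 < c) (l : ℝ) :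
    ((‖gaussMellin (-Complex.I * l) 1 c‖ ^ 2 : ℝ) : ℂ) =
      ∫ s : ℝ, Complex.exp (Complex.I * l * s - (s : ℂ) ^ 2 / 2) *
        ((∫ w in Set.Ioi (0 : ℝ), (1 / Real.sqrt (s ^ 2 + 4 * w)) *
          (w ^ (c - 1) * Real.exp (-w)) : ℝ) : ℂ) := by
  set f : ℝ → ℂ := fun x => Complex.exp (-(-Complex.I * l) * (x : ℂ) - 1 * (x : ℂ) ^ 2 / 2) *
    ((x ^ (c - 1) : ℝ) : ℂ) with hf
  set φ : ℝ → ℂ := (Set.Ioi 0).indicator f with hφ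
  have hφi : Integrable φ := (integrable_indicator_iff measurableSet_Ioi).2
    (integrableOn_gaussMellin (kernelDecay_one _) one_pos hc)
  have hφint : ∫ x, φ x = gaussMellin (-Complex.I * l) 1 c := by
    rw [hφ, integral_indicator measurableSet_Ioi]; rfl
  set ψ : ℝ → ℂ := fun u => starRingEnd ℂ (φ (-u)) with hψ
  have hψi : Integrable ψ := (Complex.conjCLE : ℂ →L[ℝ] ℂ).integrable_comp hφi.comp_neg
  have hψint : ∫ x, ψ x = starRingEnd ℂ (gaussMellin (-Complex.I * l) 1 c) := by
    rw [hψ, integral_conj, integral_neg_eq_self φ, hφint]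
  have hconv := integral_convolution (μ := volume) (ν := volume)
    (ContinuousLinearMap.mul ℂ ℂ) hφi hψi
  rw [hφint, hψint, ContinuousLinearMap.mul_apply', Complex.mul_conj'] at hconv
  push_cast
  rw [← hconv]
  congr 1
  ext s
  rw [convolution_def]
  have hpt : ∀ t, (ContinuousLinearMap.mul ℂ ℂ) (φ t) (ψ (s - t)) =
      Complex.exp (Complex.I * l * s - (s : ℂ) ^ 2 / 2) *
        (((Set.Ioi (max 0 s)).indicator (fun t => (t * (t - s)) ^ (c - 1) *
          Real.exp (-(t * (t - s)))) t : ℝ) : ℂ) := by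
    intro t
    rw [ContinuousLinearMap.mul_apply']
    simp only [ψ, φ, neg_sub]
    by_cases ht : t ∈ Set.Ioi (max 0 s)
    · obtain ⟨h0, hs⟩ := max_lt_iff.1 (Set.mem_Ioi.1 ht)
      have hts : 0 < t - s := sub_pos.2 hs
      rw [Set.indicator_of_mem ht, Set.indicator_of_mem (Set.mem_Ioi.2 h0),
        Set.indicator_of_mem (Set.mem_Ioi.2 hts)]
      simp only [f]
      rw [map_mul, Complex.conj_ofReal, ← Complex.exp_conj, Real.mul_rpow h0.le hts.le]
      simp only [map_sub, map_mul, map_neg, Complex.conj_I, Complex.conj_ofReal, map_div₀, map_pow,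
        map_one, map_ofNat]
      push_cast
      have e : Complex.exp (-(-Complex.I * l) * (t : ℂ) - 1 * (t : ℂ) ^ 2 / 2) *
          Complex.exp (-(- -Complex.I * l) * ((t : ℂ) - s) - 1 * ((t : ℂ) - s) ^ 2 / 2) =
          Complex.exp (Complex.I * l * s - (s : ℂ) ^ 2 / 2) *
          Complex.exp (-((t : ℂ) * (t - s))) := by
        rw [← Complex.exp_add, ← Complex.exp_add]
        congr 1
        ring
      linear_combination ((t ^ (c - 1) : ℝ) : ℂ) * (((t - s) ^ (c - 1) : ℝ) : ℂ) * e
    · rw [Set.indicator_of_notMem ht, Complex.ofReal_zero, mul_zero]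
      by_cases h0 : 0 < t
      · have hs : t - s ∉ Set.Ioi (0 : ℝ) := fun h =>
          ht (max_lt h0 (sub_pos.1 (Set.mem_Ioi.1 h)))
        rw [Set.indicator_of_notMem hs, map_zero, mul_zero]
      · rw [Set.indicator_of_notMem (s := Set.Ioi (0 : ℝ)) (a := t) h0, zero_mul]
  simp_rw [hpt]
  rw [integral_const_mul, integral_complex_ofReal, integral_indicator measurableSet_Ioi,
    integral_Ioi_comp_mul_sub (fun w => w ^ (c - 1) * Real.exp (-w))]

/-- Product formula for `|D_{-c}(i l)|²`. -/
theorem norm_gaussMellin_sq {c : ℝ} (hc : 2 ≤ c) (l : ℝ) :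
    ‖gaussMellin (-Complex.I * l) 1 c‖ ^ 2 = Real.Gamma c * ∫ τ in Set.Ioi (0 : ℝ),
      (1 + τ) ^ (-c) * (τ * (τ + 2)) ^ (-(1 / 2) : ℝ) * Real.exp (-l ^ 2 / (τ + 2)) := by
  have hpi : 0 < Real.sqrt Real.pi := Real.sqrt_pos.2 Real.pi_pos
  set F : ℝ → ℝ → ℂ := fun s τ => Complex.exp (Complex.I * l * s - (s : ℂ) ^ 2 / 2) *
    ((τ ^ (-(1 / 2) : ℝ) * (1 + τ) ^ (-c) * Real.exp (-(s ^ 2 / 4 * τ)) : ℝ) : ℂ) with hF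
  have h1 := norm_gaussMellin_sq_eq_convolution (show 0 < c by linarith) l
  simp_rw [integral_div_sqrt_eq hc] at h1
  have h2 : ∀ s : ℝ, Complex.exp (Complex.I * l * s - (s : ℂ) ^ 2 / 2) *
      ((Real.Gamma c / (2 * Real.sqrt Real.pi) * ∫ τ in Set.Ioi (0 : ℝ),
        τ ^ (-(1 / 2) : ℝ) * (1 + τ) ^ (-c) * Real.exp (-(s ^ 2 / 4 * τ)) : ℝ) : ℂ) =
      ((Real.Gamma c / (2 * Real.sqrt Real.pi) : ℝ) : ℂ) * ∫ τ in Set.Ioi (0 : ℝ), F s τ := by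
    intro s
    simp only [F]
    rw [integral_const_mul, integral_complex_ofReal]
    push_cast
    ring
  simp_rw [h2] at h1
  have hFi : Integrable (Function.uncurry F) (volume.prod (volume.restrict (Set.Ioi 0))) := by
    have hb := (integrable_exp_neg_mul_sq (show (0 : ℝ) < 1 / 2 by norm_num)).mul_prod
      (integrableOn_rpow_mul_one_add_rpow hc)
    have hm : Measurable (Function.uncurry F) := by
      simp only [F, Function.uncurry_def]
      fun_prop
    refine hb.mono' hm.aestronglyMeasurable ?_
    have hτ : ∀ᵐ p : ℝ × ℝ ∂volume.prod (volume.restrict (Set.Ioi 0)), 0 < p.2 :=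
      Measure.quasiMeasurePreserving_snd.ae (ae_restrict_mem measurableSet_Ioi)
    filter_upwards [hτ] with p hp
    obtain ⟨s, τ⟩ := p
    have hp : 0 < τ := hp
    simp only [Function.uncurry_apply_pair, F]
    rw [norm_mul, Complex.norm_exp, Complex.norm_of_nonneg (by positivity)]
    have e : (Complex.I * l * s - (s : ℂ) ^ 2 / 2).re = -(1 / 2) * s ^ 2 := by
      have : Complex.I * l * s - (s : ℂ) ^ 2 / 2 =
          ((-(1 / 2) * s ^ 2 : ℝ) : ℂ) + ((l * s : ℝ) : ℂ) * Complex.I := by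
        push_cast
        ring
      rw [this, Complex.add_re, Complex.ofReal_re, Complex.re_ofReal_mul, Complex.I_re, mul_zero,
        add_zero]
    rw [e]
    refine mul_le_mul_of_nonneg_left ?_ (Real.exp_pos _).le
    refine mul_le_of_le_one_right (by positivity) (Real.exp_le_one_iff.2 ?_)
    have : 0 ≤ s ^ 2 / 4 * τ := by positivity
    linarith
  rw [integral_const_mul, integral_integral_swap hFi] at h1
  -- For fixed τ the s-integral is the Fourier transform of a Gaussian with coefficient 1/2 + τ/4 =
  -- (τ+2)/4.
  have h3 : ∀ τ ∈ Set.Ioi (0 : ℝ), ∫ s : ℝ, F s τ = ((2 * Real.sqrt Real.pi *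
      ((1 + τ) ^ (-c) * (τ * (τ + 2)) ^ (-(1 / 2) : ℝ) * Real.exp (-l ^ 2 / (τ + 2))) : ℝ) : ℂ) := by
    intro τ hτ
    have hτ0 : 0 < τ := hτ
    have hb : 0 < (((τ + 2) / 4 : ℝ) : ℂ).re := by
      rw [Complex.ofReal_re]; positivity
    have hg := fourierIntegral_gaussian hb l
    have e : ∀ s : ℝ, F s τ = ((τ ^ (-(1 / 2) : ℝ) * (1 + τ) ^ (-c) : ℝ) : ℂ) *
        (Complex.exp (Complex.I * l * s) * Complex.exp (-(((τ + 2) / 4 : ℝ) : ℂ) * (s : ℂ) ^ 2)) := by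
      intro s
      simp only [F]
      push_cast
      have : Complex.exp (Complex.I * l * s - (s : ℂ) ^ 2 / 2) *
          Complex.exp (-((s : ℂ) ^ 2 / 4 * τ)) = Complex.exp (Complex.I * l * s) *
          Complex.exp (-((τ + 2) / 4) * (s : ℂ) ^ 2) := by
        rw [← Complex.exp_add, ← Complex.exp_add]
        congr 1
        ring
      linear_combination ((τ ^ (-(1 / 2) : ℝ) : ℝ) : ℂ) * (((1 + τ) ^ (-c) : ℝ) : ℂ) * this
    simp_rw [e]
    rw [integral_const_mul, hg]
    have e2 : ((Real.pi : ℂ) / (((τ + 2) / 4 : ℝ) : ℂ)) ^ (1 / 2 : ℂ) =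
        ((2 * Real.sqrt Real.pi * (τ + 2) ^ (-(1 / 2) : ℝ) : ℝ) : ℂ) := by
      rw [← Complex.ofReal_div, show (1 / 2 : ℂ) = ((1 / 2 : ℝ) : ℂ) by push_cast; rfl,
        ← Complex.ofReal_cpow (by positivity)]
      congr 1
      rw [← Real.sqrt_eq_rpow, Real.rpow_neg (by positivity), ← Real.sqrt_eq_rpow,
        show Real.pi / ((τ + 2) / 4) = 2 ^ 2 * Real.pi / (τ + 2) by field_simp; norm_num,
        Real.sqrt_div (by positivity), Real.sqrt_mul (by positivity), Real.sqrt_sq (by norm_num)]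
      rfl
    have e3 : Complex.exp (-(l : ℂ) ^ 2 / (4 * (((τ + 2) / 4 : ℝ) : ℂ))) =
        ((Real.exp (-l ^ 2 / (τ + 2)) : ℝ) : ℂ) := by
      push_cast
      congr 2
      ring
    rw [e2, e3, Real.mul_rpow hτ0.le (by positivity)]
    push_cast
    ring
  rw [setIntegral_congr_fun measurableSet_Ioi h3, integral_complex_ofReal, ← Complex.ofReal_mul,
    Complex.ofReal_inj] at h1
  rw [h1, integral_const_mul]
  field_simp

/-! ### The semicircle law -/

/-- The integrand in the rescaled product formula. -/
def semicircleKernel (c x s : ℝ) : ℝ :=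
  (1 + s / c) ^ (-c) * (s * (s / c + 2)) ^ (-(1 / 2) : ℝ) * Real.exp (x ^ 2 * s / (2 * (s / c + 2)))

lemma measurable_semicircleKernel (c x : ℝ) : Measurable (semicircleKernel c x) := by
  unfold semicircleKernel
  fun_prop

lemma semicircleKernel_nonneg {c s : ℝ} (hc : 0 < c) (x : ℝ) (hs : 0 < s) :
    0 ≤ semicircleKernel c x s := by
  unfold semicircleKernel
  positivity

/-- Put τ = s/c in the product formula. The factor e^{-l²/2} of the density cancels, and the
remaining powers of c and values of Γ match the factor √c. -/
lemma sqrt_mul_crossoverDensity_eq {c : ℝ} (hc : 2 ≤ c) (x : ℝ) :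
    Real.sqrt c * crossoverDensity c (Real.sqrt c * x) =
      1 / (Real.sqrt (2 * Real.pi) * ∫ s in Set.Ioi (0 : ℝ), semicircleKernel c x s) := by
  have hc0 : 0 < c := by linarith
  have hsc : 0 < Real.sqrt c := Real.sqrt_pos.2 hc0
  have hsc2 : Real.sqrt c ^ 2 = c := Real.sq_sqrt hc0.le
  have hG : 0 < Real.Gamma c := Real.Gamma_pos_of_pos hc0
  set l := Real.sqrt c * x with hl
  have hl2 : l ^ 2 = c * x ^ 2 := by rw [hl, mul_pow, hsc2]
  set g : ℝ → ℝ := fun τ =>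
    (1 + τ) ^ (-c) * (τ * (τ + 2)) ^ (-(1 / 2) : ℝ) * Real.exp (-l ^ 2 / (τ + 2)) with hg
  have hJ : ‖cylH c (-Complex.I * l)‖ ^ 2 =
      c ^ 2 * (Real.Gamma c * ∫ τ in Set.Ioi (0 : ℝ), g τ) := by
    rw [cylH_eq_mul_gaussMellin hc0, norm_mul, mul_pow, norm_gaussMellin_sq hc,
      Complex.norm_of_nonneg hc0.le]
  have hscale : ∫ τ in Set.Ioi (0 : ℝ), g τ =
      Real.exp (-l ^ 2 / 2) / Real.sqrt c * ∫ s in Set.Ioi (0 : ℝ), semicircleKernel c x s := by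
    have h1 := integral_comp_mul_left_Ioi g 0 (inv_pos.2 hc0)
    rw [mul_zero, inv_inv, smul_eq_mul] at h1
    have h2 : ∀ s ∈ Set.Ioi (0 : ℝ), g (c⁻¹ * s) =
        Real.exp (-l ^ 2 / 2) * Real.sqrt c * semicircleKernel c x s := fun s hs => by
      have hs0 : 0 < s := hs
      have e1 : c⁻¹ * s = s / c := by ring
      have e2 : (s / c * (s / c + 2)) ^ (-(1 / 2) : ℝ) =
          Real.sqrt c * (s * (s / c + 2)) ^ (-(1 / 2) : ℝ) := by
        rw [show s / c * (s / c + 2) = c⁻¹ * (s * (s / c + 2)) by ring,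
          Real.mul_rpow (by positivity) (by positivity), Real.inv_rpow hc0.le,
          Real.rpow_neg hc0.le, inv_inv, ← Real.sqrt_eq_rpow]
      -- Here 1/(τ+2) = 1/2 - τ/(2(τ+2)) is used with l² = cx² and τ = s/c.
      have e3 : Real.exp (-l ^ 2 / (s / c + 2)) = Real.exp (-l ^ 2 / 2) *
          Real.exp (x ^ 2 * s / (2 * (s / c + 2))) := by
        rw [← Real.exp_add, hl2]
        congr 1
        have : s / c + 2 ≠ 0 := by positivity
        have : s + 2 * c ≠ 0 := by positivity
        field_simp
        ring
      simp only [g, semicircleKernel]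
      rw [e1, e2, e3]
      ring
    rw [setIntegral_congr_fun measurableSet_Ioi h2, integral_const_mul] at h1
    have h3 : ∫ τ in Set.Ioi (0 : ℝ), g τ = c⁻¹ * (c * ∫ τ in Set.Ioi (0 : ℝ), g τ) := by
      field_simp
    rw [h3, ← h1]
    field_simp
    rw [hsc2]
  rw [crossoverDensity_eq hc0.le, hJ, hscale, add_comm, Real.Gamma_add_one hc0.ne']
  have h2pi : 0 < Real.sqrt (2 * Real.pi) := Real.sqrt_pos.2 (by positivity)
  have he := Real.exp_pos (-l ^ 2 / 2)
  -- Were the integral 0, both sides would be 0 by the conventions on division, so its positivity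
  -- need not be known.
  by_cases hA : ∫ s in Set.Ioi (0 : ℝ), semicircleKernel c x s = 0
  · simp [hA]
  · field_simp
    rw [hsc2]

lemma rpow_mul_add_two_le {s u : ℝ} (hs : 0 < s) (hu : 0 ≤ u) :
    (s * (u + 2)) ^ (-(1 / 2) : ℝ) ≤ s ^ (-(1 / 2) : ℝ) :=
  Real.rpow_le_rpow_of_nonpos hs (by nlinarith) (by norm_num)

lemma integrableOn_semicircleKernel {c : ℝ} (hc : 2 ≤ c) (x : ℝ) :
    IntegrableOn (semicircleKernel c x) (Set.Ioi 0) := by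
  have hc0 : 0 < c := by linarith
  refine Integrable.mono' ((integrableOn_rpow_mul_inv_sq (inv_pos.2 hc0)).const_mul
    (Real.exp (x ^ 2 * c / 2))) (measurable_semicircleKernel c x).aestronglyMeasurable ?_
  filter_upwards [ae_restrict_mem measurableSet_Ioi] with s hs
  have hs0 : 0 < s := hs
  have hu : 0 ≤ s / c := by positivity
  rw [Real.norm_of_nonneg (semicircleKernel_nonneg hc0 x hs0), semicircleKernel]
  have h1 := one_add_rpow_neg_le hc hu
  have h2 := rpow_mul_add_two_le hs0 hu
  have h3 : x ^ 2 * s / (2 * (s / c + 2)) ≤ x ^ 2 * c / 2 := by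
    rw [div_le_div_iff₀ (by positivity) two_pos]
    have : c * (s / c) = s := by field_simp
    nlinarith [mul_nonneg (sq_nonneg x) hc0.le]
  rw [show 1 * (s / c) = c⁻¹ * s by ring] at h1
  calc _ ≤ ((1 + c⁻¹ * s) ^ 2)⁻¹ * s ^ (-(1 / 2) : ℝ) * Real.exp (x ^ 2 * c / 2) := by gcongr
    _ = _ := by ring

/-- With u = s/c and κ = (1 - x²/4)/2, the inequality log(1+u) ≥ 2u/(u+2) bounds the exponential
factor by (1+u)^{cx²/4}. What remains is (1+u)^{-2cκ}, and Bernoulli's inequality gives (1+u)^{cκ} ≥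
1 + κs once cκ ≥ 1. The majorant no longer depends on c. -/
lemma semicircleKernel_le {c x s : ℝ} (hc : 0 < c) (hcx : 1 ≤ c * ((1 - x ^ 2 / 4) / 2))
    (hs : 0 < s) : semicircleKernel c x s ≤
      s ^ (-(1 / 2) : ℝ) * ((1 + (1 - x ^ 2 / 4) / 2 * s) ^ 2)⁻¹ := by
  set κ := (1 - x ^ 2 / 4) / 2 with hκ
  have hκ0 : 0 < κ := pos_of_mul_pos_right (one_pos.trans_le hcx) hc.le
  set u := s / c with hu_def
  have hu : 0 < u := by positivity
  have hcu : c * u = s := by rw [hu_def]; field_simp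
  have h1 : Real.exp (x ^ 2 * s / (2 * (u + 2))) ≤ (1 + u) ^ (c * (1 - 2 * κ)) := by
    rw [Real.rpow_def_of_pos (by linarith)]
    refine Real.exp_le_exp.2 ?_
    have h2 := mul_le_mul_of_nonneg_right (Real.le_log_one_add_of_nonneg hu.le)
      (show 0 ≤ c * (1 - 2 * κ) by rw [hκ]; nlinarith [mul_nonneg hc.le (sq_nonneg x)])
    refine le_trans (le_of_eq ?_) h2
    rw [← hcu, hκ]
    field_simp
    ring
  have h3 : 1 + κ * s ≤ (1 + u) ^ (c * κ) := by
    have := one_add_mul_self_le_rpow_one_add (s := u) (by linarith) hcx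
    rw [← hcu]
    linarith
  have h4 : (1 + u) ^ (-c) * (1 + u) ^ (c * (1 - 2 * κ)) = (((1 + u) ^ (c * κ)) ^ 2)⁻¹ := by
    rw [← Real.rpow_add (by linarith), ← Real.rpow_natCast, ← Real.rpow_mul (by linarith),
      ← Real.rpow_neg (by linarith)]
    congr 1
    push_cast
    ring
  have h5 := rpow_mul_add_two_le hs hu.le
  have h1u : 0 < 1 + u := by linarith
  calc semicircleKernel c x s ≤ (1 + u) ^ (-c) * s ^ (-(1 / 2) : ℝ) *
        (1 + u) ^ (c * (1 - 2 * κ)) := by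
        unfold semicircleKernel
        gcongr
    _ = s ^ (-(1 / 2) : ℝ) * (((1 + u) ^ (c * κ)) ^ 2)⁻¹ := by rw [← h4]; ring
    _ ≤ _ := by gcongr

lemma tendsto_semicircleKernel (x : ℝ) {s : ℝ} (hs : 0 < s) :
    Tendsto (fun c => semicircleKernel c x s) atTop
      (𝓝 (Real.exp (-s) * (s * 2) ^ (-(1 / 2) : ℝ) * Real.exp (x ^ 2 * s / 4))) := by
  have hu : Tendsto (fun c : ℝ => s / c) atTop (𝓝 0) := tendsto_const_nhds.div_atTop tendsto_id
  have h1 : Tendsto (fun c : ℝ => (1 + s / c) ^ (-c)) atTop (𝓝 (Real.exp (-s))) := by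
    rw [Real.exp_neg]
    refine ((Real.tendsto_one_add_div_rpow_exp s).inv₀ (Real.exp_ne_zero s)).congr' ?_
    filter_upwards [eventually_gt_atTop 0] with c hc
    rw [Real.rpow_neg (by positivity)]
  have h2 : Tendsto (fun c : ℝ => (s * (s / c + 2)) ^ (-(1 / 2) : ℝ)) atTop
      (𝓝 ((s * 2) ^ (-(1 / 2) : ℝ))) := by
    have := ((hu.add_const 2).const_mul s).rpow_const (p := (-(1 / 2) : ℝ))
      (Or.inl (by rw [zero_add]; positivity))
    simpa only [zero_add] using this
  have h3 : Tendsto (fun c : ℝ => Real.exp (x ^ 2 * s / (2 * (s / c + 2)))) atTop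
      (𝓝 (Real.exp (x ^ 2 * s / 4))) := by
    have := (tendsto_const_nhds (x := x ^ 2 * s)).div ((hu.add_const 2).const_mul 2) (by norm_num)
    rw [zero_add, show (2 : ℝ) * 2 = 4 by norm_num] at this
    exact (Real.continuous_exp.tendsto _).comp this
  exact (h1.mul h2).mul h3

lemma integral_semicircleKernel_limit {x : ℝ} (hx : x ^ 2 < 4) :
    ∫ s in Set.Ioi (0 : ℝ), Real.exp (-s) * (s * 2) ^ (-(1 / 2) : ℝ) * Real.exp (x ^ 2 * s / 4) =
      Real.sqrt (2 * Real.pi) / Real.sqrt (4 - x ^ 2) := by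
  have hr : 0 < 1 - x ^ 2 / 4 := by linarith
  have h1 := Real.integral_rpow_mul_exp_neg_mul_Ioi (a := 1 / 2) (by norm_num) hr
  rw [show (1 / 2 - 1 : ℝ) = -(1 / 2) by norm_num, Real.Gamma_one_half_eq,
    ← Real.sqrt_eq_rpow] at h1
  have h2 : ∀ s ∈ Set.Ioi (0 : ℝ),
      Real.exp (-s) * (s * 2) ^ (-(1 / 2) : ℝ) * Real.exp (x ^ 2 * s / 4) =
      (Real.sqrt 2)⁻¹ * (s ^ (-(1 / 2) : ℝ) * Real.exp (-((1 - x ^ 2 / 4) * s))) := fun s hs => by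
    have hs0 : 0 < s := hs
    rw [Real.mul_rpow hs0.le two_pos.le, Real.rpow_neg two_pos.le, ← Real.sqrt_eq_rpow,
      show -((1 - x ^ 2 / 4) * s) = -s + x ^ 2 * s / 4 by ring, Real.exp_add]
    ring
  rw [setIntegral_congr_fun measurableSet_Ioi h2, integral_const_mul, h1,
    show 1 / (1 - x ^ 2 / 4) = 2 ^ 2 / (4 - x ^ 2) by
      have : 4 - x ^ 2 ≠ 0 := by linarith
      field_simp; norm_num,
    Real.sqrt_div (by norm_num), Real.sqrt_sq two_pos.le, Real.sqrt_mul two_pos.le]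
  have h4 : Real.sqrt 2 ^ 2 = 2 := Real.sq_sqrt two_pos.le
  have h5 : Real.sqrt (4 - x ^ 2) ≠ 0 := (Real.sqrt_pos.2 (by linarith)).ne'
  have h6 : Real.sqrt 2 ≠ 0 := (Real.sqrt_pos.2 two_pos).ne'
  field_simp
  rw [h4]

lemma tendsto_sqrt_mul_crossoverDensity_of_lt {x : ℝ} (hx : x ^ 2 < 4) :
    Tendsto (fun c : ℝ => Real.sqrt c * crossoverDensity c (Real.sqrt c * x))
      atTop (𝓝 (1 / (2 * Real.pi) * Real.sqrt (4 - x ^ 2))) := by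
  have hκ : 0 < (1 - x ^ 2 / 4) / 2 := by linarith
  have hlim : Tendsto (fun c => ∫ s in Set.Ioi (0 : ℝ), semicircleKernel c x s) atTop
      (𝓝 (Real.sqrt (2 * Real.pi) / Real.sqrt (4 - x ^ 2))) := by
    rw [← integral_semicircleKernel_limit hx]
    refine tendsto_integral_filter_of_dominated_convergence _
      (Eventually.of_forall fun c => (measurable_semicircleKernel c x).aestronglyMeasurable)
      ?_ (integrableOn_rpow_mul_inv_sq hκ) ?_
    · have hev := (tendsto_id (x := atTop (α := ℝ))).atTop_mul_const hκ
      filter_upwards [hev.eventually_ge_atTop 1, eventually_gt_atTop 0] with c h1 hc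
      filter_upwards [ae_restrict_mem measurableSet_Ioi] with s hs
      rw [Real.norm_of_nonneg (semicircleKernel_nonneg hc x hs)]
      exact semicircleKernel_le hc h1 hs
    · filter_upwards [ae_restrict_mem measurableSet_Ioi] with s hs
      exact tendsto_semicircleKernel x hs
  have h4 : 0 < Real.sqrt (4 - x ^ 2) := Real.sqrt_pos.2 (by linarith)
  have h2pi : 0 < Real.sqrt (2 * Real.pi) := Real.sqrt_pos.2 (by positivity)
  have hsq : Real.sqrt (2 * Real.pi) ^ 2 = 2 * Real.pi := Real.sq_sqrt (by positivity)
  have h := (tendsto_const_nhds (x := (1 : ℝ))).div (hlim.const_mul (Real.sqrt (2 * Real.pi)))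
    (by positivity)
  have e : 1 / (Real.sqrt (2 * Real.pi) * (Real.sqrt (2 * Real.pi) / Real.sqrt (4 - x ^ 2))) =
      1 / (2 * Real.pi) * Real.sqrt (4 - x ^ 2) := by
    rw [mul_div_assoc', ← sq, hsq]
    field_simp
  rw [e] at h
  refine h.congr' ?_
  filter_upwards [eventually_ge_atTop 2] with c hc
  exact (sqrt_mul_crossoverDensity_eq hc x).symm

/-- The kernel increases with x² and its integral stands in the denominator. This replaces dominated
convergence where |x| ≥ 2. -/
lemma sqrt_mul_crossoverDensity_anti {c x y : ℝ} (hc : 2 ≤ c) (hxy : x ^ 2 ≤ y ^ 2) :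
    Real.sqrt c * crossoverDensity c (Real.sqrt c * y) ≤
      Real.sqrt c * crossoverDensity c (Real.sqrt c * x) := by
  have hc0 : 0 < c := by linarith
  have hpos : 0 < Real.sqrt c * crossoverDensity c (Real.sqrt c * x) :=
    mul_pos (Real.sqrt_pos.2 hc0) (crossoverDensity_pos hc0.le _)
  rw [sqrt_mul_crossoverDensity_eq hc] at hpos ⊢
  rw [sqrt_mul_crossoverDensity_eq hc]
  refine one_div_le_one_div_of_le (one_div_pos.1 hpos)
    (mul_le_mul_of_nonneg_left ?_ (Real.sqrt_nonneg _))
  refine setIntegral_mono_on (integrableOn_semicircleKernel hc x)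
    (integrableOn_semicircleKernel hc y) measurableSet_Ioi fun s hs => ?_
  have hs0 : 0 < s := hs
  unfold semicircleKernel
  gcongr

theorem tendsto_sqrt_mul_crossoverDensity (x : ℝ) :
    Tendsto (fun c : ℝ => Real.sqrt c * crossoverDensity c (Real.sqrt c * x))
      atTop (𝓝 (1 / (2 * Real.pi) * Real.sqrt (4 - x ^ 2))) := by
  rcases lt_or_ge (x ^ 2) 4 with hx | hx
  · exact tendsto_sqrt_mul_crossoverDensity_of_lt hx
  rw [Real.sqrt_eq_zero_of_nonpos (by linarith), mul_zero]
  refine tendsto_order.2 ⟨fun a ha => ?_, fun a ha => ?_⟩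
  · filter_upwards [eventually_gt_atTop 0] with c hc
    exact ha.trans (mul_pos (Real.sqrt_pos.2 hc) (crossoverDensity_pos hc.le _))
  -- Compare with a point y just below 2, where the limiting density is already smaller than a.
  · have hcont : Tendsto (fun y : ℝ => 1 / (2 * Real.pi) * Real.sqrt (4 - y ^ 2)) (𝓝[<] 2)
        (𝓝 0) := by
      have : Continuous fun y : ℝ => 1 / (2 * Real.pi) * Real.sqrt (4 - y ^ 2) := by fun_prop
      have h := this.tendsto 2
      rw [show (4 : ℝ) - 2 ^ 2 = 0 by norm_num, Real.sqrt_zero, mul_zero] at h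
      exact h.mono_left nhdsWithin_le_nhds
    obtain ⟨y, hya, hy⟩ := ((hcont.eventually_lt_const ha).and
      (Ioo_mem_nhdsLT (show (0 : ℝ) < 2 by norm_num))).exists
    have hy4 : y ^ 2 < 4 := by nlinarith [hy.1, hy.2]
    filter_upwards [(tendsto_sqrt_mul_crossoverDensity_of_lt hy4).eventually_lt_const hya,
      eventually_ge_atTop 2] with c h1 hc
    exact (sqrt_mul_crossoverDensity_anti hc (by linarith)).trans_lt h1

end

theorem mainTheorem2 :
    -- all the claims at a fixed value of the parameter
    (∀ c : ℝ, 0 ≤ c →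
      -- the `β`-ensemble with `β = 2c/N` is a stationary probability law of the dynamics
      (∀ N : ℕ, 0 < N →
        Integrable (gibbsWeight c N) ∧ 0 < partitionFunction c N ∧
        IsProbabilityMeasure (betaEnsemble c N) ∧
        IsStationaryFokkerPlanck c N (betaEnsemble c N)) ∧
      -- the formula for the density makes sense, and it is the limiting stationary density
      (∀ l : ℝ, parabolicCylinderD (-(c : ℂ)) (Complex.I * (l : ℂ)) ≠ 0) ∧
      (∀ ρ : ℝ → ℝ, IsLimitingStationaryDensity c ρ ↔ ρ =ᵐ[volume] crossoverDensity c) ∧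
      -- its Stieltjes transform solves the Riccati equation with the boundary condition at infinity
      SolvesRiccati c (stieltjesTransform (crossoverDensity c)) ∧
      HasStieltjesDecay (stieltjesTransform (crossoverDensity c)) ∧
      -- and is the only solution of this problem
      (∀ G : ℂ → ℂ, SolvesRiccati c G → HasStieltjesDecay G →
        ∀ z : ℂ, z.im ≠ 0 → G z = stieltjesTransform (crossoverDensity c) z) ∧
      -- from which the density is recovered by the inversion formula
      (∀ l : ℝ, Tendsto
        (fun ε : ℝ => (1 / Real.pi) *
          (stieltjesTransform (crossoverDensity c) ((l : ℂ) + Complex.I * (ε : ℂ))).im)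
        (𝓝[>] 0) (𝓝 (crossoverDensity c l)))) ∧
    -- integral representation of the parabolic cylinder function
    (∀ c : ℝ, 0 < c → ∀ z : ℂ,
      IntegrableOn
        (fun x : ℝ => Complex.exp (-z * (x : ℂ) - (x : ℂ) ^ 2 / 2) * ((x ^ (c - 1) : ℝ) : ℂ))
        (Set.Ioi 0) ∧
      parabolicCylinderD (-(c : ℂ)) z =
        Complex.exp (-z ^ 2 / 4) / (Real.Gamma c : ℂ) *
          ∫ x : ℝ in Set.Ioi 0,
            Complex.exp (-z * (x : ℂ) - (x : ℂ) ^ 2 / 2) * ((x ^ (c - 1) : ℝ) : ℂ)) ∧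
    -- interpolation: continuity in the parameter, the Gaussian at `c = 0`, and the semicircle
    -- as `c → ∞` (`Real.sqrt` vanishes on negative numbers)
    (∀ l : ℝ, ContinuousOn (fun c : ℝ => crossoverDensity c l) (Set.Ici 0)) ∧
    (∀ l : ℝ, crossoverDensity 0 l = Real.exp (-l ^ 2 / 2) / Real.sqrt (2 * Real.pi)) ∧
    (∀ x : ℝ, Tendsto (fun c : ℝ => Real.sqrt c * crossoverDensity c (Real.sqrt c * x))
      atTop (𝓝 (1 / (2 * Real.pi) * Real.sqrt (4 - x ^ 2)))) := by
  refine ⟨fun c hc => ?_, fun c hc z => ?_, continuousOn_crossoverDensity_param,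
    crossoverDensity_zero_left, tendsto_sqrt_mul_crossoverDensity⟩
  · obtain ⟨hP, hR⟩ := solvesRiccatiUpper_crossoverMeasure hc
    have hS : stieltjesTransform (crossoverDensity c) = stieltjesOf (crossoverMeasure c) :=
      funext fun z => (stieltjesOf_crossoverMeasure hc z).symm
    rw [hS]
    refine ⟨fun N _ => ⟨integrable_gibbsWeight hc N, partitionFunction_pos hc N,
      isProbabilityMeasure_betaEnsemble hc N, isStationaryFokkerPlanck_betaEnsemble hc N⟩,
      fun l h => ?_, isLimitingStationaryDensity_iff hc, solvesRiccati_stieltjesOf hR,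
      hasStieltjesDecay_stieltjesOf hc hR, fun G hG hd z hz =>
        hG.unique (solvesRiccati_stieltjesOf hR) hd (hasStieltjesDecay_stieltjesOf hc hR) hz,
      tendsto_im_of_solvesRiccatiUpper hc hR (tendsto_stieltjesOf _)⟩
    have h1 := norm_parabolicCylinderD hc l
    rw [h, norm_zero] at h1
    have h2 := norm_pos_iff.2 (cylH_ne_zero hc l)
    have h3 := Real.Gamma_pos_of_pos (show 0 < 1 + c by linarith)
    have h4 : 0 < Real.exp (l ^ 2 / 4) / Real.Gamma (1 + c) * ‖cylH c (-Complex.I * l)‖ := by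
      positivity
    exact h4.ne h1
  · have h1 := integrableOn_gaussMellin (kernelDecay_one z) one_pos hc
    have h2 := parabolicCylinderD_eq_integral hc z
    rw [gaussMellin] at h2
    simp only [one_mul] at h1 h2
    exact ⟨h1, h2⟩
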